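/- **Setting.** Modules occupy cells of a rectangular field $\{0,\dots,w-1\}\times\{0,\dots,h-1\}$ of the square grid ($w>h$) surrounded by a ring of wall cells, at most one module per cell. Two metamorphic robotic systems (MRSs) $R_1,R_2$ of sizes $n_1,n_2\ge 1$ are placed in the field, each of them connected with respect to side-adjacency. Time is discrete and the modules are synchronous, anonymous, oblivious and run a common deterministic algorithm: in each step every module observes, for each cell at Chebyshev distance at most $k$ (the visibility range), whether the cell is empty, occupied by a module, or a wall, in its own right-handed local coordinate system (centred at the module, axes parallel to the grid), and from this observation alone the algorithm computes its movement, expressed in the same local coordinates. A movement is: to stay; a rotation by $\pi/2$ around a side-adjacent module; or, for some $\ell\ge1$, a sliding by $\ell$ cells along a straight line of $\ell+1$ modules parallel to the movement. The guiding modules must not move in the same step, the cells passed and the destination must be empty cells of the field, the trajectories of different modules must not overlap, the non-moving modules of each MRS must be connected, and each MRS must be connected after the step. The modules have no global compass: the directions of the local coordinate systems are arbitrary, and an algorithm has to work for all choices of them. An algorithm solves the rendezvous problem from an initial configuration, for a given choice of the local coordinate systems, if all movements in the resulting execution obey these rules and at some finite time every module observes all modules of $R_1\cup R_2$ and no module moves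 from then on. The state of an MRS is called symmetric if a rotation of the plane maps its set of occupied cells to itself and moves at least one of these cells. **Theorem 3.** Two MRSs each of which consists of fewer than five modules, without a global compass, cannot solve the rendezvous problem. Precisely: let $k\ge0$ and $1\le n_1,n_2\le4$. There is $N$ such that for all $w>h\ge N$ and for every algorithm with visibility range $k$ (which may depend on $k,n_1,n_2,w,h$): 1. there are an initial configuration in the $w\times h$ field in which the state of each MRS of size $\neq2$ is not symmetric (two connected modules always form a symmetric state), and a choice of the local coordinate systems used by the modules at the successive observations, for which the algorithm does not solve the rendezvous problem; 2. if the local coordinate system of each module is required to keep its directions during the whole execution, there still are an initial configuration in the $w\times h$ field and a choice of the local coordinate systems for which the algorithm does not solve the rendezvous problem. -/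

import Mathlib

namespace MRS

/-- Cells of the square grid; `(x, y)` is the cell whose bottom left corner is `(x, y)`. -/
abbrev Cell := ℤ × ℤ

/-- Counterclockwise rotation of an offset by a right angle. -/
def quarter (d : Cell) : Cell := (-d.2, d.1)

/-- Counterclockwise rotation of an offset by `r` right angles. -/
def turn (r : Fin 4) (d : Cell) : Cell := quarter^[r.val] d

/-- The four unit vectors, numbered counterclockwise from `(1, 0)`. -/
def dirVec (j : Fin 4) : Cell := turn j (1, 0)

/-- Two cells share a side. -/
def SideAdj (p q : Cell) : Prop := |p.1 - q.1| + |p.2 - q.2| = 1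

/-- The cells of the field of width `w` and height `h`. -/
def InField (w h : ℕ) (c : Cell) : Prop :=
  0 ≤ c.1 ∧ c.1 < (w : ℤ) ∧ 0 ≤ c.2 ∧ c.2 < (h : ℤ)

/-- The cells of the north, south, east and west walls. -/
def IsWall (w h : ℕ) (c : Cell) : Prop :=
  (-1 ≤ c.1 ∧ c.1 ≤ (w : ℤ) ∧ (c.2 = (h : ℤ) ∨ c.2 = -1)) ∨
  ((c.1 = (w : ℤ) ∨ c.1 = -1) ∧ -1 ≤ c.2 ∧ c.2 ≤ (h : ℤ))

/-- The modules of two MRSs of sizes `n₁` and `n₂`. The indices are only names: the modules are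
anonymous and never see them. -/
abbrev Modules (n₁ n₂ : ℕ) := Fin n₁ ⊕ Fin n₂

/-- The size of the first (`true`) or of the second (`false`) MRS. -/
def size (n₁ n₂ : ℕ) (b : Bool) : ℕ := if b then n₁ else n₂

/-- The set of modules of the first (`true`) or of the second (`false`) MRS. -/
def members (n₁ n₂ : ℕ) (b : Bool) : Set (Modules n₁ n₂) := {m | m.isLeft = b}

/-- The side-adjacency graph of the modules placed at `pos`. -/
def sideGraph {ι : Type} (pos : ι → Cell) : SimpleGraph ι where
  Adj a b := SideAdj (pos a) (pos b)
  symm := ⟨fun a b hab => by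
    unfold SideAdj at *
    rwa [abs_sub_comm (pos b).1, abs_sub_comm (pos b).2]⟩
  loopless := ⟨fun a ha => by simp [SideAdj] at ha⟩

/-- The set `s` of modules, placed at `pos`, is connected (an empty set counts as connected). -/
def Connected {ι : Type} (pos : ι → Cell) (s : Set ι) : Prop :=
  ((sideGraph pos).induce s).Preconnected

/-- A finite set of cells is symmetric if some rotation of the grid by a multiple of a right angle
maps it to itself and exchanges at least one cell with another one. -/
def SymmetricState (S : Set Cell) : Prop :=
  ∃ (r : Fin 4) (v : Cell), r ≠ 0 ∧ (fun c => turn r c + v) '' S = S ∧ ∃ c ∈ S, turn r c + v ≠ c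

/-! ### Observation -/

/-- What a module sees in a cell. -/
inductive Content where
  | empty
  | occupied
  | wall

open Classical in
/-- The content of a cell when the modules are at `pos`. -/
noncomputable def content {ι : Type} (w h : ℕ) (pos : ι → Cell) (c : Cell) : Content :=
  if IsWall w h c then Content.wall
  else if ∃ m, pos m = c then Content.occupied
  else Content.empty

/-- The local coordinates of the cells within visibility range `k`. -/
abbrev Window (k : ℕ) := {d : Cell // |d.1| ≤ (k : ℤ) ∧ |d.2| ≤ (k : ℤ)}

/-- An observation, in local coordinates. -/
abbrev View (k : ℕ) := Window k → Content

/-- The observation of module `m` whose (right-handed) local frame is the global one turned by `r`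
right angles: the cell with local coordinates `d` is the cell `pos m + turn r d`. -/
noncomputable def view {ι : Type} (k w h : ℕ) (pos : ι → Cell) (r : Fin 4) (m : ι) : View k :=
  fun d => content w h pos (pos m + turn r d.1)

/-! ### Movements -/

/-- What a module can do in one step, in local coordinates.
`rotate j ccw`: rotation by a right angle, counterclockwise iff `ccw`, around the side-adjacent
module in direction `j`.
`slide j left l`: sliding by `l` cells in direction `j`, along a line of modules that is on the left
of the direction of movement iff `left`. -/
inductive Action where
  | stay
  | rotate (j : Fin 4) (ccw : Bool)
  | slide (j : Fin 4) (left : Bool) (l : ℕ)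

/-- A common deterministic algorithm of oblivious modules with visibility range `k`. -/
abbrev Algorithm (k : ℕ) := View k → Action

/-- A right angle counterclockwise (`true`) or clockwise (`false`). -/
def spin (b : Bool) (d : Cell) : Cell := if b then turn 1 d else turn 3 d

/-- The cell that a module at `p` with frame `r` reaches by an action. -/
def dest (p : Cell) (r : Fin 4) : Action → Cell
  | .stay => p
  | .rotate j ccw => p + turn r (dirVec j) + spin ccw (-turn r (dirVec j))
  | .slide j _ l => p + (l : ℤ) • turn r (dirVec j)

/-- The cells through which the module moves, its destination included and its start excluded. -/
def swept (p : Cell) (r : Fin 4) : Action → Set Cell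
  | .stay => ∅
  | .rotate j ccw =>
      {p + spin ccw (-turn r (dirVec j)),
       p + turn r (dirVec j) + spin ccw (-turn r (dirVec j))}
  | .slide j _ l => {c | ∃ i : ℕ, 1 ≤ i ∧ i ≤ l ∧ c = p + (i : ℤ) • turn r (dirVec j)}

/-- The cells of the modules that have to guide the movement. -/
def guides (p : Cell) (r : Fin 4) : Action → Set Cell
  | .stay => ∅
  | .rotate j _ => {p + turn r (dirVec j)}
  | .slide j left l =>
      {c | ∃ i : ℕ, i ≤ l ∧
        c = p + spin left (turn r (dirVec j)) + (i : ℤ) • turn r (dirVec j)}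

/-- A sliding has positive length. -/
def Action.Proper : Action → Prop
  | .slide _ _ l => 1 ≤ l
  | _ => True

/-- The simultaneous movements `act` of modules placed at `pos` with local frames `frame` respect
all rules of the MRS model. -/
structure Legal {n₁ n₂ : ℕ} (w h : ℕ) (pos : Modules n₁ n₂ → Cell)
    (frame : Modules n₁ n₂ → Fin 4) (act : Modules n₁ n₂ → Action) : Prop where
  /-- slidings have positive length -/
  proper : ∀ m, (act m).Proper
  /-- every guiding cell holds a module that does not move -/
  guided : ∀ m, ∀ c ∈ guides (pos m) (frame m) (act m), ∃ m', pos m' = c ∧ act m' = .stay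
  /-- modules move inside the field, through and into empty cells -/
  through_empty : ∀ m, ∀ c ∈ swept (pos m) (frame m) (act m), InField w h c ∧ ∀ m', pos m' ≠ c
  /-- trajectories do not overlap -/
  no_overlap : ∀ m m', m ≠ m' →
    Disjoint (swept (pos m) (frame m) (act m)) (swept (pos m') (frame m') (act m'))
  /-- the backbone of each MRS (its modules that do not move) is connected -/
  backbone : ∀ b, Connected pos (members n₁ n₂ b ∩ {m | act m = .stay})
  /-- each MRS is connected after the step -/
  connected : ∀ b, Connected (fun m => dest (pos m) (frame m) (act m)) (members n₁ n₂ b)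

/-! ### Executions -/

/-- The actions that the algorithm `A` prescribes. -/
noncomputable def actions {n₁ n₂ k : ℕ} (w h : ℕ) (A : Algorithm k) (pos : Modules n₁ n₂ → Cell)
    (frame : Modules n₁ n₂ → Fin 4) (m : Modules n₁ n₂) : Action :=
  A (view k w h pos (frame m) m)

/-- The execution of `A` from `init`, where `frames t m` is the local frame that module `m` uses
at time `t`. -/
noncomputable def exec {n₁ n₂ k : ℕ} (w h : ℕ) (A : Algorithm k) (init : Modules n₁ n₂ → Cell)
    (frames : ℕ → Modules n₁ n₂ → Fin 4) : ℕ → Modules n₁ n₂ → Cell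
  | 0 => init
  | t + 1 => fun m =>
      dest (exec w h A init frames t m) (frames t m)
        (actions w h A (exec w h A init frames t) (frames t) m)

/-- Initial configurations: two connected MRSs in the field, at most one module in each cell. -/
structure IsInitial {n₁ n₂ : ℕ} (w h : ℕ) (init : Modules n₁ n₂ → Cell) : Prop where
  inField : ∀ m, InField w h (init m)
  injective : Function.Injective init
  connected : ∀ b, Connected init (members n₁ n₂ b)

/-- Each module observes all modules of the two MRSs. -/
def Gathered {n₁ n₂ : ℕ} (k : ℕ) (pos : Modules n₁ n₂ → Cell) : Prop :=
  ∀ m m', |(pos m).1 - (pos m').1| ≤ (k : ℤ) ∧ |(pos m).2 - (pos m').2| ≤ (k : ℤ)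

/-- Under the local frames `frames`, the algorithm `A` solves the rendezvous problem from `init`:
all its movements are legal, and at some time all modules observe each other and never move
again. -/
def SolvesRendezvous {n₁ n₂ k : ℕ} (w h : ℕ) (A : Algorithm k) (init : Modules n₁ n₂ → Cell)
    (frames : ℕ → Modules n₁ n₂ → Fin 4) : Prop :=
  (∀ t, Legal w h (exec w h A init frames t) (frames t)
    (actions w h A (exec w h A init frames t) (frames t))) ∧
  ∃ T, Gathered k (exec w h A init frames T) ∧
    ∀ t, T ≤ t → ∀ m, actions w h A (exec w h A init frames t) (frames t) m = .stay

end MRS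

/-!
The two MRSs are kept so far from each other for ever that no module of one of them is seen or
touched by the other. Then each of them moves as if it were alone in the field
(`not_solves_of_far`), and it remains to control the motion of a single MRS of at most four modules
by the choice of the local frames. An illegal step ends the execution unsolved, so it may be treated
as if nothing moved (`stepOf`).

If the frames of the modules of a centrally symmetric MRS are chosen opposite to each other, the MRS
stays centrally symmetric with the same centre, hence near that centre for ever (`SymBy.step`). A
module at the centre itself does no harm: it cannot move, because in an MRS of at most four modules
the backbone would fall apart. For this it is enough to fix the frames once and for all, so straight
rows prove the second part of the theorem (`row_trapped`).

For the first part, the MRSs of three and four modules have to start in a state without rotational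
symmetry, that is, up to motions, as the L triomino or as one of the tetrominoes T, L, J. While no
wall is in sight, the frames of such a state are attached to its shape, so its motion in the plane
is determined by a function `f` that assigns to each shape its successor, a shape together with a
motion of the plane, or a centrally symmetric state (`Describes`). There are finitely many
legal steps, and inspection of all functions `f` shows that either some shape leads to a
centrally symmetric state or to a periodic motion, so that the adversary can confine the MRS to a
small part of the field (`Trappable`), or else the algorithm is a walker: each of T, L, J becomes an
L, which moves by one cell along its long side every two or three steps (`trappable_or_walks`). The
triomino can always be confined.

A walker reaches the walls. There the adversary attaches all frames to the wall (`wallFrame`), which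
makes the motion equivariant under the translations along the wall and under the half turns that
exchange the wall with the opposite one. Near the wall there are only boundedly many states up to
translation, so a walker that leaves the wall again does so after a bounded time and is displaced by
a bounded amount along the wall (`Trail.not_low_long`). It then crosses the field and arrives at the
opposite wall in the state turned by a half turn, so its next visit is the image of the previous one
under a half turn; the two displacements cancel, and every walk far from the walls follows, up to a
bounded error, the initial line (`Trail.line_of_north`). This does not exclude that the walker
goes around the field close to the walls, but it never leaves both the surroundings of the walls and
a strip around the initial line (`Trail.near_wall_or_line`). A confined MRS can be placed
elsewhere (`lone_walker_trapped`), and if both MRSs are walkers, the second one is made the image of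
the first one under the half turn of the field, so that they are near opposite walls or in distant
strips at any time (`lone_walker_walker`).
-/

namespace MRS

/-! ### Motions of the grid -/

lemma turn_zero (d : Cell) : turn 0 d = d := rfl
lemma turn_one (d : Cell) : turn 1 d = (-d.2, d.1) := rfl
lemma turn_two (d : Cell) : turn 2 d = (-d.1, -d.2) := rfl
lemma turn_three (d : Cell) : turn 3 d = (- -d.2, -d.1) := rfl

lemma fin_four_cases (r : Fin 4) : r = 0 ∨ r = 1 ∨ r = 2 ∨ r = 3 := by
  fin_cases r <;> simp

lemma turn_add (r : Fin 4) (a b : Cell) : turn r (a + b) = turn r a + turn r b := by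
  rcases fin_four_cases r with rfl | rfl | rfl | rfl <;>
    simp only [turn_zero, turn_one, turn_two, turn_three] <;> ext <;> simp <;> ring

lemma turn_neg (r : Fin 4) (a : Cell) : turn r (-a) = -turn r a := by
  rcases fin_four_cases r with rfl | rfl | rfl | rfl <;>
    simp only [turn_zero, turn_one, turn_two, turn_three] <;> ext <;> simp

lemma turn_sub (r : Fin 4) (a b : Cell) : turn r (a - b) = turn r a - turn r b := by
  rw [sub_eq_add_neg, turn_add, turn_neg, ← sub_eq_add_neg]

lemma turn_smul (r : Fin 4) (n : ℤ) (a : Cell) : turn r (n • a) = n • turn r a := by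
  rcases fin_four_cases r with rfl | rfl | rfl | rfl <;>
    simp only [turn_zero, turn_one, turn_two, turn_three] <;> ext <;> simp

lemma turn_turn (r s : Fin 4) (a : Cell) : turn r (turn s a) = turn (r + s) a := by
  rcases fin_four_cases r with rfl | rfl | rfl | rfl <;>
    rcases fin_four_cases s with rfl | rfl | rfl | rfl <;>
    simp [turn_zero, turn_one, turn_two, turn_three]

lemma turn_spin (r : Fin 4) (b : Bool) (a : Cell) : turn r (spin b a) = spin b (turn r a) := by
  cases b <;> simp [spin, turn_turn, add_comm]

lemma turn_injective (r : Fin 4) : Function.Injective (turn r) := by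
  intro a b h
  have := congrArg (turn (-r)) h
  simpa [turn_turn, turn_zero] using this

/-- A rotation by right angles about the origin followed by a translation. -/
abbrev Motion := Fin 4 × Cell

/-- The image of a cell under a motion. -/
def place (g : Motion) (c : Cell) : Cell := g.2 + turn g.1 c

/-- The motion `g'` followed by the motion `g`. -/
def comp (g g' : Motion) : Motion := (g.1 + g'.1, g.2 + turn g.1 g'.2)

lemma place_comp (g g' : Motion) (c : Cell) : place (comp g g') c = place g (place g' c) := by
  simp [place, comp, turn_add, turn_turn, add_assoc]

lemma place_injective (g : Motion) : Function.Injective (place g) := fun a b h =>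
  turn_injective g.1 (by simpa [place] using h)

lemma place_add (g : Motion) (a b : Cell) : place g (a + b) = place g a + turn g.1 b := by
  simp [place, turn_add, add_assoc]

lemma comp_assoc (a b c : Motion) : comp (comp a b) c = comp a (comp b c) := by
  simp [comp, turn_add, turn_turn, add_assoc]

lemma comp_zero (a : Motion) : comp a (0, 0) = a := by
  have : turn a.1 (0 : Cell) = 0 := by
    rcases fin_four_cases a.1 with h | h | h | h <;> rw [h] <;> rfl
  simp [comp, this]

lemma place_zero (c : Cell) : place (0, 0) c = c := by simp [place, turn_zero]

/-- The motion undoing `g`. -/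
def inv (g : Motion) : Motion := (-g.1, -turn (-g.1) g.2)

lemma comp_inv (g : Motion) : comp g (inv g) = (0, 0) := by
  simp [comp, inv, turn_neg, turn_turn, turn_zero]

lemma inv_comp (g : Motion) : comp (inv g) g = (0, 0) := by
  simp [comp, inv]

lemma place_inv (g : Motion) (c : Cell) : place g (place (inv g) c) = c := by
  rw [← place_comp, comp_inv, place_zero]

/-- The two cells are at Chebyshev distance at most `K`. -/
def Near (K : ℤ) (c d : Cell) : Prop := |c.1 - d.1| ≤ K ∧ |c.2 - d.2| ≤ K

lemma near_place (g : Motion) (K : ℤ) (c d : Cell) :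
    Near K (place g c) (place g d) ↔ Near K c d := by
  obtain ⟨r, v⟩ := g
  rcases fin_four_cases r with rfl | rfl | rfl | rfl <;>
    simp only [Near, place, turn_zero, turn_one, turn_two, turn_three, Prod.fst_add, Prod.snd_add,
      abs_le] <;> constructor <;> rintro ⟨⟨_, _⟩, _, _⟩ <;> refine ⟨⟨?_, ?_⟩, ?_, ?_⟩ <;> linarith

lemma sideAdj_place (g : Motion) (c d : Cell) :
    SideAdj (place g c) (place g d) ↔ SideAdj c d := by
  obtain ⟨r, v⟩ := g
  have e1 : ∀ a b c : ℤ, a + -b - (a + -c) = -(b - c) := by intros; ring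
  have e2 : ∀ a b c : ℤ, a + b - (a + c) = b - c := by intros; ring
  rcases fin_four_cases r with rfl | rfl | rfl | rfl <;>
    simp only [SideAdj, place, turn_zero, turn_one, turn_two, turn_three, Prod.fst_add,
      Prod.snd_add, e1, e2, abs_neg, neg_neg]
  all_goals rw [add_comm]

lemma dest_place (g : Motion) (p : Cell) (r : Fin 4) (a : Action) :
    dest (place g p) (g.1 + r) a = place g (dest p r a) := by
  cases a <;> simp [dest, place, turn_add, turn_turn, turn_smul, turn_spin, turn_neg, add_assoc,
    -zsmul_eq_mul, -natCast_zsmul]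

lemma swept_place (g : Motion) (p : Cell) (r : Fin 4) (a : Action) :
    swept (place g p) (g.1 + r) a = place g '' swept p r a := by
  cases a with
  | stay => simp [swept]
  | rotate j b =>
    simp [swept, Set.image_pair, place, turn_add, turn_turn, turn_spin, turn_neg, add_assoc]
  | slide j b l =>
    ext c
    simp only [swept, Set.mem_ofPred_eq, Set.mem_image]
    constructor
    · rintro ⟨i, h1, h2, rfl⟩
      exact ⟨_, ⟨i, h1, h2, rfl⟩, by simp [place, turn_add, turn_turn, turn_smul, add_assoc,
        -zsmul_eq_mul, -natCast_zsmul]⟩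
    · rintro ⟨_, ⟨i, h1, h2, rfl⟩, rfl⟩
      exact ⟨i, h1, h2, by simp [place, turn_add, turn_turn, turn_smul, add_assoc,
        -zsmul_eq_mul, -natCast_zsmul]⟩

lemma guides_place (g : Motion) (p : Cell) (r : Fin 4) (a : Action) :
    guides (place g p) (g.1 + r) a = place g '' guides p r a := by
  cases a with
  | stay => simp [guides]
  | rotate j b => simp [guides, place, turn_add, turn_turn, add_assoc]
  | slide j b l =>
    ext c
    simp only [guides, Set.mem_ofPred_eq, Set.mem_image]
    constructor
    · rintro ⟨i, h2, rfl⟩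
      exact ⟨_, ⟨i, h2, rfl⟩,
        by simp [place, turn_add, turn_turn, turn_smul, turn_spin, add_assoc,
          -zsmul_eq_mul, -natCast_zsmul]⟩
    · rintro ⟨_, ⟨i, h2, rfl⟩, rfl⟩
      exact ⟨i, h2, by simp [place, turn_add, turn_turn, turn_smul, turn_spin, add_assoc,
          -zsmul_eq_mul, -natCast_zsmul]⟩

/-! ### Connectedness through cuts -/

section
variable {ι : Type}

/-- Every cut of `s` into two nonempty parts is crossed by two side-adjacent modules. This is a
form of connectedness that is checked by evaluation on small index types. -/
def Linked (pos : ι → Cell) (s : Set ι) : Prop :=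
  ∀ T : ι → Bool, (∃ a ∈ s, T a = true) → (∃ b ∈ s, T b = false) →
    ∃ a ∈ s, ∃ b ∈ s, T a = true ∧ T b = false ∧ SideAdj (pos a) (pos b)

lemma connected_iff_linked (pos : ι → Cell) (s : Set ι) : Connected pos s ↔ Linked pos s := by
  classical
  constructor
  · rintro h T ⟨a, ha, hTa⟩ ⟨b, hb, hTb⟩
    obtain ⟨p⟩ := h ⟨a, ha⟩ ⟨b, hb⟩
    obtain ⟨d, -, h1, h2⟩ := p.exists_boundary_dart {x | T x.1 = true} hTa (by simp [hTb])
    exact ⟨d.fst, d.fst.2, d.snd, d.snd.2, h1, by simpa using h2, d.adj⟩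
  · intro h a b
    by_contra hab
    obtain ⟨x, hx, y, hy, hTx, hTy, hxy⟩ := h
      (fun x => decide (∃ hx : x ∈ s, ((sideGraph pos).induce s).Reachable a ⟨x, hx⟩))
      ⟨a, a.2, by simp⟩ ⟨b, b.2, by simpa using hab⟩
    simp only [decide_eq_true_eq, decide_eq_false_iff_not, not_exists] at hTx hTy
    obtain ⟨_, hTx⟩ := hTx
    refine hTy hy (hTx.trans (SimpleGraph.Adj.reachable ?_))
    exact hxy

lemma Linked.transport {p p' : ι → Cell} {s s' : Set ι} (hL : Linked p s) (g : Motion)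
    (π : Equiv.Perm ι) (hp : ∀ m, p' m = place g (p (π m))) (hs : ∀ m, m ∈ s' ↔ π m ∈ s) :
    Linked p' s' := by
  rintro T ⟨a, ha, hTa⟩ ⟨b, hb, hTb⟩
  obtain ⟨x, hx, y, hy, h1, h2, h3⟩ := hL (fun m => T (π.symm m))
    ⟨π a, (hs a).1 ha, by simpa using hTa⟩ ⟨π b, (hs b).1 hb, by simpa using hTb⟩
  refine ⟨π.symm x, (hs _).2 (by simpa using hx), π.symm y, (hs _).2 (by simpa using hy),
    h1, h2, ?_⟩
  rw [hp, hp, sideAdj_place]; simpa using h3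

lemma SideAdj.abs_le {p q : Cell} (h : SideAdj p q) : |p.1 - q.1| ≤ 1 ∧ |p.2 - q.2| ≤ 1 := by
  unfold SideAdj at h
  constructor <;> linarith [abs_nonneg (p.1 - q.1), abs_nonneg (p.2 - q.2)]

lemma Linked.sub_le [Fintype ι] {pos : ι → Cell} (h : Linked pos Set.univ) (f : Cell → ℤ)
    (hf : ∀ p q, SideAdj p q → f q ≤ f p + 1) (a b : ι) :
    f (pos b) - f (pos a) ≤ Fintype.card ι - 1 := by
  classical
  have key : ∀ v ∈ Finset.Icc (f (pos a)) (f (pos b)),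
      v ∈ Finset.univ.image (fun m => f (pos m)) := by
    intro v hv
    rw [Finset.mem_Icc] at hv
    rcases eq_or_lt_of_le hv.1 with rfl | hlt
    · simp
    obtain ⟨x, -, y, -, hx, hy, hxy⟩ := h (fun m => decide (f (pos m) < v))
      ⟨a, trivial, by simpa using hlt⟩ ⟨b, trivial, by simpa using hv.2⟩
    have h1 := hf _ _ hxy
    simp only [decide_eq_true_eq, decide_eq_false_iff_not, not_lt] at hx hy
    simp only [Finset.mem_image, Finset.mem_univ, true_and]
    exact ⟨y, by omega⟩
  have h1 := Finset.card_le_card key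
  have h2 : (Finset.univ.image (fun m => f (pos m))).card ≤ Fintype.card ι := Finset.card_image_le
  rw [Int.card_Icc] at h1
  omega

lemma Linked.near [Fintype ι] {pos : ι → Cell} (h : Linked pos Set.univ) (a b : ι) :
    Near (Fintype.card ι - 1) (pos a) (pos b) := by
  constructor <;> rw [abs_le]
  · have h1 := h.sub_le (fun c => c.1) (fun p q hpq => by
      have := (_root_.abs_le.1 hpq.abs_le.1).1; omega)
    have := h1 a b; have := h1 b a; constructor <;> omega
  · have h1 := h.sub_le (fun c => c.2) (fun p q hpq => by
      have := (_root_.abs_le.1 hpq.abs_le.2).1; omega)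
    have := h1 a b; have := h1 b a; constructor <;> omega

/-! ### The dynamics of a single MRS -/

/-- What surrounds a single MRS: the wall cells and the cells that may be moved through. -/
structure World where
  /-- the cells seen as walls -/
  wall : Cell → Prop
  /-- the cells through which modules may move -/
  free : Cell → Prop

/-- The rectangular field with its walls. -/
def field (w h : ℕ) : World := ⟨IsWall w h, InField w h⟩

/-- The whole plane, without walls. -/
def plane : World := ⟨fun _ => False, fun _ => True⟩

open Classical in
/-- The observation of a module when the wall cells are those of `wall` and the only modules are
those at `pos`. -/
noncomputable def look (k : ℕ) (wall : Cell → Prop) (pos : ι → Cell) (r : Fin 4) (m : ι) :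
    View k := fun d =>
  if wall (pos m + turn r d.1) then Content.wall
  else if ∃ m', pos m' = pos m + turn r d.1 then Content.occupied
  else Content.empty

/-- The actions prescribed to the modules of a single MRS. -/
noncomputable def plan {k : ℕ} (A : Algorithm k) (Ω : World) (pos : ι → Cell) (fr : ι → Fin 4)
    (m : ι) : Action := A (look k Ω.wall pos (fr m) m)

/-- The positions after the actions `act`. -/
def jump (pos : ι → Cell) (fr : ι → Fin 4) (act : ι → Action) (m : ι) : Cell :=
  dest (pos m) (fr m) (act m)

/-- The rules of the MRS model for a single MRS that moves through the cells of `free`. -/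
structure LocalLegal (free : Cell → Prop) (pos : ι → Cell) (fr : ι → Fin 4) (act : ι → Action) :
    Prop where
  proper : ∀ m, (act m).Proper
  guided : ∀ m, ∀ c ∈ guides (pos m) (fr m) (act m), ∃ m', pos m' = c ∧ act m' = .stay
  through : ∀ m, ∀ c ∈ swept (pos m) (fr m) (act m), free c ∧ ∀ m', pos m' ≠ c
  no_overlap : ∀ m m', m ≠ m' →
    Disjoint (swept (pos m) (fr m) (act m)) (swept (pos m') (fr m') (act m'))
  backbone : Linked pos {m | act m = .stay}
  connected : Linked (jump pos fr act) Set.univ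

open Classical in
/-- The positions after one step of the algorithm, where an MRS of which the algorithm demands an
illegal step does not move. -/
noncomputable def stepOf {k : ℕ} (A : Algorithm k) (Ω : World) (pos : ι → Cell) (fr : ι → Fin 4) :
    ι → Cell :=
  if LocalLegal Ω.free pos fr (plan A Ω pos fr) then jump pos fr (plan A Ω pos fr) else pos

lemma action_cases (a : Action) : a = .stay ∨ (∃ j b, a = .rotate j b) ∨
    ∃ j b l, a = .slide j b l := by
  cases a <;> simp

lemma dirVec_abs (r j : Fin 4) (b : Bool) :
    |(turn r (dirVec j)).1| ≤ 1 ∧ |(turn r (dirVec j)).2| ≤ 1 ∧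
    |(spin b (turn r (dirVec j))).1| ≤ 1 ∧ |(spin b (turn r (dirVec j))).2| ≤ 1 := by
  revert r j b; decide

lemma dirVec_sum (r j : Fin 4) (b : Bool) :
    |(turn r (dirVec j)).1| + |(turn r (dirVec j)).2| = 1 ∧
    |(spin b (turn r (dirVec j))).1| + |(spin b (turn r (dirVec j))).2| = 1 ∧
    |(turn r (dirVec j)).1 + (spin b (-turn r (dirVec j))).1| ≤ 1 ∧
    |(turn r (dirVec j)).2 + (spin b (-turn r (dirVec j))).2| ≤ 1 ∧
    |(spin b (-turn r (dirVec j))).1| ≤ 1 ∧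
    |(spin b (-turn r (dirVec j))).2| ≤ 1  := by
  revert r j b; decide

/-- A module of a connected MRS of at most four modules moves by at most three cells, since the
line that guides a sliding belongs to the MRS. -/
lemma swept_near {pos : ι → Cell} [Fintype ι] (hc : Fintype.card ι ≤ 4)
    (hl : Linked pos Set.univ) (p : Cell) (r : Fin 4) (a : Action)
    (hg : ∀ c ∈ guides p r a, ∃ m, pos m = c) {c : Cell} (hcs : c ∈ swept p r a) :
    Near 3 c p := by
  rcases action_cases a with rfl | ⟨j, b, rfl⟩ | ⟨j, b, l, rfl⟩
  · simp [swept] at hcs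
  · have h := dirVec_sum r j b
    simp only [swept, Set.mem_insert_iff, Set.mem_singleton_iff] at hcs
    obtain ⟨-, -, h1, h2, h3, h4⟩ := h
    rw [abs_le] at h1 h2 h3 h4
    rcases hcs with rfl | rfl <;>
      constructor <;> simp only [Prod.fst_add, Prod.snd_add] <;> rw [abs_le] <;>
      constructor <;> linarith
  · obtain ⟨i, -, hi, rfl⟩ := hcs
    obtain ⟨m, hm⟩ := hg (p + spin b (turn r (dirVec j)) + ((0 : ℕ) : ℤ) • turn r (dirVec j))
      ⟨0, Nat.zero_le _, rfl⟩
    obtain ⟨m', hm'⟩ := hg (p + spin b (turn r (dirVec j)) + (i : ℤ) • turn r (dirVec j))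
      ⟨i, hi, rfl⟩
    obtain ⟨h1, h2⟩ := hl.near m' m
    rw [hm, hm'] at h1 h2
    simp only [Nat.cast_zero, zero_smul, add_zero, Prod.fst_add, Prod.snd_add, Prod.smul_fst,
      Prod.smul_snd, add_sub_cancel_left] at h1 h2
    constructor <;> simp only [Prod.fst_add, Prod.snd_add, Prod.smul_fst, Prod.smul_snd,
      add_sub_cancel_left] <;> omega

lemma dest_eq_or_mem_swept (p : Cell) (r : Fin 4) (a : Action) (ha : a.Proper) :
    a = .stay ∧ dest p r a = p ∨ a ≠ .stay ∧ dest p r a ∈ swept p r a := by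
  cases a with
  | stay => simp [dest]
  | rotate j b => simp [dest, swept]
  | slide j b l => exact .inr ⟨by simp, l, ha, le_rfl, rfl⟩

/-- The configurations of a connected MRS. -/
structure Good (pos : ι → Cell) : Prop where
  injective : Function.Injective pos
  linked : Linked pos Set.univ

lemma LocalLegal.dest_near [Fintype ι] (hc : Fintype.card ι ≤ 4) {free : Cell → Prop}
    {pos : ι → Cell} {fr : ι → Fin 4} {act : ι → Action} (hl : Linked pos Set.univ)
    (h : LocalLegal free pos fr act) (m : ι) : Near 3 (jump pos fr act m) (pos m) := by
  rcases dest_eq_or_mem_swept (pos m) (fr m) (act m) (h.proper m) with ⟨-, h1⟩ | ⟨-, h1⟩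
  · rw [jump, h1]; constructor <;> simp
  · exact swept_near hc hl _ _ _ (fun c hcg => (h.guided m c hcg).imp fun _ h => h.1) h1

lemma LocalLegal.good {free : Cell → Prop}
    {pos : ι → Cell} {fr : ι → Fin 4} {act : ι → Action} (hp : Function.Injective pos)
    (h : LocalLegal free pos fr act) : Good (jump pos fr act) := by
  refine ⟨fun a b hab => ?_, h.connected⟩
  by_contra hne
  simp only [jump] at hab
  rcases dest_eq_or_mem_swept (pos a) (fr a) (act a) (h.proper a) with ⟨-, h1⟩ | ⟨-, h1⟩ <;>
    rcases dest_eq_or_mem_swept (pos b) (fr b) (act b) (h.proper b) with ⟨-, h2⟩ | ⟨-, h2⟩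
  · exact hne (hp (by rw [← h1, ← h2, hab]))
  · exact (h.through b _ h2).2 a (by rw [← hab, h1])
  · exact (h.through a _ h1).2 b (by rw [hab, h2])
  · exact Set.disjoint_left.1 (h.no_overlap a b hne) h1 (hab ▸ h2)

section step
variable {k : ℕ} (A : Algorithm k)

lemma step_near [Fintype ι] (hc : Fintype.card ι ≤ 4) (Ω : World) {pos : ι → Cell}
    (hl : Linked pos Set.univ) (fr : ι → Fin 4) (m : ι) : Near 3 (stepOf A Ω pos fr m) (pos m) := by
  unfold stepOf
  split_ifs with h
  · exact h.dest_near hc hl m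
  · constructor <;> simp

lemma step_good (Ω : World) {pos : ι → Cell} (hg : Good pos)
    (fr : ι → Fin 4) : Good (stepOf A Ω pos fr) := by
  unfold stepOf
  split_ifs with h
  · exact h.good hg.injective
  · exact hg

lemma step_free (Ω : World) {pos : ι → Cell} (hf : ∀ m, Ω.free (pos m)) (fr : ι → Fin 4) (m : ι) :
    Ω.free (stepOf A Ω pos fr m) := by
  unfold stepOf
  split_ifs with h
  · rcases dest_eq_or_mem_swept (pos m) (fr m) _ (h.proper m) with ⟨-, h1⟩ | ⟨-, h1⟩
    · rw [jump, h1]; exact hf m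
    · exact (h.through m _ h1).1
  · exact hf m

lemma plan_equivariant {Ω Ω' : World} {pos pos' : ι → Cell} {fr fr' : ι → Fin 4} (g : Motion)
    (π : Equiv.Perm ι) (hpos : ∀ m, pos' m = place g (pos (π m)))
    (hw : ∀ m c, Near k c (pos m) → (Ω'.wall (place g c) ↔ Ω.wall c)) {m : ι}
    (hfr : fr' m = g.1 + fr (π m)) :
    plan A Ω' pos' fr' m = plan A Ω pos fr (π m) := by
  unfold plan
  congr 1
  funext d
  have h1 : pos' m + turn (fr' m) d.1 = place g (pos (π m) + turn (fr (π m)) d.1) := by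
    rw [hpos, hfr, place_add, turn_turn]
  have h2 : (∃ m', pos' m' = pos' m + turn (fr' m) d.1) ↔
      ∃ m', pos m' = pos (π m) + turn (fr (π m)) d.1 := by
    rw [h1]
    simp only [hpos, (place_injective g).eq_iff]
    exact π.exists_congr_left.trans (by simp)
  have h3 : Near k (pos (π m) + turn (fr (π m)) d.1) (pos (π m)) := by
    have := d.2
    rcases fin_four_cases (fr (π m)) with h | h | h | h <;> rw [h] <;>
      simpa [Near, turn_zero, turn_one, turn_two, turn_three, and_comm] using this
  have h4 := hw _ _ h3
  unfold look
  classical exact if_congr (by rw [h1]; exact h4) rfl (if_congr h2 rfl rfl)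

lemma legal_of_legal [Fintype ι] (hc : Fintype.card ι ≤ 4) {free free' : Cell → Prop}
    {pos pos' : ι → Cell}
    {fr fr' : ι → Fin 4} {act act' : ι → Action} (hl : Linked pos Set.univ) (g : Motion)
    (π : Equiv.Perm ι) (hpos : ∀ m, pos' m = place g (pos (π m)))
    (hfr : ∀ m, fr' m = g.1 + fr (π m)) (hact : ∀ m, act' m = act (π m))
    (hf : ∀ m c, Near 3 c (pos m) → (free' (place g c) ↔ free c))
    (h : LocalLegal free pos fr act) : LocalLegal free' pos' fr' act' := by
  have hswept : ∀ m, swept (pos' m) (fr' m) (act' m) =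
      place g '' swept (pos (π m)) (fr (π m)) (act (π m)) := by
    intro m; rw [hpos, hfr, hact, swept_place]
  refine ⟨fun m => hact m ▸ h.proper _, fun m => ?_, fun m => ?_, fun m m' hne => ?_, ?_, ?_⟩
  · rw [hpos, hfr, hact, guides_place]
    rintro _ ⟨c, hcg, rfl⟩
    obtain ⟨m', h1, h2⟩ := h.guided _ c hcg
    exact ⟨π.symm m', by simp [hpos, h1], by simp [hact, h2]⟩
  · rw [hswept]
    rintro _ ⟨c, hcs, rfl⟩
    refine ⟨(hf (π m) c ?_).2 (h.through _ c hcs).1, fun m' => ?_⟩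
    · exact swept_near hc hl _ _ _ (fun c hcg => (h.guided _ c hcg).imp fun _ h => h.1) hcs
    · rw [hpos]; exact (place_injective g).ne ((h.through _ c hcs).2 _)
  · rw [hswept, hswept]
    exact (Set.disjoint_image_iff (place_injective g)).2 (h.no_overlap _ _ (π.injective.ne hne))
  · exact h.backbone.transport g π hpos (fun m => by simp [hact])
  · exact h.connected.transport g π (fun m => by simp only [jump]; rw [hpos, hfr, hact, dest_place])
      (fun m => by simp)

/-- A step commutes with every motion of the plane that respects the surroundings within sight
and reach. -/
lemma step_equivariant [Fintype ι] (hc : Fintype.card ι ≤ 4) {Ω Ω' : World} {pos pos' : ι → Cell}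
    {fr fr' : ι → Fin 4} (hl : Linked pos Set.univ) (g : Motion) (π : Equiv.Perm ι)
    (hpos : ∀ m, pos' m = place g (pos (π m))) (hfr : ∀ m, fr' m = g.1 + fr (π m))
    (hw : ∀ m c, Near k c (pos m) → (Ω'.wall (place g c) ↔ Ω.wall c))
    (hf : ∀ m c, Near 3 c (pos m) → (Ω'.free (place g c) ↔ Ω.free c)) (m : ι) :
    stepOf A Ω' pos' fr' m = place g (stepOf A Ω pos fr (π m)) := by
  have hact := fun m => plan_equivariant A g π hpos hw (hfr m)
  have hlegal : LocalLegal Ω'.free pos' fr' (plan A Ω' pos' fr') ↔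
      LocalLegal Ω.free pos fr (plan A Ω pos fr) := by
    have hpos' : ∀ m, pos m = place (inv g) (pos' (π.symm m)) := by
      intro m; rw [hpos, ← place_comp, inv_comp, place_zero]; simp
    refine ⟨fun h => ?_, legal_of_legal hc hl g π hpos hfr hact hf⟩
    have hl' : Linked pos' Set.univ := hl.transport g π hpos (by simp)
    refine legal_of_legal hc hl' (inv g) π.symm hpos' (fun m => ?_) (fun m => ?_) ?_ h
    · simp [hfr, inv]
    · simp [hact]
    · intro m c hcm
      rw [← hf (π m) (place (inv g) c), place_inv]
      rw [← near_place g, place_inv, ← hpos]; exact hcm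
  unfold stepOf
  by_cases h : LocalLegal Ω.free pos fr (plan A Ω pos fr)
  · rw [if_pos h, if_pos (hlegal.2 h)]
    simp only [jump]; rw [hpos, hfr, hact, dest_place]
  · rw [if_neg h, if_neg (fun h' => h (hlegal.1 h'))]
    exact hpos m

end step

end

/-! ### Two distant MRSs act independently -/

/-- `e` embeds the modules of one MRS into a larger set of modules whose other members are out of
sight and out of reach. -/
structure Isolated {ι κ : Type} (k : ℕ) (e : ι → κ) (pos : κ → Cell) : Prop where
  far : ∀ m m', ¬ (∃ x, e x = m') → ¬ Near (k + 4) (pos m') (pos (e m))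

lemma Near.mono {K L : ℤ} {c d : Cell} (h : Near K c d) (hKL : K ≤ L) : Near L c d :=
  ⟨h.1.trans hKL, h.2.trans hKL⟩

lemma Near.symm {K : ℤ} {c d : Cell} (h : Near K c d) : Near K d c :=
  ⟨by rw [abs_sub_comm]; exact h.1, by rw [abs_sub_comm]; exact h.2⟩

lemma Near.trans {K L : ℤ} {c d e : Cell} (h : Near K c d) (h' : Near L d e) :
    Near (K + L) c e := by
  obtain ⟨h1, h2⟩ := h
  obtain ⟨h3, h4⟩ := h'
  constructor
  · have := abs_sub_le c.1 d.1 e.1; linarith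
  · have := abs_sub_le c.2 d.2 e.2; linarith

section
variable {ι κ : Type} {k w h : ℕ} {e : ι → κ} {pos : κ → Cell}

lemma Isolated.look_eq (hi : Isolated k e pos) (r : Fin 4) (m : ι) :
    view k w h pos r (e m) = look k (IsWall w h) (fun x => pos (e x)) r m := by
  funext d
  have h3 : Near k (pos (e m) + turn r d.1) (pos (e m)) := by
    have := d.2
    rcases fin_four_cases r with h | h | h | h <;> rw [h] <;>
      simpa [Near, turn_zero, turn_one, turn_two, turn_three, and_comm] using this
  have h2 : (∃ m', pos m' = pos (e m) + turn r d.1) ↔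
      ∃ m', pos (e m') = pos (e m) + turn r d.1 := by
    refine ⟨fun ⟨m', hm'⟩ => ?_, fun ⟨m', hm'⟩ => ⟨_, hm'⟩⟩
    by_cases hx : ∃ x, e x = m'
    · obtain ⟨x, rfl⟩ := hx; exact ⟨x, hm'⟩
    · refine absurd ?_ (hi.far m m' hx)
      rw [hm']; exact h3.mono (by linarith)
  unfold view content look
  classical exact if_congr Iff.rfl rfl (if_congr h2 rfl rfl)

lemma near_spin (p : Cell) (r j : Fin 4) (b : Bool) :
    Near 1 (p + spin b (turn r (dirVec j))) p := by
  have h := dirVec_abs r j b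
  exact ⟨by simpa using h.2.2.1, by simpa using h.2.2.2⟩

lemma near_turn (p : Cell) (r j : Fin 4) : Near 1 (p + turn r (dirVec j)) p := by
  have h := dirVec_abs r j true
  exact ⟨by simpa using h.1, by simpa using h.2.1⟩

lemma Isolated.guides_mem (hi : Isolated k e pos) {m : ι} {r : Fin 4} {a : Action}
    (hg : ∀ c ∈ guides (pos (e m)) r a, ∃ m', pos m' = c) :
    ∀ c ∈ guides (pos (e m)) r a, ∀ m', pos m' = c → ∃ x, e x = m' := by
  have near : ∀ x m', Near 1 (pos m') (pos (e x)) → ∃ x, e x = m' := by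
    intro x m' hn
    by_contra hx
    exact hi.far x m' hx (hn.mono (by linarith [Int.natCast_nonneg k]))
  rcases action_cases a with rfl | ⟨j, b, rfl⟩ | ⟨j, b, l, rfl⟩
  · simp [guides]
  · simp only [guides, Set.mem_singleton_iff, forall_eq]
    intro m' hm'
    exact near m m' (hm' ▸ near_turn _ _ _)
  · rintro c ⟨i, hil, rfl⟩
    induction i with
    | zero =>
      intro m' hm'
      refine near m m' (hm' ▸ ?_)
      simpa using near_spin (pos (e m)) r j b
    | succ i ih =>
      intro m' hm'
      obtain ⟨m'', hm''⟩ := hg _ ⟨i, by omega, rfl⟩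
      obtain ⟨x, rfl⟩ := ih (by omega) m'' hm''
      refine near x m' ?_
      rw [hm', hm'']
      have := near_turn (pos (e m) + spin b (turn r (dirVec j)) + (i : ℤ) • turn r (dirVec j)) r j
      rwa [add_assoc _ ((i : ℤ) • _), ← add_one_zsmul] at this

end

section
variable {n₁ n₂ k w h : ℕ}

lemma Isolated.localLegal {ι : Type} {e : ι → Modules n₁ n₂} {pos : Modules n₁ n₂ → Cell}
    (hi : Isolated k e pos) (he : Function.Injective e) (b : Bool)
    (hb : ∀ m, m ∈ members n₁ n₂ b ↔ ∃ x, e x = m)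
    {frame : Modules n₁ n₂ → Fin 4} {act : Modules n₁ n₂ → Action}
    (hL : Legal w h pos frame act) :
    LocalLegal (InField w h) (fun x => pos (e x)) (fun x => frame (e x)) (fun x => act (e x)) := by
  have link : ∀ (p : Modules n₁ n₂ → Cell) (s : Set (Modules n₁ n₂)) (s' : Set ι),
      (∀ x, x ∈ s' ↔ e x ∈ s) → Connected p (members n₁ n₂ b ∩ s) →
      Linked (fun x => p (e x)) s' := by
    intro p s s' hs hC
    rw [connected_iff_linked] at hC
    rintro T ⟨x, hx, hTx⟩ ⟨y, hy, hTy⟩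
    obtain ⟨c, hc, d, hd, h1, h2, h3⟩ := hC
      (Function.extend e T (fun _ => false))
      ⟨e x, ⟨(hb _).2 ⟨x, rfl⟩, (hs x).1 hx⟩, by rw [he.extend_apply, hTx]⟩
      ⟨e y, ⟨(hb _).2 ⟨y, rfl⟩, (hs y).1 hy⟩, by rw [he.extend_apply, hTy]⟩
    obtain ⟨c', rfl⟩ := (hb _).1 hc.1
    obtain ⟨d', rfl⟩ := (hb _).1 hd.1
    rw [he.extend_apply] at h1 h2
    exact ⟨c', (hs _).2 hc.2, d', (hs _).2 hd.2, h1, h2, h3⟩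
  refine ⟨fun m => hL.proper _, fun m c hc => ?_, fun m c hc => ?_, fun m m' hne => ?_, ?_, ?_⟩
  · obtain ⟨m', h1, h2⟩ := hL.guided (e m) c hc
    obtain ⟨x, rfl⟩ := hi.guides_mem
      (fun c hc => (hL.guided (e m) c hc).imp fun _ h => h.1) c hc m' h1
    exact ⟨x, h1, h2⟩
  · obtain ⟨h1, h2⟩ := hL.through_empty (e m) c hc
    exact ⟨h1, fun m' => h2 _⟩
  · exact hL.no_overlap _ _ (he.ne hne)
  · exact link pos {m | act m = .stay} _ (fun x => Iff.rfl) (hL.backbone b)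
  · exact link (fun m => dest (pos m) (frame m) (act m)) Set.univ _ (by simp)
      (by rw [Set.inter_univ]; exact hL.connected b)

/-- If two MRSs, each following the algorithm as if it were alone in the field, never come into
each other's sight, then the algorithm does not solve the rendezvous problem. -/
theorem not_solves_of_far (A : Algorithm k) (hn₁ : 1 ≤ n₁) (hn₂ : 1 ≤ n₂)
    {q₁ : ℕ → Fin n₁ → Cell} {q₂ : ℕ → Fin n₂ → Cell}
    {fr₁ : ℕ → Fin n₁ → Fin 4} {fr₂ : ℕ → Fin n₂ → Fin 4}
    (h₁ : ∀ t, q₁ (t + 1) = stepOf A (field w h) (q₁ t) (fr₁ t))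
    (h₂ : ∀ t, q₂ (t + 1) = stepOf A (field w h) (q₂ t) (fr₂ t))
    (hfar : ∀ t m m', ¬ Near (k + 4) (q₁ t m) (q₂ t m')) :
    ¬ SolvesRendezvous w h A (Sum.elim (q₁ 0) (q₂ 0)) (fun t => Sum.elim (fr₁ t) (fr₂ t)) := by
  rintro ⟨hL, T, hG, -⟩
  have iso₁ : ∀ t, Isolated k (Sum.inl : Fin n₁ → Modules n₁ n₂) (Sum.elim (q₁ t) (q₂ t)) := by
    refine fun t => ⟨fun m m' hm' => ?_⟩
    rcases m' with x | x
    · exact absurd ⟨x, rfl⟩ hm'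
    · exact fun hn => hfar t m x hn.symm
  have iso₂ : ∀ t, Isolated k (Sum.inr : Fin n₂ → Modules n₁ n₂) (Sum.elim (q₁ t) (q₂ t)) := by
    refine fun t => ⟨fun m m' hm' => ?_⟩
    rcases m' with x | x
    · exact fun hn => hfar t x m hn
    · exact absurd ⟨x, rfl⟩ hm'
  have key : ∀ t, exec w h A (Sum.elim (q₁ 0) (q₂ 0)) (fun t => Sum.elim (fr₁ t) (fr₂ t)) t =
      Sum.elim (q₁ t) (q₂ t) := by
    intro t
    induction t with
    | zero => rfl
    | succ t ih =>
      have hLt := hL t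
      rw [ih] at hLt
      have l₁ := (iso₁ t).localLegal Sum.inl_injective true
        (fun m => by rcases m with x | x <;> simp [members]) hLt
      have l₂ := (iso₂ t).localLegal Sum.inr_injective false
        (fun m => by rcases m with x | x <;> simp [members]) hLt
      have a₁ : ∀ m, actions w h A (Sum.elim (q₁ t) (q₂ t)) (Sum.elim (fr₁ t) (fr₂ t))
          (Sum.inl m) = plan A (field w h) (q₁ t) (fr₁ t) m := fun m => by
        unfold actions plan
        rw [(iso₁ t).look_eq]; rfl
      have a₂ : ∀ m, actions w h A (Sum.elim (q₁ t) (q₂ t)) (Sum.elim (fr₁ t) (fr₂ t))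
          (Sum.inr m) = plan A (field w h) (q₂ t) (fr₂ t) m := fun m => by
        unfold actions plan
        rw [(iso₂ t).look_eq]; rfl
      simp only [a₁, Sum.elim_inl] at l₁
      simp only [a₂, Sum.elim_inr] at l₂
      rw [h₁ t, h₂ t]
      unfold stepOf
      rw [if_pos (show LocalLegal (field w h).free (q₁ t) (fr₁ t)
        (plan A (field w h) (q₁ t) (fr₁ t)) from l₁),
        if_pos (show LocalLegal (field w h).free (q₂ t) (fr₂ t)
          (plan A (field w h) (q₂ t) (fr₂ t)) from l₂)]
      unfold exec
      rw [ih]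
      funext m
      rcases m with m | m
      · simp only [a₁, Sum.elim_inl, jump]
      · simp only [a₂, Sum.elim_inr, jump]
  rw [key] at hG
  have := hG (Sum.inl ⟨0, hn₁⟩) (Sum.inr ⟨0, hn₂⟩)
  exact hfar T ⟨0, hn₁⟩ ⟨0, hn₂⟩ (Near.mono this (by linarith))

end

/-! ### Centrally symmetric states -/

section
variable {ι : Type}

/-- `σ` pairs the modules that are exchanged by the half turn `c ↦ z - c`. -/
def SymBy (σ : ι → ι) (z : Cell) (pos : ι → Cell) : Prop := ∀ m, pos (σ m) = z - pos m

lemma place_two (z c : Cell) : place (2, z) c = z - c := by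
  simp only [place, turn_two]; ext <;> simp <;> ring

lemma exists_guide {p : Cell} {r : Fin 4} {a : Action} (ha : a ≠ .stay) :
    ∃ d : Cell, |d.1| + |d.2| = 1 ∧ p + d ∈ guides p r a := by
  rcases action_cases a with rfl | ⟨j, b, rfl⟩ | ⟨j, b, l, rfl⟩
  · exact absurd rfl ha
  · exact ⟨_, (dirVec_sum r j b).1, rfl⟩
  · exact ⟨_, (dirVec_sum r j b).2.1, 0, Nat.zero_le _, by simp⟩

/-- In a centrally symmetric MRS of at most four modules with symmetric actions, a module at the
centre cannot move: the rest of the MRS would fall apart. -/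
lemma LocalLegal.center_stays [Fintype ι] (hc : Fintype.card ι ≤ 4) {free : Cell → Prop}
    {pos : ι → Cell} {fr : ι → Fin 4} {act : ι → Action} (h : LocalLegal free pos fr act)
    (hinj : Function.Injective pos) {σ : ι → ι} {z : Cell} (hσ : SymBy σ z pos)
    (hact : ∀ m, pos m + pos m ≠ z → act (σ m) = act m) {c : ι} (hcz : pos c + pos c = z) :
    act c = .stay := by
  classical
  by_contra hne
  obtain ⟨d, hd, hg⟩ := exists_guide (p := pos c) (r := fr c) hne
  obtain ⟨m, hm, hst⟩ := h.guided c _ hg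
  have hd0 : d ≠ 0 := by rintro rfl; simp at hd
  have center : ∀ m, pos m + pos m = z → m = c := by
    intro x hx
    apply hinj
    rw [← hcz] at hx
    have h1 := congrArg Prod.fst hx
    have h2 := congrArg Prod.snd hx
    simp only [Prod.fst_add, Prod.snd_add] at h1 h2
    ext <;> omega
  have hmc : m ≠ c := by rintro rfl; simp [hd0] at hm
  have invol : ∀ m, σ (σ m) = m := fun m => hinj (by rw [hσ, hσ]; abel)
  have fixed : ∀ m, σ m = m → m = c := fun m hm => center m (by
    have := hσ m; rw [hm] at this; nth_rw 1 [this]; abel)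
  have hσc : σ c = c := hinj (by rw [hσ, ← hcz]; abel)
  have stays : ∀ m, m ≠ c → act m = .stay → act (σ m) = .stay := fun m hmc hm => by
    rw [hact m (fun h => hmc (center m h)), hm]
  obtain ⟨x, hx, y, hy, hxT, hyT, hxy⟩ := h.backbone (fun x => decide (x = m)) ⟨m, hst, by simp⟩
    ⟨σ m, stays m hmc hst, by simpa using fun h => hmc (fixed m h)⟩
  obtain rfl : x = m := by simpa using hxT
  have hyx : y ≠ x := by simpa using hyT
  have hyc : y ≠ c := by rintro rfl; exact hne hy
  have hyσ : y ≠ σ x := by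
    rintro rfl
    rw [hσ, hm, ← hcz] at hxy
    unfold SideAdj at hxy
    have e1 : (pos c + d).1 - (pos c + pos c - (pos c + d)).1 = 2 * d.1 := by simp; ring
    have e2 : (pos c + d).2 - (pos c + pos c - (pos c + d)).2 = 2 * d.2 := by simp; ring
    rw [e1, e2, abs_mul, abs_mul] at hxy
    norm_num at hxy
    omega
  have h5 : ({c, x, σ x, y, σ y} : Finset ι).card = 5 := by
    have n1 : c ≠ σ x := fun h => hmc (by rw [← invol x, ← h, hσc])
    have n2 : c ≠ σ y := fun h => hyc (by rw [← invol y, ← h, hσc])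
    have n3 : x ≠ σ x := fun h => hmc (fixed x h.symm)
    have n4 : x ≠ σ y := fun h => hyσ (by rw [h, invol])
    have n5 : σ x ≠ σ y := fun h => hyx (by rw [← invol x, h, invol])
    have n6 : y ≠ σ y := fun h => hyc (fixed y h.symm)
    rw [Finset.card_insert_of_notMem, Finset.card_insert_of_notMem, Finset.card_insert_of_notMem,
      Finset.card_insert_of_notMem, Finset.card_singleton] <;>
      simp [*, hmc.symm, hyc.symm, hyx.symm, hyσ.symm]
  have := Finset.card_le_univ ({c, x, σ x, y, σ y} : Finset ι)
  omega

/-- Central symmetry persists if the local frames are symmetric too. -/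
lemma SymBy.step [Fintype ι] {k : ℕ} (A : Algorithm k) (hc : Fintype.card ι ≤ 4) {pos : ι → Cell}
    {fr : ι → Fin 4} (hg : Good pos) {σ : ι → ι} {z : Cell} (hσ : SymBy σ z pos)
    (hfr : ∀ m, pos m + pos m ≠ z → fr (σ m) = 2 + fr m) :
    SymBy σ z (stepOf A plane pos fr) := by
  have invol : ∀ m, σ (σ m) = m := fun m => hg.injective (by rw [hσ, hσ]; abel)
  have hplan : ∀ m, pos m + pos m ≠ z → plan A plane pos fr (σ m) = plan A plane pos fr m := by
    intro m hm
    rw [plan_equivariant A (Ω := plane) (Ω' := plane) (pos := pos) (pos' := pos) (fr := fr)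
      (fr' := fr) (2, z) ⟨σ, σ, invol, invol⟩ (m := σ m)]
    · simp [invol]
    · intro m
      change pos m = place (2, z) (pos (σ m))
      rw [place_two, hσ]; abel
    · intro m c _; rfl
    · simp [invol, hfr m hm]
  unfold stepOf
  split_ifs with h
  · intro m
    by_cases hm : pos m + pos m = z
    · have hst := h.center_stays hc hg.injective hσ hplan hm
      have : σ m = m := hg.injective (by rw [hσ, ← hm]; abel)
      rw [this]
      simp only [jump, hst, dest]
      rw [← hm]; abel
    · simp only [jump]
      rw [hplan m hm, hfr m hm, hσ, ← place_two, ← place_two, ← dest_place]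
  · exact hσ

lemma SymBy.near [Fintype ι] (hc : Fintype.card ι ≤ 4) {pos : ι → Cell} (hg : Good pos) {σ : ι → ι}
    {z : Cell} (hσ : SymBy σ z pos) (m : ι) :
    |2 * (pos m).1 - z.1| ≤ 3 ∧ |2 * (pos m).2 - z.2| ≤ 3 := by
  obtain ⟨h1, h2⟩ := hg.linked.near m (σ m)
  rw [hσ] at h1 h2
  simp only [Prod.fst_sub, Prod.snd_sub] at h1 h2
  constructor
  · rw [show 2 * (pos m).1 - z.1 = (pos m).1 - (z.1 - (pos m).1) by ring]; omega
  · rw [show 2 * (pos m).2 - z.2 = (pos m).2 - (z.2 - (pos m).2) by ring]; omega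

/-- All modules are at distance more than `K` from the walls. -/
def Deep (K : ℤ) (w h : ℕ) (pos : ι → Cell) : Prop :=
  ∀ m, K ≤ (pos m).1 ∧ (pos m).1 + K < w ∧ K ≤ (pos m).2 ∧ (pos m).2 + K < h

lemma Near.bounds {K : ℤ} {c d : Cell} (h : Near K c d) :
    c.1 ≤ d.1 + K ∧ d.1 ≤ c.1 + K ∧ c.2 ≤ d.2 + K ∧ d.2 ≤ c.2 + K := by
  obtain ⟨h1, h2⟩ := h
  rw [abs_le] at h1 h2
  omega

/-- Far from the walls the field is like the plane. -/
lemma step_deep [Fintype ι] {k w h : ℕ} (A : Algorithm k) (hc : Fintype.card ι ≤ 4)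
    {pos : ι → Cell} (fr : ι → Fin 4) (hl : Linked pos Set.univ) (hd : Deep (k + 4) w h pos) :
    stepOf A (field w h) pos fr = stepOf A plane pos fr := by
  funext m
  rw [step_equivariant A hc hl (Ω := plane) (Ω' := field w h) (fr := fr) (0, 0) (Equiv.refl _)]
  · simp [place_zero]
  · simp [place_zero]
  · simp
  · intro m c hn
    have := hd m
    have := hn.bounds
    simp only [place_zero, field, plane, iff_false, IsWall]
    omega
  · intro m c hn
    have := hd m
    have := hn.bounds
    simp only [place_zero, field, plane, iff_true, InField]
    omega

lemma Good.place {pos : ι → Cell} (hg : Good pos) (g : Motion) :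
    Good (fun m => place g (pos m)) :=
  ⟨(place_injective g).comp hg.injective,
    hg.linked.transport g (Equiv.refl _) (fun _ => rfl) (by simp)⟩

end

/-- The straight row of `n` modules that starts at the origin. -/
def row (n : ℕ) (m : Fin n) : Cell := ((m : ℕ), 0)

lemma row_good {n : ℕ} (hn : n < 5) : Good (row n) := by
  refine ⟨fun a b h => ?_, ?_⟩
  · simpa [row, Fin.ext_iff] using h
  · have : ∀ T : Fin n → Bool, (∃ a, T a = true) → (∃ b, T b = false) →
        ∃ a b, T a = true ∧ T b = false ∧ SideAdj (row n a) (row n b) := by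
      unfold SideAdj row
      interval_cases n <;> decide
    intro T ⟨a, _, ha⟩ ⟨b, _, hb⟩
    obtain ⟨x, y, h⟩ := this T ⟨a, ha⟩ ⟨b, hb⟩
    exact ⟨x, trivial, y, trivial, h⟩

/-- With frames that never change, a straight row of at most four modules can be confined to a
small part of the field. -/
lemma row_trapped {k w h n : ℕ} (A : Algorithm k) (hn : n < 5) (c : Cell)
    (hc : k + 10 ≤ c.1 ∧ c.1 + (k + 10) < w ∧ k + 10 ≤ c.2 ∧ c.2 + (k + 10) < h) :
    ∃ (fr : Fin n → Fin 4) (q : ℕ → Fin n → Cell),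
      Good (q 0) ∧ (∀ t, q (t + 1) = stepOf A (field w h) (q t) fr) ∧
      ∀ t m, Near 5 (q t m) c := by
  have hcard : Fintype.card (Fin n) ≤ 4 := by rw [Fintype.card_fin]; omega
  set fr : Fin n → Fin 4 := fun m => if 2 * (m : ℕ) + 1 < n then 0 else 2 with hfr
  set z : Cell := c + c + ((n : ℤ) - 1, 0) with hz
  set q : ℕ → Fin n → Cell := fun t =>
    (fun p => stepOf A (field w h) p fr)^[t] (fun m => place (0, c) (row n m)) with hq
  have hstep : ∀ t, q (t + 1) = stepOf A (field w h) (q t) fr :=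
    fun t => Function.iterate_succ_apply' _ _ _
  have h0 : Good (q 0) := (row_good hn).place (0, c)
  have key : ∀ t, Good (q t) ∧ SymBy Fin.rev z (q t) := by
    intro t
    have near : ∀ t, Good (q t) → SymBy Fin.rev z (q t) → Deep (k + 4) w h (q t) := by
      intro t hg hs m
      have := hs.near hcard hg m
      rw [abs_le, abs_le] at this
      simp only [hz, Prod.fst_add, Prod.snd_add] at this
      omega
    induction t with
    | zero =>
      refine ⟨h0, fun m => ?_⟩
      have := m.2
      simp only [hq, Function.iterate_zero, id, place, turn_zero, row, hz, Fin.val_rev]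
      ext
      · simp only [Prod.fst_add, Prod.fst_sub]; push_cast [show (m : ℕ) + 1 ≤ n by omega]; ring
      · simp
    | succ t ih =>
      rw [hstep]
      refine ⟨step_good A _ ih.1 _, ?_⟩
      rw [step_deep A hcard fr ih.1.linked (near t ih.1 ih.2)]
      refine ih.2.step A hcard ih.1 (fun m hm => ?_)
      have h2 : Fin.rev m ≠ m := by
        intro h
        have := ih.2 m
        rw [h] at this
        apply hm
        nth_rw 1 [this]; abel
      have := m.2
      have h3 : n - (m + 1) ≠ m := by simpa [Fin.ext_iff, Fin.val_rev] using h2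
      simp only [hfr, Fin.val_rev]
      by_cases h4 : 2 * (m : ℕ) + 1 < n
      · rw [if_neg (by omega), if_pos h4]; rfl
      · rw [if_pos (by omega), if_neg h4]; rfl
  refine ⟨fr, q, h0, hstep, fun t m => ?_⟩
  have := (key t).2.near hcard (key t).1 m
  rw [abs_le, abs_le] at this
  simp only [hz, Prod.fst_add, Prod.snd_add] at this
  have := m.2
  constructor <;> rw [abs_le] <;> omega

/-! ### Poses of rigid shapes and the frames of the adversary -/

section
variable {ι Θ : Type}

/-- Up to the names of the modules, `q` is the image of the shape `x.1` under the motion `x.2`. -/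
def Pose (base : Θ → ι → Cell) (x : Θ × Motion) (q : ι → Cell) : Prop :=
  ∃ π : Equiv.Perm ι, ∀ m, q m = place x.2 (base x.1 (π m))

/-- A family of pairwise incongruent connected shapes without rotational symmetry. -/
structure Rigid (base : Θ → ι → Cell) : Prop where
  good : ∀ τ, Good (base τ)
  unique : ∀ τ τ' g, Pose base (τ, g) (base τ') → τ = τ' ∧ g = (0, 0)

variable {base : Θ → ι → Cell}

lemma Pose.map {x : Θ × Motion} {q q' : ι → Cell} (h : Pose base x q) (g : Motion)
    (π : Equiv.Perm ι) (hq : ∀ m, q' m = place g (q (π m))) :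
    Pose base (x.1, comp g x.2) q' := by
  obtain ⟨ρ, hρ⟩ := h
  exact ⟨π.trans ρ, fun m => by rw [hq, hρ, place_comp]; rfl⟩

lemma Pose.symm {τ : Θ} {g : Motion} {q : ι → Cell} (h : Pose base (τ, g) q) :
    ∃ π : Equiv.Perm ι, ∀ m, base τ m = place (inv g) (q (π m)) := by
  obtain ⟨π, hπ⟩ := h
  exact ⟨π.symm, fun m => by rw [hπ, ← place_comp, inv_comp, place_zero]; simp⟩

lemma Rigid.pose_unique (hb : Rigid base) {x x' : Θ × Motion} {q : ι → Cell}
    (h : Pose base x q) (h' : Pose base x' q) : x = x' := by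
  obtain ⟨τ, g⟩ := x
  obtain ⟨τ', g'⟩ := x'
  obtain ⟨π, hπ⟩ := h'.symm
  obtain ⟨rfl, h2⟩ := hb.unique _ _ _ (h.map (inv g') π hπ)
  have : comp g' (comp (inv g') g) = comp g' (0, 0) := congrArg _ h2
  rw [← comp_assoc, comp_inv, comp_zero] at this
  have e : comp (0, 0) g = g := by simp [comp, turn_zero]
  rw [e] at this
  rw [this]

lemma Pose.good {x : Θ × Motion} {q : ι → Cell} (hb : Rigid base) (h : Pose base x q) :
    Good q := by
  obtain ⟨π, hπ⟩ := h
  refine ⟨fun a b hab => ?_, (hb.good x.1).linked.transport x.2 π hπ (by simp)⟩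
  rw [hπ, hπ] at hab
  exact π.injective ((hb.good x.1).injective (place_injective _ hab))

/-- The involution of the modules that realizes a central symmetry. -/
def SymBy.perm {σ : ι → ι} {z : Cell} {q : ι → Cell} (h : SymBy σ z q)
    (hq : Function.Injective q) : Equiv.Perm ι :=
  ⟨σ, σ, fun m => hq (by rw [h, h]; abel), fun m => hq (by rw [h, h]; abel)⟩

lemma SymBy.not_pose (hb : Rigid base) {σ : ι → ι} {z : Cell} {q : ι → Cell} (h : SymBy σ z q)
    (hq : Good q) (x : Θ × Motion) : ¬ Pose base x q := by
  intro hx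
  have h1 := hx.map (q' := q) (2, z) (h.perm hq.injective)
    (fun m => by rw [place_two]; change _ = z - q (σ m); rw [h]; abel)
  have := hb.pose_unique hx h1
  have h2 : x.2.1 = 2 + x.2.1 := congrArg (fun x => x.2.1) this
  exact absurd h2 (by generalize x.2.1 = r; revert r; decide)

variable [Fintype ι]

open Classical in
/-- The local frame that the adversary gives to a module that sees no wall. In a rigid shape all
frames follow the orientation of the shape; in any other state they are opposite on the two sides
of the centre of gravity, the sides being told apart lexicographically. -/
noncomputable def frameIn (base : Θ → ι → Cell) (q : ι → Cell) (m : ι) : Fin 4 :=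
  if h : ∃ x, Pose base x q then h.choose.2.1
  else if (Fintype.card ι : ℤ) * (q m).1 < ∑ i, (q i).1 ∨
      ((Fintype.card ι : ℤ) * (q m).1 = ∑ i, (q i).1 ∧
        (Fintype.card ι : ℤ) * (q m).2 < ∑ i, (q i).2) then 0 else 2

lemma frameIn_pose (hb : Rigid base) {x : Θ × Motion} {q : ι → Cell} (h : Pose base x q) (m : ι) :
    frameIn base q m = x.2.1 := by
  unfold frameIn
  have hex : ∃ x, Pose base x q := ⟨x, h⟩
  rw [dif_pos hex, hb.pose_unique hex.choose_spec h]

lemma sum_place_zero (v : Cell) (q : ι → Cell) :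
    ∑ i, (place (0, v) (q i)).1 = Fintype.card ι * v.1 + ∑ i, (q i).1 ∧
    ∑ i, (place (0, v) (q i)).2 = Fintype.card ι * v.2 + ∑ i, (q i).2 := by
  simp [place, turn_zero, Finset.sum_add_distrib]

lemma sum_place_two (v : Cell) (q : ι → Cell) :
    ∑ i, (place (2, v) (q i)).1 = Fintype.card ι * v.1 - ∑ i, (q i).1 ∧
    ∑ i, (place (2, v) (q i)).2 = Fintype.card ι * v.2 - ∑ i, (q i).2 := by
  simp [place_two, Finset.sum_sub_distrib]

/-- No module is at the centre of gravity. -/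
def OffCentre (q : ι → Cell) : Prop :=
  ∀ m, ¬ ((Fintype.card ι : ℤ) * (q m).1 = ∑ i, (q i).1 ∧
    (Fintype.card ι : ℤ) * (q m).2 = ∑ i, (q i).2)

lemma SymBy.two_sum {σ : ι → ι} {z : Cell} {q : ι → Cell} (h : SymBy σ z q)
    (hq : Function.Injective q) :
    2 * ∑ i, (q i).1 = Fintype.card ι * z.1 ∧ 2 * ∑ i, (q i).2 = Fintype.card ι * z.2 := by
  have h1 := (h.perm hq).sum_comp Finset.univ (fun m => (q m).1) (by simp)
  have h2 := (h.perm hq).sum_comp Finset.univ (fun m => (q m).2) (by simp)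
  have e : ∀ m, q (h.perm hq m) = z - q m := h
  simp only [e, Prod.fst_sub, Prod.snd_sub, Finset.sum_sub_distrib, Finset.sum_const,
    Finset.card_univ, nsmul_eq_mul] at h1 h2
  constructor <;> linarith

lemma SymBy.offCentre {σ : ι → ι} {z : Cell} {q : ι → Cell} (h : SymBy σ z q)
    (hq : Function.Injective q) (hz : ∀ m, q m + q m ≠ z) : OffCentre q := by
  rintro m ⟨h1, h2⟩
  obtain ⟨h3, h4⟩ := h.two_sum hq
  have hn : (Fintype.card ι : ℤ) ≠ 0 := by
    have : Nonempty ι := ⟨m⟩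
    exact_mod_cast Fintype.card_ne_zero
  apply hz m
  ext
  · simp only [Prod.fst_add]; apply mul_left_cancel₀ hn; linarith
  · simp only [Prod.snd_add]; apply mul_left_cancel₀ hn; linarith

lemma frameIn_zero {q q' : ι → Cell} (hb : Rigid base) (g : Motion) (π : Equiv.Perm ι)
    (hq : ∀ m, q' m = place g (q (π m)))
    (hg : g.1 = 0 ∨ (∃ x, Pose base x q) ∨ g.1 = 2 ∧ OffCentre q) (m : ι) :
    frameIn base q' m = g.1 + frameIn base q (π m) := by
  by_cases hx : ∃ x, Pose base x q
  · obtain ⟨x, hx⟩ := hx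
    rw [frameIn_pose hb hx, frameIn_pose hb (hx.map g π hq)]; rfl
  have hx' : ¬ ∃ x, Pose base x q' := by
    rintro ⟨x, h⟩
    exact hx ⟨_, h.map (inv g) π.symm (fun m => by
      rw [hq, ← place_comp, inv_comp, place_zero]; simp)⟩
  have hs1 : ∑ i, (q' i).1 = ∑ i, (place g (q i)).1 := by
    simp only [hq]; exact π.sum_comp Finset.univ (fun m => (place g (q m)).1) (by simp)
  have hs2 : ∑ i, (q' i).2 = ∑ i, (place g (q i)).2 := by
    simp only [hq]; exact π.sum_comp Finset.univ (fun m => (place g (q m)).2) (by simp)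
  unfold frameIn
  rw [dif_neg hx, dif_neg hx', hs1, hs2, hq m]
  obtain ⟨r, v⟩ := g
  rcases hg with h0 | h0 | ⟨h0, hoff⟩
  · obtain rfl : r = 0 := h0
    rw [(sum_place_zero v q).1, (sum_place_zero v q).2, zero_add]
    refine if_congr ?_ rfl rfl
    simp only [place, turn_zero, Prod.fst_add, Prod.snd_add, mul_add]
    omega
  · exact absurd h0 hx
  · obtain rfl : r = 2 := h0
    rw [(sum_place_two v q).1, (sum_place_two v q).2]
    have := hoff (π m)
    simp only [place_two, Prod.fst_sub, Prod.snd_sub, mul_sub]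
    generalize (Fintype.card ι : ℤ) * (q (π m)).1 = a at *
    generalize (Fintype.card ι : ℤ) * (q (π m)).2 = b at *
    split_ifs with h1 h2 h2 <;> first | rfl | (exfalso; omega)

lemma SymBy.frameIn (hb : Rigid base) {σ : ι → ι} {z : Cell} {q : ι → Cell} (h : SymBy σ z q)
    (hq : Good q) (m : ι) (hm : q m + q m ≠ z) :
    frameIn base q (σ m) = 2 + frameIn base q m := by
  have hx : ¬ ∃ x, Pose base x q := fun ⟨x, hx⟩ => h.not_pose hb hq x hx
  obtain ⟨h3, h4⟩ := h.two_sum hq.injective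
  have hn : (Fintype.card ι : ℤ) ≠ 0 := by
    have : Nonempty ι := ⟨m⟩
    exact_mod_cast Fintype.card_ne_zero
  have key : ¬ ((Fintype.card ι : ℤ) * (q m).1 = ∑ i, (q i).1 ∧
      (Fintype.card ι : ℤ) * (q m).2 = ∑ i, (q i).2) := by
    rintro ⟨h1, h2⟩
    apply hm
    ext
    · simp only [Prod.fst_add]; apply mul_left_cancel₀ hn; linarith
    · simp only [Prod.snd_add]; apply mul_left_cancel₀ hn; linarith
  unfold MRS.frameIn
  rw [dif_neg hx, dif_neg hx, h m]
  simp only [Prod.fst_sub, Prod.snd_sub, mul_sub]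
  rw [← h3, ← h4]
  generalize (Fintype.card ι : ℤ) * (q m).1 = a at *
  generalize (Fintype.card ι : ℤ) * (q m).2 = b at *
  split_ifs with h1 h2 h2 <;> first | rfl | (exfalso; omega)

/-- The step in the plane against the adversary's frames. -/
noncomputable def openStep (base : Θ → ι → Cell) {k : ℕ} (A : Algorithm k) (q : ι → Cell) :
    ι → Cell :=
  stepOf A plane q (frameIn base q)

lemma openStep_map (hb : Rigid base) (hc : Fintype.card ι ≤ 4) {k : ℕ} (A : Algorithm k)
    {q q' : ι → Cell} (hq : Good q) (g : Motion) (π : Equiv.Perm ι)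
    (hqq : ∀ m, q' m = place g (q (π m)))
    (hg : g.1 = 0 ∨ (∃ x, Pose base x q) ∨ g.1 = 2 ∧ OffCentre q) (m : ι) :
    openStep base A q' m = place g (openStep base A q (π m)) :=
  step_equivariant A hc hq.linked g π hqq (frameIn_zero hb g π hqq hg)
    (fun _ _ _ => Iff.rfl) (fun _ _ _ => Iff.rfl) m

lemma openStep_sym (hb : Rigid base) (hc : Fintype.card ι ≤ 4) {k : ℕ} (A : Algorithm k)
    {q : ι → Cell} (hq : Good q) {σ : ι → ι} {z : Cell} (h : SymBy σ z q) :
    SymBy σ z (openStep base A q) :=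
  h.step A hc hq (h.frameIn hb hq)

/-- The pose reached from the pose `x` when the standard shapes move as `f` says; `none` stands for
a centrally symmetric state. -/
def follow (f : Θ → Option (Θ × Motion)) (x : Θ × Motion) : Option (Θ × Motion) :=
  (f x.1).map fun y => (y.1, comp x.2 y.2)

/-- `f` describes the steps of the algorithm `A` from the standard shapes. -/
def Describes (base : Θ → ι → Cell) {k : ℕ} (A : Algorithm k) (f : Θ → Option (Θ × Motion)) :
    Prop :=
  ∀ τ, match f τ with
    | some y => Pose base y (openStep base A (base τ))
    | none => ∃ σ z, SymBy σ z (openStep base A (base τ))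

lemma Describes.step (hb : Rigid base) (hc : Fintype.card ι ≤ 4) {k : ℕ} {A : Algorithm k}
    {f : Θ → Option (Θ × Motion)} (hf : Describes base A f) {x : Θ × Motion} {q : ι → Cell}
    (hx : Pose base x q) :
    match follow f x with
    | some y => Pose base y (openStep base A q)
    | none => ∃ σ z, SymBy σ z (openStep base A q) := by
  obtain ⟨π, hπ⟩ := hx
  have hid : Pose base (x.1, ((0, 0) : Motion)) (base x.1) :=
    ⟨Equiv.refl _, fun m => by simp [place_zero]⟩
  have h1 := openStep_map hb hc A (hb.good x.1) x.2 π hπ (.inr (.inl ⟨_, hid⟩))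
  have h2 := hf x.1
  unfold follow
  rcases hfx : f x.1 with _ | y
  · rw [hfx] at h2
    obtain ⟨σ, z, hz⟩ := h2
    refine ⟨fun m => π.symm (σ (π m)), turn x.2.1 z + x.2.2 + x.2.2,
      fun m => ?_⟩
    rw [h1, h1, Equiv.apply_symm_apply, hz]
    simp only [place, turn_sub]
    abel
  · rw [hfx] at h2
    exact Pose.map h2 x.2 π h1

end

/-! ### The legal steps of the asymmetric polyominoes with three and four cells -/

/-- The three asymmetric tetrominoes: T, L and J. -/
def tetromino : Fin 3 → Fin 4 → Cell :=
  ![![(-1, 0), (0, 0), (1, 0), (0, 1)], ![(0, 2), (0, 1), (0, 0), (1, 0)],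
    ![(0, 2), (0, 1), (0, 0), (-1, 0)]]

/-- The asymmetric triomino. -/
def triomino : Fin 1 → Fin 3 → Cell := ![![(0, 0), (1, 0), (0, 1)]]

/-- The poses that each asymmetric tetromino can reach in one legal step, apart from centrally
symmetric states. -/
def tetrominoMoves : Fin 3 → List (Fin 3 × Motion) :=
  ![[(0, 0, (0, 0)), (0, 1, (0, 0)), (0, 2, (0, 1)), (0, 3, (0, 0)), (1, 1, (1, 0)),
      (1, 2, (0, 1)), (2, 2, (0, 1)), (2, 3, (-1, 0))],
    [(0, 2, (0, 1)), (0, 3, (0, 1)), (1, 0, (0, 0)), (1, 2, (0, 1)), (2, 2, (0, 1)),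
      (2, 2, (0, 2))],
    [(0, 1, (0, 1)), (0, 2, (0, 1)), (1, 2, (0, 1)), (1, 2, (0, 2)), (2, 0, (0, 0)),
      (2, 2, (0, 1))]]

/-- The poses that the asymmetric triomino can reach in one legal step, apart from centrally
symmetric states. -/
def triominoMoves : Fin 1 → List (Fin 1 × Motion) :=
  ![[(0, 0, (0, 0)), (0, 1, (1, 0)), (0, 2, (0, 0)), (0, 3, (0, 1))]]

instance (p q : Cell) : Decidable (SideAdj p q) :=
  inferInstanceAs (Decidable (|p.1 - q.1| + |p.2 - q.2| = 1))

/-! The rules of the model in a form that is checked by evaluation, for frames that agree with the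
global directions. -/

/-- `a` is to stay. -/
def isStay : Action → Bool
  | .stay => true
  | _ => false

lemma isStay_iff (a : Action) : isStay a = true ↔ a = .stay := by cases a <;> simp [isStay]

/-- The cells swept by an action, as a list. -/
def sweptList (p : Cell) : Action → List Cell
  | .stay => []
  | .rotate j b => [p + spin b (-dirVec j), p + dirVec j + spin b (-dirVec j)]
  | .slide j _ l => (List.range l).map fun i : ℕ =>
      (p.1 + ((i : ℤ) + 1) * (dirVec j).1, p.2 + ((i : ℤ) + 1) * (dirVec j).2)

/-- The cells of the guiding modules, as a list. -/
def guideList (p : Cell) : Action → List Cell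
  | .stay => []
  | .rotate j _ => [p + dirVec j]
  | .slide j b l => (List.range (l + 1)).map fun i : ℕ =>
      (p.1 + (spin b (dirVec j)).1 + (i : ℤ) * (dirVec j).1,
        p.2 + (spin b (dirVec j)).2 + (i : ℤ) * (dirVec j).2)

/-- The destination of an action. -/
def target (p : Cell) : Action → Cell
  | .stay => p
  | .rotate j b => p + dirVec j + spin b (-dirVec j)
  | .slide j _ l => (p.1 + l * (dirVec j).1, p.2 + l * (dirVec j).2)

lemma mem_sweptList (p c : Cell) (a : Action) : c ∈ sweptList p a ↔ c ∈ swept p 0 a := by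
  cases a with
  | stay => simp [sweptList, swept]
  | rotate j b => simp [sweptList, swept, turn_zero]
  | slide j b l =>
    simp only [sweptList, swept, List.mem_map, List.mem_range, Set.mem_ofPred_eq, turn_zero]
    constructor
    · rintro ⟨i, hi, rfl⟩
      exact ⟨i + 1, by omega, by omega, by ext <;> simp⟩
    · rintro ⟨i, h1, h2, rfl⟩
      refine ⟨i - 1, by omega, ?_⟩
      have : ((i - 1 : ℕ) : ℤ) + 1 = i := by omega
      ext <;> simp [this]

lemma mem_guideList (p c : Cell) (a : Action) : c ∈ guideList p a ↔ c ∈ guides p 0 a := by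
  cases a with
  | stay => simp [guideList, guides]
  | rotate j b => simp [guideList, guides, turn_zero]
  | slide j b l =>
    simp only [guideList, guides, List.mem_map, List.mem_range, Set.mem_ofPred_eq, turn_zero]
    constructor
    · rintro ⟨i, hi, rfl⟩
      exact ⟨i, by omega, by ext <;> simp⟩
    · rintro ⟨i, h2, rfl⟩
      exact ⟨i, by omega, by ext <;> simp⟩

lemma target_eq (p : Cell) (a : Action) : target p a = dest p 0 a := by
  cases a with
  | stay => rfl
  | rotate j b => rfl
  | slide j b l => ext <;> simp [target, dest, turn_zero]

/-- The actions that a module of an MRS of at most four modules can take. -/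
def shortActions : List Action :=
  .stay :: ((List.finRange 4).flatMap fun j => [true, false].flatMap fun b =>
    [.rotate j b, .slide j b 1, .slide j b 2, .slide j b 3])

/-- The module at `p` could take the action `a` if nothing else moved. -/
def feasible {n : ℕ} (pos : Fin n → Cell) (p : Cell) (a : Action) : Bool :=
  ((guideList p a).all fun c => (List.finRange n).any fun m => pos m == c) &&
  ((sweptList p a).all fun c => (List.finRange n).all fun m => pos m != c)

/-- The feasible actions of a module. -/
def choices {n : ℕ} (pos : Fin n → Cell) (m : Fin n) : List Action :=
  shortActions.filter (feasible pos (pos m))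

/-- Necessary conditions for a joint step to be legal. -/
def compatible {n : ℕ} (pos : Fin n → Cell) (act : Fin n → Action) : Bool :=
  ((List.finRange n).all fun m => (guideList (pos m) (act m)).all fun c =>
    (List.finRange n).any fun m' => isStay (act m') && (pos m' == c)) &&
  ((List.finRange n).all fun m => (List.finRange n).all fun m' => m == m' ||
    (sweptList (pos m) (act m)).all fun c => !((sweptList (pos m') (act m')).contains c)) &&
  ((List.finRange n).all fun m => !(isStay (act m)) ||
    ((List.finRange n).all fun m' => m == m' || !(isStay (act m'))) ||
    (List.finRange n).any fun m' => isStay (act m') && decide (SideAdj (pos m) (pos m')))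

/-- The configuration `q` is centrally symmetric or in one of the poses of the list `l`. -/
def expected {n : ℕ} {Θ : Type} (base : Θ → Fin n → Cell) (l : List (Θ × Motion))
    (q : Fin n → Cell) : Bool :=
  (l.any fun x => (List.finRange n).all fun m => (List.finRange n).any fun m' =>
    q m == place x.2 (base x.1 m')) ||
  ((List.finRange n).any fun i => (List.finRange n).any fun j => (List.finRange n).all fun m =>
    (List.finRange n).any fun m' => q m' == q i + q j - q m)

lemma act_mem_choices {n : ℕ} (hn : n < 5) {free : Cell → Prop} {pos : Fin n → Cell}
    (hg : Good pos) {act : Fin n → Action} (h : LocalLegal free pos (fun _ => 0) act)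
    (m : Fin n) : act m ∈ choices pos m := by
  have hcard : Fintype.card (Fin n) ≤ 4 := by rw [Fintype.card_fin]; omega
  have hgd := h.guided m
  have hth := h.through m
  have hpr := h.proper m
  have hnear : ∀ c ∈ swept (pos m) 0 (act m), Near 3 c (pos m) := fun c hc =>
    swept_near hcard hg.linked _ _ _ (fun c hcg => (hgd c hcg).imp fun _ h => h.1) hc
  simp only [choices, List.mem_filter, feasible, Bool.and_eq_true, List.all_eq_true,
    List.any_eq_true, List.mem_finRange, true_and, beq_iff_eq, bne_iff_ne, mem_guideList,
    mem_sweptList]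
  refine ⟨?_, fun c hc => (hgd c hc).imp fun _ h => h.1, fun c hc x _ => (hth c hc).2 x⟩
  rcases action_cases (act m) with ha | ⟨j, b, ha⟩ | ⟨j, b, l, ha⟩
  · rw [ha]; simp [shortActions]
  · rw [ha]
    simp only [shortActions, List.mem_cons, List.mem_flatMap, List.mem_finRange, true_and]
    exact .inr ⟨j, b, by cases b <;> simp, by simp⟩
  · rw [ha] at hnear hpr ⊢
    have h1 := hnear _ ⟨l, hpr, le_rfl, rfl⟩
    have hl : l ≤ 3 := by
      obtain ⟨h1, h2⟩ := h1
      simp only [turn_zero, Prod.fst_add, Prod.snd_add, add_sub_cancel_left, Prod.smul_fst,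
        Prod.smul_snd, smul_eq_mul, abs_mul, Nat.abs_cast] at h1 h2
      have h3 := (dirVec_sum 0 j b).1
      rw [turn_zero] at h3
      rcases fin_four_cases j with rfl | rfl | rfl | rfl <;>
        simp [dirVec, turn_zero, turn_one, turn_two, turn_three] at h1 h2 <;> omega
    have hl1 : 1 ≤ l := hpr
    simp only [shortActions, List.mem_cons, List.mem_flatMap, List.mem_finRange, true_and]
    refine .inr ⟨j, b, by cases b <;> simp, ?_⟩
    interval_cases l <;> simp

lemma compatible_of_legal {n : ℕ} {free : Cell → Prop} {pos : Fin n → Cell}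
    {act : Fin n → Action} (h : LocalLegal free pos (fun _ => 0) act) :
    compatible pos act = true := by
  simp only [compatible, Bool.and_eq_true, List.all_eq_true, List.any_eq_true, List.mem_finRange,
    true_and, beq_iff_eq, mem_guideList, isStay_iff, Bool.or_eq_true, Bool.not_eq_true',
    List.contains_eq_mem, decide_eq_false_iff_not, mem_sweptList, decide_eq_true_eq]
  refine ⟨⟨fun m _ c hc => ?_, fun m _ m' _ => ?_⟩, fun m _ => ?_⟩
  · obtain ⟨m', h1, h2⟩ := h.guided m c hc
    exact ⟨m', h2, h1⟩
  · by_cases hm : m = m'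
    · exact .inl hm
    · exact .inr fun c hc hc' => Set.disjoint_left.1 (h.no_overlap m m' hm) hc hc'
  · by_cases hm : act m = .stay
    · by_cases hx : ∃ x, act x = .stay ∧ m ≠ x
      · obtain ⟨x, hx, hne⟩ := hx
        obtain ⟨a, ha, b, hb, h1, h2, h3⟩ := h.backbone (fun x => decide (x = m))
          ⟨m, hm, by simp⟩ ⟨x, hx, by simpa using hne.symm⟩
        obtain rfl : a = m := by simpa using h1
        exact .inr ⟨b, hb, h3⟩
      · push Not at hx
        refine .inl (.inr fun x _ => ?_)
        by_cases h1 : m = x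
        · exact .inl h1
        · refine .inr ?_
          by_contra h2
          rw [Bool.not_eq_false, isStay_iff] at h2
          exact h1 (hx x h2)
    · refine .inl (.inl ?_)
      by_contra h2
      rw [Bool.not_eq_false, isStay_iff] at h2
      exact hm h2

/-- It is enough that each module is in a cell of the shape; no cell is then left free. -/
lemma pose_of_subset {n : ℕ} {Θ : Type} {base : Θ → Fin n → Cell} {x : Θ × Motion}
    {q : Fin n → Cell} (hq : Function.Injective q) (h : ∀ m, ∃ m', q m = place x.2 (base x.1 m')) :
    Pose base x q := by
  choose f hf using h
  have hinj : Function.Injective f := fun a b hab => hq (by rw [hf, hf, hab])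
  exact ⟨Equiv.ofBijective f (Finite.injective_iff_bijective.1 hinj), fun m => hf m⟩

lemma of_expected {n : ℕ} {Θ : Type} {base : Θ → Fin n → Cell} {l : List (Θ × Motion)}
    {q : Fin n → Cell} (hq : Function.Injective q) (h : expected base l q = true) :
    (∃ x ∈ l, Pose base x q) ∨ ∃ σ z, SymBy σ z q := by
  simp only [expected, Bool.or_eq_true, List.any_eq_true, List.all_eq_true, List.mem_finRange,
    true_and, beq_iff_eq] at h
  rcases h with ⟨x, hx, h⟩ | ⟨i, j, h⟩
  · exact .inl ⟨x, hx, pose_of_subset hq fun m => h m trivial⟩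
  · choose σ hσ using fun m => h m trivial
    exact .inr ⟨σ, q i + q j, hσ⟩

lemma tetromino_steps : ∀ τ, ((choices (tetromino τ) 0).all fun a => (choices (tetromino τ) 1).all
    fun b => (choices (tetromino τ) 2).all fun c => (choices (tetromino τ) 3).all fun d =>
      !(compatible (tetromino τ) ![a, b, c, d]) || expected tetromino (tetrominoMoves τ)
        fun m => target (tetromino τ m) (![a, b, c, d] m)) = true := by
  decide +kernel

lemma triomino_steps : ∀ τ, ((choices (triomino τ) 0).all fun a => (choices (triomino τ) 1).all
    fun b => (choices (triomino τ) 2).all fun c =>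
      !(compatible (triomino τ) ![a, b, c]) || expected triomino (triominoMoves τ)
        fun m => target (triomino τ m) (![a, b, c] m)) = true := by
  decide +kernel

lemma linked_of_forall {n : ℕ} {pos : Fin n → Cell}
    (h : ∀ T : Fin n → Bool, (∃ a, T a = true) → (∃ b, T b = false) →
      ∃ a b, T a = true ∧ T b = false ∧ SideAdj (pos a) (pos b)) : Linked pos Set.univ := by
  rintro T ⟨a, _, ha⟩ ⟨b, _, hb⟩
  obtain ⟨x, y, h⟩ := h T ⟨a, ha⟩ ⟨b, hb⟩
  exact ⟨x, trivial, y, trivial, h⟩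

lemma tetromino_good (τ : Fin 3) : Good (tetromino τ) :=
  ⟨by revert τ; unfold Function.Injective; decide,
    linked_of_forall (by revert τ; decide +kernel)⟩

lemma triomino_good (τ : Fin 1) : Good (triomino τ) :=
  ⟨by revert τ; unfold Function.Injective; decide,
    linked_of_forall (by revert τ; decide +kernel)⟩

/-- Rigidity is a finite check for shapes that contain the origin: a motion that takes one shape to
another moves the origin to a cell of the latter. -/
lemma rigid_of_forall {n : ℕ} {Θ : Type} {base : Θ → Fin n → Cell} (hg : ∀ τ, Good (base τ))
    (h0 : ∀ τ, ∃ m, base τ m = (0, 0))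
    (h : ∀ τ τ' r j, (∀ m, ∃ m', base τ' m = place (r, base τ' j) (base τ m')) →
      τ = τ' ∧ r = 0 ∧ base τ' j = (0, 0)) : Rigid base := by
  refine ⟨hg, ?_⟩
  rintro τ τ' ⟨r, v⟩ ⟨π, hπ⟩
  obtain ⟨m, hm⟩ := h0 τ
  have hv : base τ' (π.symm m) = v := by
    rw [hπ, Equiv.apply_symm_apply, hm]
    have : ∀ r, turn r ((0, 0) : Cell) = 0 := by decide
    simp [place, this]
  obtain ⟨h1, h2, h3⟩ := h τ τ' r (π.symm m) (fun m' => ⟨π m', by rw [hv]; exact hπ m'⟩)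
  rw [hv] at h3
  exact ⟨h1, by rw [h2, h3]; rfl⟩

lemma tetromino_rigid : Rigid tetromino :=
  rigid_of_forall tetromino_good (by decide) (by decide +kernel)

lemma triomino_rigid : Rigid triomino :=
  rigid_of_forall triomino_good (by decide) (by decide +kernel)

lemma exists_describes {n : ℕ} {Θ : Type} {base : Θ → Fin n → Cell} (hb : Rigid base)
    {moves : Θ → List (Θ × Motion)} (hid : ∀ τ, (τ, ((0, 0) : Motion)) ∈ moves τ)
    (hm : ∀ τ act, LocalLegal (fun _ => True) (base τ) (fun _ => 0) act →
      expected base (moves τ) (fun m => target (base τ m) (act m)) = true)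
    {k : ℕ} (A : Algorithm k) :
    ∃ f : Θ → Option (Θ × Motion), Describes base A f ∧ ∀ τ, ∀ y ∈ f τ, y ∈ moves τ := by
  have key : ∀ τ, ∃ o : Option (Θ × Motion), (match o with
      | some y => Pose base y (openStep base A (base τ))
      | none => ∃ σ z, SymBy σ z (openStep base A (base τ))) ∧ ∀ y ∈ o, y ∈ moves τ := by
    intro τ
    have hpose : Pose base (τ, ((0, 0) : Motion)) (base τ) :=
      ⟨Equiv.refl _, fun m => by simp [place_zero]⟩
    have hfr : frameIn base (base τ) = fun _ => 0 :=
      funext fun m => frameIn_pose hb hpose m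
    unfold openStep stepOf
    rw [hfr]
    split_ifs with h
    · have h1 := hm τ _ h
      simp only [target_eq] at h1
      rcases of_expected (h.good (hb.good τ).injective).injective h1 with ⟨x, hx, h2⟩ | h2
      · exact ⟨some x, h2, by simpa using hx⟩
      · exact ⟨none, h2, by simp⟩
    · exact ⟨some (τ, (0, 0)), hpose, by simpa using hid τ⟩
  choose f hf using key
  exact ⟨f, fun τ => (hf τ).1, fun τ => (hf τ).2⟩

lemma tetromino_describes {k : ℕ} (A : Algorithm k) :
    ∃ f, Describes tetromino A f ∧ ∀ τ, ∀ y ∈ f τ, y ∈ tetrominoMoves τ := by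
  refine exists_describes tetromino_rigid (by decide) (fun τ act h => ?_) A
  have h1 := tetromino_steps τ
  simp only [List.all_eq_true] at h1
  have h2 := act_mem_choices (by norm_num) (tetromino_good τ) h
  have h3 := h1 _ (h2 0) _ (h2 1) _ (h2 2) _ (h2 3)
  have e : ![act 0, act 1, act 2, act 3] = act := by
    funext m; fin_cases m <;> rfl
  rw [e, compatible_of_legal h] at h3
  simpa using h3

lemma triomino_describes {k : ℕ} (A : Algorithm k) :
    ∃ f, Describes triomino A f ∧ ∀ τ, ∀ y ∈ f τ, y ∈ triominoMoves τ := by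
  refine exists_describes triomino_rigid (by decide) (fun τ act h => ?_) A
  have h1 := triomino_steps τ
  simp only [List.all_eq_true] at h1
  have h2 := act_mem_choices (by norm_num) (triomino_good τ) h
  have h3 := h1 _ (h2 0) _ (h2 1) _ (h2 2)
  have e : ![act 0, act 1, act 2] = act := by
    funext m; fin_cases m <;> rfl
  rw [e, compatible_of_legal h] at h3
  simpa using h3

/-! ### Classification of the tetrominoes -/

lemma SideAdj.exists_dir {p q : Cell} (h : SideAdj p q) : ∃ j, q = p + dirVec j := by
  obtain ⟨a, b⟩ := p
  obtain ⟨c, d⟩ := q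
  have h1 : |a - c| + |b - d| = 1 := h
  have h2 : (c = a + 1 ∧ d = b) ∨ (c = a ∧ d = b + 1) ∨ (c = a - 1 ∧ d = b) ∨
      (c = a ∧ d = b - 1) := by
    rcases abs_cases (a - c) with h | h <;> rcases abs_cases (b - d) with h' | h' <;> omega
  rcases h2 with ⟨rfl, rfl⟩ | ⟨rfl, rfl⟩ | ⟨rfl, rfl⟩ | ⟨rfl, rfl⟩
  · exact ⟨0, by simp [dirVec, turn_zero]⟩
  · exact ⟨1, by simp [dirVec, turn_one]⟩
  · exact ⟨2, by simp [dirVec, turn_two, sub_eq_add_neg]⟩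
  · exact ⟨3, by simp [dirVec, turn_three, sub_eq_add_neg]⟩

/-- The cells of a tetromino that is grown from the origin: the second cell is next to the first,
the third next to the cell numbered `e₁`, and the fourth next to the one numbered `e₂`. -/
def grown (j₁ j₂ j₃ : Fin 4) (e₁ : Fin 2) (e₂ : Fin 3) : Fin 4 → Cell :=
  let a := dirVec j₁
  let b := ![(0, 0), a] e₁ + dirVec j₂
  ![(0, 0), a, b, ![(0, 0), a, b] e₂ + dirVec j₃]

/-- `p` is in the pose of an asymmetric tetromino, or it is centrally symmetric about a point that
is not the centre of a cell of `p`. -/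
def classified (p : Fin 4 → Cell) : Bool :=
  ((List.finRange 3).any fun τ => (List.finRange 4).any fun r => (List.finRange 4).any fun j =>
    (List.finRange 4).all fun m => (List.finRange 4).any fun m' =>
      p m == place (r, p j) (tetromino τ m')) ||
  ((List.finRange 4).any fun j => (List.finRange 4).all fun m =>
    ((List.finRange 4).any fun m' => p m' == p 0 + p j - p m) && (p m + p m != p 0 + p j))

lemma grown_classified : ∀ j₁ j₂ j₃ e₁ e₂, (decide (∀ a b, grown j₁ j₂ j₃ e₁ e₂ a =
    grown j₁ j₂ j₃ e₁ e₂ b → a = b) → classified (grown j₁ j₂ j₃ e₁ e₂) = true) := by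
  decide +kernel

/-- A connected set of four cells is an asymmetric tetromino or centrally symmetric. -/
lemma tetromino_classification {q : Fin 4 → Cell} (hq : Good q) :
    (∃ x, Pose tetromino x q) ∨ ∃ σ z, SymBy σ z q ∧ ∀ m, q m + q m ≠ z := by
  have grow : ∀ T : Fin 4 → Bool, (∃ a, T a = true) → (∃ b, T b = false) →
      ∃ a b j, T a = true ∧ T b = false ∧ q b = q a + dirVec j := by
    intro T ⟨a, ha⟩ ⟨b, hb⟩
    obtain ⟨x, -, y, -, h1, h2, h3⟩ := hq.linked T ⟨a, trivial, ha⟩ ⟨b, trivial, hb⟩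
    obtain ⟨j, hj⟩ := h3.exists_dir
    exact ⟨x, y, j, h1, h2, hj⟩
  obtain ⟨a, b₁, j₁, ha, hb₁, h₁⟩ := grow (fun m => decide (m = 0)) ⟨0, rfl⟩ ⟨1, rfl⟩
  obtain rfl : a = 0 := by simpa using ha
  have hb₁ : b₁ ≠ 0 := by simpa using hb₁
  have ex2 : ∀ b₁ : Fin 4, ∃ m, m ≠ 0 ∧ m ≠ b₁ := by decide
  obtain ⟨a₁, b₂, j₂, ha₁, hb₂, h₂⟩ := grow (fun m => decide (m = 0 ∨ m = b₁)) ⟨0, by simp⟩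
    (by simpa using ex2 b₁)
  have ha₁ : a₁ = 0 ∨ a₁ = b₁ := by simpa using ha₁
  have hb₂ : b₂ ≠ 0 ∧ b₂ ≠ b₁ := by simpa using hb₂
  have ex3 : ∀ b₁ b₂ : Fin 4, ∃ m, m ≠ 0 ∧ m ≠ b₁ ∧ m ≠ b₂ := by decide
  obtain ⟨a₂, b₃, j₃, ha₂, hb₃, h₃⟩ := grow (fun m => decide (m = 0 ∨ m = b₁ ∨ m = b₂))
    ⟨0, by simp⟩ (by simpa using ex3 b₁ b₂)
  have ha₂ : a₂ = 0 ∨ a₂ = b₁ ∨ a₂ = b₂ := by simpa using ha₂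
  have hb₃ : b₃ ≠ 0 ∧ b₃ ≠ b₁ ∧ b₃ ≠ b₂ := by simpa using hb₃
  set e : Fin 4 → Fin 4 := ![0, b₁, b₂, b₃] with he
  have hinj : Function.Injective e := by
    have : ∀ b₁ b₂ b₃ : Fin 4, b₁ ≠ 0 → b₂ ≠ 0 → b₂ ≠ b₁ → b₃ ≠ 0 → b₃ ≠ b₁ → b₃ ≠ b₂ →
        ∀ i j, (![0, b₁, b₂, b₃] : Fin 4 → Fin 4) i = (![0, b₁, b₂, b₃] : Fin 4 → Fin 4) j →
          i = j := by decide +kernel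
    exact fun i j => this b₁ b₂ b₃ hb₁ hb₂.1 hb₂.2 hb₃.1 hb₃.2.1 hb₃.2.2 i j
  set ε := Equiv.ofBijective e (Finite.injective_iff_bijective.1 hinj) with hε
  obtain ⟨e₁, he₁⟩ : ∃ e₁ : Fin 2, q a₁ = q 0 + (![(0, 0), dirVec j₁] : Fin 2 → Cell) e₁ := by
    rcases ha₁ with rfl | rfl
    · exact ⟨0, by simp⟩
    · exact ⟨1, by simpa using h₁⟩
  set b : Cell := (![(0, 0), dirVec j₁] : Fin 2 → Cell) e₁ + dirVec j₂ with hbdef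
  have h₂' : q b₂ = q 0 + b := by rw [h₂, he₁, hbdef, add_assoc]
  obtain ⟨e₂, he₂⟩ : ∃ e₂ : Fin 3, q a₂ = q 0 + (![(0, 0), dirVec j₁, b] : Fin 3 → Cell) e₂ := by
    rcases ha₂ with rfl | rfl | rfl
    · exact ⟨0, by simp⟩
    · exact ⟨1, by simpa using h₁⟩
    · exact ⟨2, by simpa using h₂'⟩
  have hp : ∀ m, q (ε m) = q 0 + grown j₁ j₂ j₃ e₁ e₂ m := by
    intro m
    change q (e m) = _
    fin_cases m
    · simp [e, grown]
    · simpa [e, grown] using h₁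
    · simpa [e, grown] using h₂'
    · simpa [e, grown, he₂, add_assoc] using h₃
  set p := grown j₁ j₂ j₃ e₁ e₂
  have hpinj : Function.Injective p := fun i j hij => ε.injective (hq.injective (by
    rw [hp, hp, hij]))
  have hcl : classified p = true := grown_classified j₁ j₂ j₃ e₁ e₂ (by
    simpa using fun a b h => hpinj h)
  simp only [classified, Bool.or_eq_true, List.any_eq_true, List.all_eq_true, List.mem_finRange,
    true_and, beq_iff_eq, Bool.and_eq_true, bne_iff_ne] at hcl
  rcases hcl with ⟨τ, r, j, h⟩ | ⟨j, h⟩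
  · left
    refine ⟨_, (pose_of_subset (x := (τ, (r, p j))) hpinj fun m => h m trivial).map (0, q 0) ε.symm
      (fun m => ?_)⟩
    have := hp (ε.symm m)
    rw [Equiv.apply_symm_apply] at this
    rw [this]; rfl
  · right
    choose σ hσ using fun m => (h m trivial).1
    have hne := fun m => (h m trivial).2
    have hq' : ∀ m, q m = q 0 + p (ε.symm m) := fun m => by
      have := hp (ε.symm m)
      rwa [Equiv.apply_symm_apply] at this
    refine ⟨fun m => ε (σ (ε.symm m)), q 0 + q 0 + (p 0 + p j), fun m => ?_, fun m hm => ?_⟩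
    · rw [hp, hσ, hq' m]; abel
    · rw [hq' m] at hm
      apply hne (ε.symm m)
      have : q 0 + q 0 + (p (ε.symm m) + p (ε.symm m)) = q 0 + q 0 + (p 0 + p j) := by
        rw [← hm]; abel
      exact add_left_cancel this

/-! ### Confined asymmetric states -/

section
variable {Θ : Type}

/-- The pose reached after `t` steps from the standard pose of the shape `τ`. -/
def orbit (f : Θ → Option (Θ × Motion)) (τ : Θ) (t : ℕ) : Option (Θ × Motion) :=
  (fun o => o.bind (follow f))^[t] (some (τ, (0, 0)))

lemma orbit_succ (f : Θ → Option (Θ × Motion)) (τ : Θ) (t : ℕ) :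
    orbit f τ (t + 1) = (orbit f τ t).bind (follow f) := Function.iterate_succ_apply' _ _ _

lemma orbit_none {f : Θ → Option (Θ × Motion)} {τ : Θ} {s t : ℕ} (hst : s ≤ t)
    (h : orbit f τ s = none) : orbit f τ t = none := by
  induction t, hst using Nat.le_induction with
  | base => exact h
  | succ t _ ih => rw [orbit_succ, ih]; rfl

/-- Starting from the shape `τ`, the poses become periodic or a centrally symmetric state is
reached. With at most three shapes the preperiod is at most `2`; the period divides `24` because it
is the product of a cycle length in `{1, 2, 3}` and the order of a rotation by right angles. -/
def Confined [DecidableEq Θ] (f : Θ → Option (Θ × Motion)) (τ : Θ) : Bool :=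
  orbit f τ 26 == none || orbit f τ 26 == orbit f τ 2

lemma exists_le_of_confined [DecidableEq Θ] {f : Θ → Option (Θ × Motion)} {τ : Θ}
    (h : Confined f τ = true) (t : ℕ) : ∃ t' ≤ 26, orbit f τ t = orbit f τ t' := by
  simp only [Confined, Bool.or_eq_true, beq_iff_eq] at h
  induction t with
  | zero => exact ⟨0, by omega, rfl⟩
  | succ t ih =>
    obtain ⟨t', ht', he⟩ := ih
    rw [orbit_succ, he, ← orbit_succ]
    rcases Nat.lt_or_ge t' 26 with hlt | hge
    · exact ⟨t' + 1, by omega, rfl⟩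
    · obtain rfl : t' = 26 := by omega
      rcases h with h | h
      · exact ⟨26, le_rfl, by rw [h]; exact orbit_none (by omega) h⟩
      · refine ⟨3, by omega, ?_⟩
        rw [orbit_succ, h, ← orbit_succ]

variable {ι : Type} [Fintype ι] {base : Θ → ι → Cell}

/-- The configuration after `t` steps in the plane from the standard pose of the shape `τ`. -/
noncomputable def openRun (base : Θ → ι → Cell) {k : ℕ} (A : Algorithm k) (τ : Θ) (t : ℕ) :
    ι → Cell := (openStep base A)^[t] (base τ)

lemma openRun_succ {k : ℕ} (A : Algorithm k) (τ : Θ) (t : ℕ) :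
    openRun base A τ (t + 1) = openStep base A (openRun base A τ t) :=
  Function.iterate_succ_apply' _ _ _

lemma openRun_good (hb : Rigid base) {k : ℕ} (A : Algorithm k) (τ : Θ) (t : ℕ) :
    Good (openRun base A τ t) := by
  induction t with
  | zero => exact hb.good τ
  | succ t ih => rw [openRun_succ]; exact step_good A _ ih _

lemma openRun_near (hb : Rigid base) (hc : Fintype.card ι ≤ 4) {k : ℕ} (A : Algorithm k) (τ : Θ)
    (t : ℕ) (m : ι) : Near (3 * t) (openRun base A τ t m) (base τ m) := by
  induction t with
  | zero => constructor <;> simp [openRun]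
  | succ t ih =>
    rw [openRun_succ]
    exact ((step_near A hc _ (openRun_good hb A τ t).linked _ m).trans ih).mono
      (by push_cast; omega)

lemma openRun_pose (hb : Rigid base) (hc : Fintype.card ι ≤ 4) {k : ℕ} {A : Algorithm k}
    {f : Θ → Option (Θ × Motion)} (hf : Describes base A f) {τ : Θ} :
    ∀ (t : ℕ) (x : Θ × Motion), orbit f τ t = some x → Pose base x (openRun base A τ t) := by
  intro t
  induction t with
  | zero =>
    intro x hx
    obtain rfl : (τ, (0, 0)) = x := by simpa [orbit] using hx
    exact ⟨Equiv.refl _, fun m => by simp [place_zero, openRun]⟩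
  | succ t ih =>
    intro x hx
    rw [orbit_succ] at hx
    rcases ho : orbit f τ t with _ | y
    · rw [ho] at hx; simp at hx
    · rw [ho] at hx
      have h1 := hf.step hb hc (ih y ho)
      rw [show follow f y = some x from hx] at h1
      rw [openRun_succ]; exact h1

/-- From a confined shape the modules stay near the origin. -/
lemma openRun_bounded [DecidableEq Θ] (hb : Rigid base) (hc : Fintype.card ι ≤ 4) {k : ℕ}
    {A : Algorithm k} {f : Θ → Option (Θ × Motion)} (hf : Describes base A f) {τ : Θ}
    (h : Confined f τ = true) (h0 : ∀ m, Near 2 (base τ m) (0, 0)) (t : ℕ) (m : ι) :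
    Near 90 (openRun base A τ t m) (0, 0) := by
  have early : ∀ t ≤ 26, ∀ m, Near 80 (openRun base A τ t m) (0, 0) := fun t ht m =>
    ((openRun_near hb hc A τ t m).trans (h0 m)).mono (by omega)
  rcases ho : orbit f τ t with _ | x
  · have hex : ∃ s, orbit f τ s = none := ⟨t, ho⟩
    classical
    set s := Nat.find hex with hs
    have hs0 : orbit f τ s = none := Nat.find_spec hex
    have hst : s ≤ t := Nat.find_min' hex ho
    obtain ⟨t', ht', he⟩ := exists_le_of_confined h s
    have hs26 : s ≤ 26 := (Nat.find_min' hex (he ▸ hs0)).trans ht'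
    obtain ⟨r, hr⟩ : ∃ r, s = r + 1 := by
      rcases hsz : s with _ | r
      · rw [hsz] at hs0; simp [orbit] at hs0
      · exact ⟨r, rfl⟩
    obtain ⟨y, hy⟩ : ∃ y, orbit f τ r = some y :=
      Option.ne_none_iff_exists'.1 (Nat.find_min hex (m := r) (by omega))
    have h1 := hf.step hb hc (openRun_pose hb hc hf r y hy)
    have h2 : follow f y = none := by
      rw [hr, orbit_succ, hy] at hs0; exact hs0
    rw [h2] at h1
    obtain ⟨σ, z, hz⟩ := h1
    rw [← openRun_succ, ← hr] at hz
    have hall : ∀ t, s ≤ t → SymBy σ z (openRun base A τ t) := by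
      intro t hst
      induction t, hst using Nat.le_induction with
      | base => exact hz
      | succ t _ ih =>
        rw [openRun_succ]; exact openStep_sym hb hc A (openRun_good hb A τ t) ih
    have n1 := hz.near hc (openRun_good hb A τ s) m
    have n2 := (hall t hst).near hc (openRun_good hb A τ t) m
    have n3 := (early s hs26 m).bounds
    rw [abs_le, abs_le] at n1 n2
    dsimp only at n3
    constructor <;> rw [abs_le] <;> dsimp only <;> omega
  · obtain ⟨t', ht', he⟩ := exists_le_of_confined h t
    obtain ⟨π, hπ⟩ := openRun_pose hb hc hf t x ho
    obtain ⟨ρ, hρ⟩ := openRun_pose hb hc hf t' x (he ▸ ho)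
    have := early t' ht' (ρ.symm (π m))
    rw [hρ, Equiv.apply_symm_apply, ← hπ] at this
    exact this.mono (by norm_num)

lemma Pose.not_symmetricState (hb : Rigid base) {x : Θ × Motion} {q : ι → Cell}
    (h : Pose base x q) : ¬ SymmetricState (Set.range q) := by
  rintro ⟨r, v, hr, himg, -⟩
  have key : ∀ m, ∃ m', q m = place (r, v) (q m') := by
    intro m
    have : q m ∈ (fun c => turn r c + v) '' Set.range q := by rw [himg]; exact ⟨m, rfl⟩
    obtain ⟨_, ⟨m', rfl⟩, hm'⟩ := this
    exact ⟨m', by rw [← hm', place, add_comm]⟩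
  choose π hπ using key
  have hinj : Function.Injective π := fun a b hab =>
    (h.good hb).injective (by rw [hπ a, hπ b, hab])
  have h1 := h.map (r, v) (Equiv.ofBijective π (Finite.injective_iff_bijective.1 hinj)) hπ
  have h2 := congrArg (fun x => x.2.1) (hb.pose_unique h h1)
  apply hr
  simpa [comp] using h2

end

/-- Wherever there is enough room, the adversary can confine an MRS of size `n` that starts in a
state without rotational symmetry (or consists of two modules) to a small part of the field. -/
def Trappable {k : ℕ} (A : Algorithm k) (n : ℕ) : Prop :=
  ∀ (w h : ℕ) (c : Cell), k + 100 ≤ c.1 ∧ c.1 + (k + 100) < w ∧ k + 100 ≤ c.2 ∧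
      c.2 + (k + 100) < h →
    ∃ (fr : ℕ → Fin n → Fin 4) (q : ℕ → Fin n → Cell), Good (q 0) ∧
      (n ≠ 2 → ¬ SymmetricState (Set.range (q 0))) ∧
      (∀ t, q (t + 1) = stepOf A (field w h) (q t) (fr t)) ∧ ∀ t m, Near 90 (q t m) c

lemma trappable_of_confined {Θ : Type} [DecidableEq Θ] {n : ℕ} (hn : n < 5)
    {base : Θ → Fin n → Cell} (hb : Rigid base) {k : ℕ}
    {A : Algorithm k} {f : Θ → Option (Θ × Motion)} (hf : Describes base A f) {τ : Θ}
    (h : Confined f τ = true) (h0 : ∀ m, Near 2 (base τ m) (0, 0)) : Trappable A n := by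
  have hc : Fintype.card (Fin n) ≤ 4 := by rw [Fintype.card_fin]; omega
  intro w h c hroom
  set q : ℕ → Fin n → Cell := fun t m => place (0, c) (openRun base A τ t m) with hq
  have hbd : ∀ t m, Near 90 (q t m) c := by
    intro t m
    have := (near_place (0, c) _ _ _).2 (openRun_bounded hb hc hf ‹_› h0 t m)
    have e : place (0, c) (0, 0) = c := by simp only [place, turn_zero]; ext <;> simp
    rwa [e] at this
  refine ⟨fun t => frameIn base (q t), q, (hb.good τ).place (0, c), fun _ => ?_, fun t => ?_, hbd⟩
  · exact Pose.not_symmetricState hb (x := (τ, (0, c))) ⟨Equiv.refl _, fun m => rfl⟩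
  · have hg := openRun_good hb A τ t
    rw [step_deep A hc _ (hg.place (0, c)).linked]
    · funext m
      rw [hq, ← openStep]
      simp only [openRun_succ]
      exact (openStep_map hb hc A hg (0, c) (Equiv.refl _) (fun _ => rfl) (.inl rfl) m).symm
    · intro m
      have := (hbd t m).bounds
      change _ ≤ (q t m).1 ∧ (q t m).1 + _ < _ ∧ _ ≤ (q t m).2 ∧ (q t m).2 + _ < _
      omega

lemma trappable_of_lt_three {k : ℕ} (A : Algorithm k) {n : ℕ} (hn : n < 3) : Trappable A n := by
  intro w h c hc
  obtain ⟨fr, q, h1, h2, h3⟩ := row_trapped A (n := n) (w := w) (h := h) (by omega) c (by omega)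
  refine ⟨fun _ => fr, q, h1, fun hn2 => ?_, h2, fun t m => (h3 t m).mono (by norm_num)⟩
  rintro ⟨r, v, -, himg, _, ⟨m, rfl⟩, hne⟩
  have : turn r (q 0 m) + v ∈ Set.range (q 0) := by
    rw [← himg]; exact ⟨_, ⟨m, rfl⟩, rfl⟩
  obtain ⟨m', hm'⟩ := this
  have : m' = m := Fin.ext (by have := m.2; have := m'.2; omega)
  exact hne (by rw [← hm', this])

lemma triomino_confined : ∀ y ∈ none :: (triominoMoves 0).map some,
    Confined (fun _ : Fin 1 => y) 0 = true := by
  decide +kernel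

lemma trappable_three {k : ℕ} (A : Algorithm k) : Trappable A 3 := by
  obtain ⟨f, hf, hm⟩ := triomino_describes A
  refine trappable_of_confined (by norm_num) triomino_rigid hf (τ := 0) ?_ ?_
  · have : f = fun _ => f 0 := funext fun τ => by rw [Subsingleton.elim τ 0]
    rw [this]
    refine triomino_confined _ ?_
    rcases h : f 0 with _ | y
    · simp
    · exact List.mem_cons_of_mem _ (List.mem_map_of_mem (hm 0 y h))
  · unfold Near; decide

/-! ### The dichotomy for the asymmetric tetrominoes -/

/-- From every asymmetric tetromino the algorithm gets to the L tetromino, and in `p` steps it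
shifts the L tetromino by one cell along its long side. -/
def Walks (f : Fin 3 → Option (Fin 3 × Motion)) (p : ℕ) (e : ℤ) : Bool :=
  orbit f 1 p == some (1, (0, (0, e))) &&
  ((List.range p).all fun i => i == 0 || (orbit f 1 i).any fun x => x.1 != 1) &&
  ((List.finRange 3).all fun τ => (List.range 3).any fun i => (orbit f τ i).any fun x => x.1 == 1)

lemma tetromino_dichotomy : ∀ a ∈ none :: (tetrominoMoves 0).map some,
    ∀ b ∈ none :: (tetrominoMoves 1).map some, ∀ c ∈ none :: (tetrominoMoves 2).map some,
      ((List.finRange 3).any fun τ => Confined ![a, b, c] τ) ||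
      ([2, 3].any fun p => [1, -1].any fun e => Walks ![a, b, c] p e) := by
  decide +kernel

lemma trappable_or_walks {k : ℕ} (A : Algorithm k) : Trappable A 4 ∨
    ∃ f p e, Describes tetromino A f ∧ (p = 2 ∨ p = 3) ∧ (e = 1 ∨ e = -1) ∧
      Walks f p e = true := by
  obtain ⟨f, hf, hm⟩ := tetromino_describes A
  have hmem : ∀ τ, f τ ∈ none :: (tetrominoMoves τ).map some := by
    intro τ
    rcases h : f τ with _ | y
    · simp
    · exact List.mem_cons_of_mem _ (List.mem_map_of_mem (hm τ y h))
  have h := tetromino_dichotomy _ (hmem 0) _ (hmem 1) _ (hmem 2)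
  have e : ![f 0, f 1, f 2] = f := by funext m; fin_cases m <;> rfl
  rw [e] at h
  simp only [Bool.or_eq_true, List.any_eq_true, List.mem_finRange, true_and, List.mem_cons,
    List.not_mem_nil, or_false] at h
  rcases h with ⟨τ, h⟩ | ⟨p, hp, e, he, h⟩
  · left
    refine trappable_of_confined (by norm_num) tetromino_rigid hf h ?_
    have : ∀ τ m, Near 2 (tetromino τ m) (0, 0) := by unfold Near; decide
    exact this τ
  · exact .inr ⟨f, p, e, hf, hp, he, h⟩

/-! ### Long-term behaviour of a walking tetromino -/

/-- The modules are at distance more than `K` from the east and the west wall. -/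
def XFar (K : ℤ) (w : ℕ) (p : Fin 4 → Cell) : Prop := ∀ m, K ≤ (p m).1 ∧ (p m).1 + K < w

/-- What is used about the motion of an MRS of four modules in a field. `W t u` says that at time
`t` the MRS is an L tetromino that, as long as it sees no wall, moves by the unit vector `u` every
`p` steps. Symmetry is assumed only with respect to the motions of the plane that preserve the
north and south walls as a pair. -/
structure Trail (w h K p : ℕ) (q : ℕ → Fin 4 → Cell) (W : ℕ → Cell → Prop) : Prop where
  inside : ∀ t m, 0 ≤ (q t m).1 ∧ (q t m).1 < w ∧ 0 ≤ (q t m).2 ∧ (q t m).2 < h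
  near : ∀ t m m', Near 3 (q t m) (q t m')
  step : ∀ t m, Near 3 (q (t + 1) m) (q t m)
  period : 2 ≤ p ∧ p ≤ 3
  shift : ∀ (i j : ℕ) (d : ℤ) (π : Equiv.Perm (Fin 4)), XFar K w (q i) → XFar K w (q j) →
    (∀ m, (q j m).1 = d + (q i (π m)).1 ∧ (q j m).2 = (q i (π m)).2) →
    ∀ m, (q (j + 1) m).1 = d + (q (i + 1) (π m)).1 ∧ (q (j + 1) m).2 = (q (i + 1) (π m)).2
  flip : ∀ (i j : ℕ) (d : ℤ) (π : Equiv.Perm (Fin 4)), XFar K w (q i) → XFar K w (q j) →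
    (∀ m, (q j m).1 = d - (q i (π m)).1 ∧ (q j m).2 = h - 1 - (q i (π m)).2) →
    ∀ m, (q (j + 1) m).1 = d - (q (i + 1) (π m)).1 ∧
      (q (j + 1) m).2 = h - 1 - (q (i + 1) (π m)).2
  unit : ∀ t u, W t u → u = (1, 0) ∨ u = (-1, 0) ∨ u = (0, 1) ∨ u = (0, -1)
  uniq : ∀ t u u', W t u → W t u' → u = u'
  walk : ∀ t u, W t u → (∀ s, t ≤ s → s < t + p → Deep K w h (q s)) → W (t + p) u ∧
    ∃ π : Equiv.Perm (Fin 4), ∀ m, q (t + p) m = q t (π m) + u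
  gap : ∀ t u, W t u → ∀ s, t < s → s < t + p → (∀ r, t ≤ r → r < s → Deep K w h (q r)) →
    ∀ u', ¬ W s u'
  same : ∀ t t' u, W t u → W t' u → ∃ (π : Equiv.Perm (Fin 4)) (v : Cell),
    ∀ m, q t' m = v + q t (π m)
  opp : ∀ t t' u, W t u → W t' (-u) → ∃ (π : Equiv.Perm (Fin 4)) (v : Cell),
    ∀ m, q t' m = v - q t (π m)
  transfer : ∀ (t t' : ℕ) (u v : Cell) (π : Equiv.Perm (Fin 4)), W t u →
    (∀ m, q t' m = v - q t (π m)) → W t' (-u)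
  settle : ∀ t, Deep K w h (q t) →
    (∃ i ≤ 2, (∀ s, t ≤ s → s < t + i → Deep K w h (q s)) → ∃ u, W (t + i) u) ∨
    ∀ t', t ≤ t' → (∀ s, t ≤ s → s < t' → Deep K w h (q s)) → ∀ m, Near 3 (q t' m) (q t m)

namespace Trail

variable {w h K p : ℕ} {q : ℕ → Fin 4 → Cell} {W : ℕ → Cell → Prop}

lemma deep_turned (pos : Fin 4 → Cell) :
    Deep K w h (fun m => ((w : ℤ) - 1, (h : ℤ) - 1) - pos m) ↔ Deep K w h pos := by
  refine forall_congr' fun m => ?_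
  simp only [Prod.fst_sub, Prod.snd_sub]
  omega

/-- The half turn of the field turns a trail into a trail. -/
lemma turned (T : Trail w h K p q W) :
    Trail w h K p (fun t m => ((w : ℤ) - 1, (h : ℤ) - 1) - q t m) (fun t u => W t (-u)) := by
  have hd := fun t => deep_turned (w := w) (h := h) (K := K) (q t)
  have hx : ∀ t, XFar K w (fun m => ((w : ℤ) - 1, (h : ℤ) - 1) - q t m) ↔ XFar K w (q t) := by
    intro t
    refine forall_congr' fun m => ?_
    simp only [Prod.fst_sub]
    omega
  have hn : ∀ (L : ℤ) (a b c : Cell), Near L (c - a) (c - b) ↔ Near L a b := by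
    intro L a b c
    simp only [Near, Prod.fst_sub, Prod.snd_sub, sub_sub_sub_cancel_left]
    rw [abs_sub_comm b.1, abs_sub_comm b.2]
  constructor
  · intro t m
    have := T.inside t m
    simp only [Prod.fst_sub, Prod.snd_sub]
    omega
  · intro t m m'
    exact (hn _ _ _ _).2 (T.near t m m')
  · intro t m
    exact (hn _ _ _ _).2 (T.step t m)
  · exact T.period
  · intro i j d π hi hj he m
    have := T.shift i j (-d) π ((hx i).1 hi) ((hx j).1 hj) (fun m => by
      have := he m; simp only [Prod.fst_sub, Prod.snd_sub] at this; omega) m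
    simp only [Prod.fst_sub, Prod.snd_sub]
    omega
  · intro i j d π hi hj he m
    have := T.flip i j (2 * w - 2 - d) π ((hx i).1 hi) ((hx j).1 hj) (fun m => by
      have := he m; simp only [Prod.fst_sub, Prod.snd_sub] at this; omega) m
    simp only [Prod.fst_sub, Prod.snd_sub]
    omega
  · intro t u hu
    have := T.unit t _ hu
    obtain ⟨a, b⟩ := u
    simp only [Prod.neg_mk, Prod.mk.injEq] at this ⊢
    omega
  · intro t u u' hu hu'
    exact neg_injective (T.uniq t _ _ hu hu')
  · intro t u hu hs
    obtain ⟨h1, π, h2⟩ := T.walk t _ hu (fun s a b => (hd s).1 (hs s a b))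
    exact ⟨h1, π, fun m => by rw [h2]; abel⟩
  · intro t u hu s a b hs u'
    exact T.gap t _ hu s a b (fun r a b => (hd r).1 (hs r a b)) _
  · intro t t' u hu hu'
    obtain ⟨π, v, hv⟩ := T.same t t' _ hu hu'
    exact ⟨π, -v, fun m => by rw [hv]; abel⟩
  · intro t t' u hu hu'
    obtain ⟨π, v, hv⟩ := T.opp t t' _ hu hu'
    refine ⟨π, ((w : ℤ) - 1, (h : ℤ) - 1) + ((w : ℤ) - 1, (h : ℤ) - 1) - v, fun m => ?_⟩
    rw [hv]; abel
  · intro t t' u v π hu hv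
    refine T.transfer t t' (-u) (((w : ℤ) - 1, (h : ℤ) - 1) + ((w : ℤ) - 1, (h : ℤ) - 1) - v) π hu
      fun m => ?_
    have h1 : q t' m = ((w : ℤ) - 1, (h : ℤ) - 1) - (((w : ℤ) - 1, (h : ℤ) - 1) - q t' m) := by abel
    rw [h1, hv]; abel
  · intro t ht
    rcases T.settle t ((hd t).1 ht) with ⟨i, hi, h1⟩ | h1
    · refine .inl ⟨i, hi, fun hs => ?_⟩
      obtain ⟨u, hu⟩ := h1 (fun s a b => (hd s).1 (hs s a b))
      exact ⟨-u, by rwa [neg_neg]⟩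
    · exact .inr fun t' htt hs m => (hn _ _ _ _).2 (h1 t' htt (fun s a b => (hd s).1 (hs s a b)) m)

lemma steps (T : Trail w h K p q W) (t n : ℕ) (m : Fin 4) : Near (3 * n) (q (t + n) m) (q t m) := by
  induction n with
  | zero => constructor <;> simp
  | succ n ih => exact ((T.step (t + n) m).trans ih).mono (by push_cast; omega)

/-- Positions at different times, in a form suited to linear arithmetic. -/
lemma bounds (T : Trail w h K p q W) {s t : ℕ} (hst : s ≤ t) (m : Fin 4) :
    (q t m).1 ≤ (q s m).1 + 3 * (t - s) ∧ (q s m).1 ≤ (q t m).1 + 3 * (t - s) ∧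
    (q t m).2 ≤ (q s m).2 + 3 * (t - s) ∧ (q s m).2 ≤ (q t m).2 + 3 * (t - s) := by
  have := (T.steps s (t - s) m).bounds
  rw [Nat.add_sub_cancel' hst] at this
  push_cast [hst] at this
  exact this

lemma run_start {t : ℕ} (ht : Deep K w h (q t)) : ∃ s ≤ t, (∀ i, s ≤ i → i ≤ t → Deep K w h (q i)) ∧
    (s = 0 ∨ 0 < s ∧ ¬ Deep K w h (q (s - 1))) := by
  induction t with
  | zero => exact ⟨0, le_rfl, fun i _ h2 => Nat.le_zero.1 h2 ▸ ht, .inl rfl⟩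
  | succ t ih =>
    by_cases hd : Deep K w h (q t)
    · obtain ⟨s, hs, h1, h2⟩ := ih hd
      refine ⟨s, by omega, fun i hi hi' => ?_, h2⟩
      rcases Nat.lt_or_ge t i with h | h
      · obtain rfl : i = t + 1 := by omega
        exact ht
      · exact h1 i hi h
    · refine ⟨t + 1, le_rfl, fun i hi hi' => ?_, .inr ⟨by omega, by simpa using hd⟩⟩
      obtain rfl : i = t + 1 := by omega
      exact ht

lemma line_aux (T : Trail w h K p q W) {s : ℕ} {u : Cell} (hW : W s u) (n : ℕ)
    (hd : ∀ i, s ≤ i → i < s + n * p → Deep K w h (q i)) :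
    W (s + n * p) u ∧ ∃ π : Equiv.Perm (Fin 4), ∀ m, q (s + n * p) m = q s (π m) + (n : ℤ) • u := by
  induction n with
  | zero => exact ⟨by simpa using hW, Equiv.refl _, by simp⟩
  | succ n ih =>
    have e : s + (n + 1) * p = s + n * p + p := by ring
    rw [e] at hd ⊢
    obtain ⟨h1, π, h2⟩ := ih (fun i a b => hd i a (by omega))
    obtain ⟨h3, ρ, h4⟩ := T.walk _ u h1 (fun i a b => hd i (by omega) b)
    refine ⟨h3, ρ.trans π, fun m => ?_⟩
    rw [h4, h2]
    push_cast
    rw [add_smul, one_smul, ← add_assoc]; rfl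

lemma line (T : Trail w h K p q W) {s t : ℕ} (hst : s ≤ t) {u : Cell} (hW : W s u)
    (hd : ∀ i, s ≤ i → i ≤ t → Deep K w h (q i)) :
    ∃ n r, r = s + n * p ∧ r ≤ t ∧ t < r + p ∧ W r u ∧
      ∃ π : Equiv.Perm (Fin 4), ∀ m, q r m = q s (π m) + (n : ℤ) • u := by
  have hp := T.period
  have h1 := Nat.div_add_mod (t - s) p
  have h2 := Nat.mod_lt (t - s) (show 0 < p by omega)
  rw [mul_comm] at h1
  refine ⟨(t - s) / p, _, rfl, by omega, by omega, ?_⟩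
  exact T.line_aux hW _ (fun i a b => hd i a (by omega))

lemma line_eq (T : Trail w h K p q W) {s t : ℕ} (hst : s ≤ t) {u u' : Cell}
    (hW : W s u) (hW' : W t u')
    (hd : ∀ i, s ≤ i → i ≤ t → Deep K w h (q i)) :
    u' = u ∧ ∃ (n : ℕ) (π : Equiv.Perm (Fin 4)), ∀ m, q t m = q s (π m) + (n : ℤ) • u := by
  obtain ⟨n, r, h1, h2, h3, h4, π, h5⟩ := T.line hst hW hd
  have hsr : s ≤ r := h1 ▸ Nat.le_add_right _ _
  rcases eq_or_lt_of_le h2 with rfl | hlt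
  · exact ⟨T.uniq _ _ _ hW' h4, n, π, h5⟩
  · refine absurd hW' (T.gap r u h4 t hlt h3 (fun i a b => hd i (by omega) (by omega)) u')

/-- The modules all have height at least `L`, and one has height `L`. -/
def Level (q : ℕ → Fin 4 → Cell) (t : ℕ) (L : ℤ) : Prop :=
  (∀ m, L ≤ (q t m).2) ∧ ∃ m, (q t m).2 = L

/-- A bound for the number of states of an MRS with a module below height `K + 40`, up to
translations along the south wall: the other modules are at most three columns and three rows
away. -/
def recurrenceTime (K : ℕ) : ℕ := (7 * (K + 43)) ^ 4

/-- A low MRS comes back, up to a translation along the south wall, to one of boundedly many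
states. So it cannot stay low for long and then rise: after a repetition it would stay low. -/
lemma not_low_long (T : Trail w h K p q W) {t : ℕ} (hhigh : ∀ m, (K + 40 : ℤ) ≤ (q t m).2)
    (ht : recurrenceTime K + 1 ≤ t)
    (hlow : ∀ i, t ≤ i + recurrenceTime K + 1 → i < t → ∃ m, (q i m).2 < K + 40)
    (hx : ∀ i, t ≤ i + recurrenceTime K + 1 → i < t → XFar K w (q i)) : False := by
  set N := recurrenceTime K with hN
  set a := t - (N + 1) with ha
  let code : ℕ → Fin 4 → Cell := fun i m => ((q (a + i) m).1 - (q (a + i) 0).1, (q (a + i) m).2)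
  have hcard : (Fintype.piFinset fun _ : Fin 4 =>
      Finset.Icc (-3 : ℤ) 3 ×ˢ Finset.Icc (0 : ℤ) (K + 42)).card = N := by
    rw [Fintype.card_piFinset_const, Finset.card_product, Int.card_Icc, Int.card_Icc, hN,
      recurrenceTime]
    congr 2
  clear_value N
  obtain ⟨i, hi, j, hj, hne, hij⟩ := Finset.exists_ne_map_eq_of_card_lt_of_maps_to
    (s := Finset.range (N + 1)) (f := code) (t := Fintype.piFinset fun _ : Fin 4 =>
      Finset.Icc (-3 : ℤ) 3 ×ˢ Finset.Icc (0 : ℤ) (K + 42))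
    (by rw [hcard, Finset.card_range]; omega)
    (by
      intro i hi
      rw [Finset.coe_range, Set.mem_Iio] at hi
      obtain ⟨m₀, hm₀⟩ := hlow (a + i) (by omega) (by omega)
      rw [Finset.mem_coe, Fintype.mem_piFinset]
      intro m
      have h1 := T.inside (a + i) m
      have h2 := (T.near (a + i) m m₀).bounds
      have h3 := (T.near (a + i) m 0).bounds
      simp only [code, Finset.mem_product, Finset.mem_Icc]
      omega)
  have key : ∀ i j, i < j → j < N + 1 → code i = code j → False := by
    intro i j hij hj hc
    have hn : ∀ n, a + j + n ≤ t → ∀ m, (q (a + j + n) m).1 =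
        ((q (a + j) 0).1 - (q (a + i) 0).1) + (q (a + i + n) m).1 ∧
        (q (a + j + n) m).2 = (q (a + i + n) m).2 := by
      intro n
      induction n with
      | zero =>
        intro _ m
        have := congrFun hc m
        simp only [code, Prod.mk.injEq] at this
        simp only [add_zero]
        omega
      | succ n ih =>
        intro hn
        exact T.shift (a + i + n) (a + j + n) _ (Equiv.refl _) (hx _ (by omega) (by omega))
          (hx _ (by omega) (by omega)) (ih (by omega))
    obtain ⟨m, hm⟩ := hlow (a + i + (t - (a + j))) (by omega) (by omega)
    have h1 := hn (t - (a + j)) (by omega) m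
    have h2 := hhigh m
    rw [show a + j + (t - (a + j)) = t by omega] at h1
    omega
  rw [Finset.mem_range] at hi hj
  rcases Nat.lt_or_gt_of_ne hne with h | h
  · exact key i j h hj hij
  · exact key j i h hi hij.symm

end Trail

/-! ### A visit of the walker to a wall -/

namespace Trail

lemma exists_first {P : ℕ → Prop} {s t : ℕ} (hst : s ≤ t) (ht : P t) :
    ∃ r, s ≤ r ∧ r ≤ t ∧ P r ∧ ∀ i, s ≤ i → i < r → ¬ P i := by
  classical
  have hex : ∃ r, s ≤ r ∧ P r := ⟨t, hst, ht⟩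
  exact ⟨Nat.find hex, (Nat.find_spec hex).1, Nat.find_min' hex ⟨hst, ht⟩, (Nat.find_spec hex).2,
    fun i h1 h2 h3 => Nat.find_min hex h2 ⟨h1, h3⟩⟩

lemma exists_last {P : ℕ → Prop} {s : ℕ} (h0 : P 0) :
    ∃ r ≤ s, P r ∧ ∀ i, r < i → i ≤ s → ¬ P i := by
  classical
  exact ⟨Nat.findGreatest P s, Nat.findGreatest_le s, Nat.findGreatest_spec (Nat.zero_le s) h0,
    fun i h1 h2 => Nat.findGreatest_is_greatest h1 h2⟩

variable {w h K p : ℕ} {q : ℕ → Fin 4 → Cell} {W : ℕ → Cell → Prop}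

/-- An MRS that walks north comes from the south wall, which it had reached on its way south, or
has never seen a wall. -/
lemma leaves_south_wall (T : Trail w h K p q W) {s t : ℕ} (hs0 : 0 < s) (hst : s ≤ t)
    (hint : ∀ i, s ≤ i → i ≤ t → Deep K w h (q i)) (hns : ¬ Deep K w h (q (s - 1)))
    (hW : W t (0, 1)) (hhi : ∀ m, (K + 40 : ℤ) ≤ (q t m).2)
    (htop : ∀ m, (q t m).2 + (K + 12) < h) {D : ℤ} (hD : K + 12 ≤ D) (hx : XFar D w (q t)) :
    (∃ s', s ≤ s' ∧ s' ≤ s + 2 ∧ s' ≤ t ∧ W s' (0, 1)) ∧ ∃ m, (q (s - 1) m).2 < K := by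
  rcases T.settle s (hint s le_rfl hst) with ⟨i, hi, hw⟩ | htrap
  · by_cases hit : s + i ≤ t
    · obtain ⟨u, hu⟩ := hw fun r a b => hint r a (by omega)
      obtain ⟨rfl, n, π, hπ⟩ := T.line_eq hit hu hW fun r a b => hint r (by omega) b
      refine ⟨⟨s + i, by omega, by omega, hit, hu⟩, ?_⟩
      by_contra hc
      push Not at hc
      refine hns fun m => ?_
      have h1 := hc m
      have h2 := hπ (π.symm m)
      rw [Equiv.apply_symm_apply] at h2
      have h3 := T.bounds (show s - 1 ≤ s + i by omega) m
      have h4 := hx (π.symm m)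
      have h5 := htop (π.symm m)
      simp only [h2, Prod.fst_add, Prod.snd_add, Prod.smul_fst, Prod.smul_snd, smul_eq_mul,
        mul_zero, mul_one] at h4 h5
      push_cast at h3
      omega
    · refine absurd (fun m => ?_) hns
      have h3 := T.bounds (show s - 1 ≤ t by omega) m
      have h4 := hx m
      have h5 := htop m
      have h6 := hhi m
      omega
  · refine absurd (fun m => ?_) hns
    have h2 := (htrap t hst (fun i a b => hint i a (by omega)) m).bounds
    have h3 := T.bounds (show s - 1 ≤ s by omega) m
    have h4 := hx m
    have h5 := htop m
    have h6 := hhi m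
    omega

/-- The visit to the south wall before a walk north: at time `t₁` the MRS walks south and is at
height `K + 12`; then it stays low until time `T₂`, when it is walking north already. -/
lemma visit (T : Trail w h K p q W) {s t : ℕ} (hs0 : 0 < s) (hst : s ≤ t)
    (hint : ∀ i, s ≤ i → i ≤ t → Deep K w h (q i)) (hns : ¬ Deep K w h (q (s - 1)))
    (hW : W t (0, 1)) (hhi : ∀ m, (K + 40 : ℤ) ≤ (q t m).2)
    (htop : ∀ m, (q t m).2 + (K + 12) < h) (h0 : ∀ m, (K + 40 : ℤ) ≤ (q 0 m).2)
    (hx : XFar (K + 3 * recurrenceTime K + 50) w (q t)) (hh : 2 * K + 100 < h) :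
    ∃ t₁ T₂ r s₁, t₁ < T₂ ∧ T₂ ≤ t ∧ W t₁ (0, -1) ∧ Level q t₁ (K + 12) ∧
      (∀ m, (K + 40 : ℤ) ≤ (q T₂ m).2) ∧
      (∀ i, t₁ ≤ i → i < T₂ → ∃ m, (q i m).2 < K + 40) ∧
      t₁ ≤ r ∧ r ≤ T₂ ∧ W r (0, 1) ∧ (∀ i, r ≤ i → i ≤ t → Deep K w h (q i)) ∧
      s₁ ≤ t₁ ∧ (∀ i, s₁ ≤ i → i ≤ t₁ → Deep K w h (q i)) ∧
      (s₁ = 0 ∨ 0 < s₁ ∧ ¬ Deep K w h (q (s₁ - 1))) ∧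
      ∀ i, t₁ ≤ i → i ≤ T₂ → ∀ m m', (q i m).1 ≤ (q t m').1 + (3 * recurrenceTime K + 20) ∧
        (q t m').1 ≤ (q i m).1 + (3 * recurrenceTime K + 20) := by
  have hp := T.period
  obtain ⟨⟨s', hs1, hs2, hs't, hWs'⟩, m₀, hm₀⟩ :=
    T.leaves_south_wall hs0 hst hint hns hW hhi htop (by omega) hx
  -- `T₂` is the first time after the visit, and `T₁` the last time before it, at which the MRS is
  -- high above the wall
  obtain ⟨T₂, hT2s, hT2t, hT2, hT2min⟩ := exists_first
    (P := fun i => ∀ m, (K + 40 : ℤ) ≤ (q i m).2) hst hhi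
  have hT2s' : s + 10 ≤ T₂ := by
    have h1 := T.bounds (show s - 1 ≤ T₂ by omega) m₀
    have h2 := hT2 m₀
    omega
  obtain ⟨n, r, hr1, hr2, hr3, hWr, -⟩ := T.line (show s' ≤ T₂ by omega) hWs'
    (fun i a b => hint i (by omega) (by omega))
  have hrs : s' ≤ r := hr1 ▸ Nat.le_add_right _ _
  obtain ⟨-, n', π, hπ⟩ := T.line_eq (show r ≤ t by omega) hWr hW
    (fun i a b => hint i (by omega) b)
  have hxT2 : ∀ m m', (q T₂ m).1 ≤ (q t m').1 + 12 ∧ (q t m').1 ≤ (q T₂ m).1 + 12 := by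
    intro m m'
    have h1 := T.bounds hr2 m
    have h2 := (T.near r m (π m')).bounds
    have h3 := congrArg Prod.fst (hπ m')
    simp only [Prod.fst_add, Prod.smul_fst, smul_eq_mul, mul_zero, add_zero] at h3
    omega
  obtain ⟨T₁, hT1s, hT1, hT1max⟩ := exists_last
    (P := fun i => ∀ m, (K + 40 : ℤ) ≤ (q i m).2) (s := s - 1) h0
  have hT1s' : T₁ < s - 1 := by
    rcases eq_or_lt_of_le hT1s with h1 | h1
    · have := hT1 m₀
      rw [h1] at this
      omega
    · exact h1
  have hlow : ∀ i, T₁ < i → i < T₂ → ∃ m, (q i m).2 < K + 40 := by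
    intro i h1 h2
    by_contra hc
    push Not at hc
    rcases Nat.lt_or_ge i s with h3 | h3
    · exact hT1max i h1 (by omega) hc
    · exact hT2min i h3 h2 hc
  have hxi : ∀ i, T₂ ≤ i + recurrenceTime K + 1 → i ≤ T₂ → ∀ m m',
      (q i m).1 ≤ (q t m').1 + (3 * recurrenceTime K + 20) ∧
        (q t m').1 ≤ (q i m).1 + (3 * recurrenceTime K + 20) := by
    intro i h1 h2 m m'
    have h3 := T.bounds h2 m
    have h4 := hxT2 m m'
    omega
  have hfar : ∀ i, T₂ ≤ i + recurrenceTime K + 1 → i ≤ T₂ → XFar K w (q i) := by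
    intro i h1 h2 m
    have h3 := hxi i h1 h2 m m
    have h4 := hx m
    omega
  have hlen : T₂ ≤ T₁ + recurrenceTime K + 1 := by
    by_contra hc
    exact T.not_low_long hT2 (by omega) (fun i h1 h2 => hlow i (by omega) h2)
      (fun i h1 h2 => hfar i h1 h2.le)
  have hT1d : Deep K w h (q T₁) := by
    intro m
    obtain ⟨m₁, hm₁⟩ := hlow (T₁ + 1) (by omega) (by omega)
    have h1 := hfar T₁ hlen (by omega) m
    have h2 := hT1 m
    have h3 := T.bounds (show T₁ ≤ T₁ + 1 by omega) m₁
    have h4 := (T.near T₁ m m₁).bounds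
    push_cast at h3
    omega
  obtain ⟨s₁, hs1T, hs1d, hs1⟩ := run_start hT1d
  -- `e` is the time at which the MRS comes into sight of the wall
  obtain ⟨e, heT, hes, hed, hemin⟩ := exists_first (P := fun i => ¬ Deep K w h (q i)) hT1s hns
  simp only [not_not] at hemin
  have heT' : T₁ < e := by
    rcases eq_or_lt_of_le heT with h1 | h1
    · rw [← h1] at hed; exact absurd hT1d hed
    · exact h1
  have hrun : ∀ i, s₁ ≤ i → i < e → Deep K w h (q i) := by
    intro i h1 h2
    rcases Nat.lt_or_ge i T₁ with h3 | h3
    · exact hs1d i h1 h3.le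
    · exact hemin i h3 h2
  have hye : ∀ m, (q e m).2 ≤ K + 2 := by
    have h1 : ∃ m, (q e m).2 < K := by
      by_contra hc
      push Not at hc
      refine hed fun m => ?_
      obtain ⟨m₁, hm₁⟩ := hlow e heT' (by omega)
      have h2 := (T.near e m m₁).bounds
      have h3 := hfar e (by omega) (by omega) m
      have h4 := hc m
      omega
    obtain ⟨m₁, hm₁⟩ := h1
    intro m
    have h2 := (T.near e m m₁).bounds
    omega
  have hdrop : T₁ + 10 ≤ e := by
    have h1 := T.bounds heT 0
    have h2 := hT1 0
    have h3 := hye 0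
    omega
  rcases T.settle s₁ (hs1d s₁ le_rfl hs1T) with ⟨i, hi, hw⟩ | htrap
  swap
  · have h1 := (htrap T₁ hs1T (fun i a b => hs1d i a b.le) 0).bounds
    have h2 := (htrap e (by omega) hrun 0).bounds
    have h3 := hye 0
    have h4 := hT1 0
    omega
  obtain ⟨u, hu⟩ := hw fun r a b => hrun r a (by omega)
  obtain ⟨nA, A, hA1, hA2, hA3, hWA, -⟩ := T.line (le_max_right T₁ (s₁ + i)) hu
    (fun i a b => hrun i (by omega) (by omega))
  have hAs : s₁ + i ≤ A := hA1 ▸ Nat.le_add_right _ _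
  have hyA : ∀ m, (K + 25 : ℤ) ≤ (q A m).2 := by
    intro m
    have h1 := T.bounds (le_max_left T₁ (s₁ + i)) m
    have h2 := T.bounds hA2 m
    have h3 := hT1 m
    omega
  obtain ⟨mA, hmA⟩ := Finite.exists_min fun m => (q A m).2
  obtain ⟨n₂, r₂, hr21, hr22, hr23, -, ρ, hρ⟩ := T.line (show A ≤ e - 1 by omega) hWA
    (fun i a b => hrun i (by omega) (by omega))
  have hyr : ∀ m, (q r₂ m).2 ≤ K + 11 := by
    intro m
    have h1 := T.bounds (show r₂ ≤ e by omega) m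
    have h2 := hye m
    omega
  have hn2 := hyr (ρ.symm mA)
  have hyAm := hyA mA
  rw [hρ, Equiv.apply_symm_apply] at hn2
  simp only [Prod.snd_add, Prod.smul_snd, smul_eq_mul] at hn2
  -- before time `e` the MRS descends along a line, so it is walking south
  obtain rfl : u = (0, -1) := by
    rcases T.unit _ _ hu with rfl | rfl | rfl | rfl
    · simp only [mul_zero] at hn2; omega
    · simp only [mul_zero] at hn2; omega
    · simp only [mul_one] at hn2; omega
    · rfl
  simp only [mul_neg, mul_one] at hn2
  obtain ⟨n₀, hn₀⟩ := Int.eq_ofNat_of_zero_le (show 0 ≤ (q A mA).2 - (K + 12) by omega)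
  have hle : n₀ * p ≤ n₂ * p := Nat.mul_le_mul_right _ (by omega)
  have hge : n₀ ≤ n₀ * p := Nat.le_mul_of_pos_right _ (by omega)
  obtain ⟨hW1, ρ', hρ'⟩ := T.line_aux hWA n₀ (fun i a b => hrun i (by omega) (by omega))
  have hy1 : ∀ m, (q (A + n₀ * p) m).2 = (q A (ρ' m)).2 - n₀ := by
    intro m
    rw [hρ']
    simp only [Prod.snd_add, Prod.smul_snd, smul_eq_mul, mul_neg, mul_one]
    ring
  refine ⟨A + n₀ * p, T₂, r, s₁, by omega, hT2t, hW1, ⟨fun m => ?_, ρ'.symm mA, ?_⟩, hT2,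
    fun i h1 h2 => hlow i (by omega) h2, by omega, hr2, hWr, fun i a b => hint i (by omega) b,
    by omega, fun i a b => hrun i a (by omega), hs1, fun i h1 h2 => hxi i (by omega) h2⟩
  · have := hmA (ρ' m)
    rw [hy1]; omega
  · rw [hy1, Equiv.apply_symm_apply]; omega

end Trail

/-! ### All walks follow one line -/

namespace Trail

variable {w h K p : ℕ} {q : ℕ → Fin 4 → Cell} {W : ℕ → Cell → Prop}

lemma sum_line {s t : ℕ} {π : Equiv.Perm (Fin 4)} {n : ℤ} {e : ℤ}
    (hπ : ∀ m, q t m = q s (π m) + n • ((0, e) : Cell)) :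
    ∑ m, (q t m).1 = ∑ m, (q s m).1 := by
  simp only [hπ, Prod.fst_add, Prod.smul_fst, smul_zero, add_zero]
  exact π.sum_comp Finset.univ (fun m => (q s m).1) (by simp)

/-- A visit to the south wall that follows a visit to the north wall is its mirror image under a
half turn, so the two sideways shifts cancel: the walk north goes on along the line of the walk
north before the two visits. Hence all walks north follow one line. -/
lemma line_of_north (T : Trail w h K p q W) {u₀ : Cell} (hW0 : W 0 u₀)
    (h0 : ∀ m, (K + 40 : ℤ) ≤ (q 0 m).2 ∧ (q 0 m).2 + (K + 40) < h) (hh : 2 * K + 100 < h) (t : ℕ)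
    (hW : W t (0, 1)) (hy : ∀ m, (K + 40 : ℤ) ≤ (q t m).2 ∧ (q t m).2 + (K + 12) < h)
    (hx : XFar (K + 6 * recurrenceTime K + 100) w (q t)) :
    (u₀ = (0, 1) ∨ u₀ = (0, -1)) ∧
      |∑ m, (q t m).1 - ∑ m, (q 0 m).1| ≤ 4 * (3 * recurrenceTime K + 20) := by
  induction t using Nat.strong_induction_on with
  | _ t ih =>
  have hpos : (0 : ℤ) ≤ recurrenceTime K := Int.natCast_nonneg _
  have htd : Deep K w h (q t) := fun m => by
    have h1 := hx m
    have h2 := hy m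
    omega
  obtain ⟨s, hst, hsd, rfl | ⟨hs0, hns⟩⟩ := run_start htd
  · obtain ⟨h1, n, π, hπ⟩ := T.line_eq hst hW0 hW hsd
    rw [← h1] at hπ
    rw [sum_line hπ, sub_self, abs_zero]
    exact ⟨.inl h1.symm, by omega⟩
  obtain ⟨t₁, T₂, r, s₁, h12, hT2t, hW1, hL1, hT2, hmin, htr, hrT, hWr, hrd, hs1, hs1d, hs1',
    hx1⟩ :=
    T.visit hs0 hst hsd hns hW (fun m => (hy m).1) (fun m => (hy m).2) (fun m => (h0 m).1)
      (fun m => by have := hx m; omega) hh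
  -- either the MRS comes from its initial line, or from a visit to the north wall
  rcases hs1' with rfl | ⟨hs10, hns1⟩
  · obtain ⟨h1, n, π, hπ⟩ := T.line_eq hs1 hW0 hW1 hs1d
    refine ⟨.inr h1.symm, ?_⟩
    rw [← h1] at hπ
    rw [← sum_line hπ, ← Finset.sum_sub_distrib]
    refine (Finset.abs_sum_le_sum_abs _ _).trans ?_
    refine (Finset.sum_le_card_nsmul _ _ (3 * recurrenceTime K + 20 : ℤ) fun m _ => ?_).trans ?_
    · have := hx1 t₁ le_rfl h12.le m m
      rw [abs_le]; omega
    · simp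
  have hx1' : XFar (K + 3 * recurrenceTime K + 60) w (q t₁) := by
    intro m
    have h1 := hx1 t₁ le_rfl h12.le m m
    have h2 := hx m
    omega
  have hy1 : ∀ m, (K + 12 : ℤ) ≤ (q t₁ m).2 ∧ (q t₁ m).2 ≤ K + 15 := by
    intro m
    obtain ⟨h1, m₁, hm₁⟩ := hL1
    have h2 := (T.near t₁ m m₁).bounds
    have h3 := h1 m
    omega
  obtain ⟨t₂, T₂', r₂, -, h12', hT2t', hW2, hL2, hT2', hmin', htr2, hrT2, -, hrd2, -, -, -, hx2⟩ :=
    T.turned.visit hs10 hs1 (fun i a b => (deep_turned _).2 (hs1d i a b))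
      (fun hd => hns1 ((deep_turned _).1 hd)) (show W t₁ (-(0, 1)) from hW1)
      (fun m => by have := hy1 m; simp only [Prod.snd_sub]; omega)
      (fun m => by have := hy1 m; simp only [Prod.snd_sub]; omega)
      (fun m => by have := h0 m; simp only [Prod.snd_sub]; omega)
      (fun m => by have := hx1' m; simp only [Prod.fst_sub]; omega) hh
  replace hW2 : W t₂ (0, 1) := by
    have : (-(0, -1) : Cell) = (0, 1) := rfl
    rwa [this] at hW2
  simp only [Prod.snd_sub, Prod.fst_sub] at hT2' hmin' hx2
  obtain ⟨hL2, m₂, hm₂⟩ := hL2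
  simp only [Prod.snd_sub] at hL2 hm₂
  obtain ⟨π, v, hv⟩ := T.opp t₂ t₁ (0, 1) hW2 hW1
  have hv2 : v.2 = h - 1 := by
    obtain ⟨h1, m₁, hm₁⟩ := hL1
    have h2 := hL2 (π m₁)
    have h3 := h1 (π.symm m₂)
    rw [hv] at hm₁ h3
    simp only [Prod.snd_sub, Equiv.apply_symm_apply] at hm₁ h3
    omega
  have far1 : ∀ i, t₁ ≤ i → i ≤ T₂ → XFar K w (q i) := by
    intro i a b m
    have h1 := hx1 i a b m m
    have h2 := hx m
    omega
  have far2 : ∀ i, t₂ ≤ i → i ≤ T₂' → XFar K w (q i) := by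
    intro i a b m
    have h1 := hx2 i a b m m
    have h2 := hx1' m
    omega
  -- the two visits are mirror images of each other as long as both of them last
  have hmatch : ∀ n, t₁ + n ≤ T₂ → t₂ + n ≤ T₂' → ∀ m, (q (t₁ + n) m).1 =
      v.1 - (q (t₂ + n) (π m)).1 ∧ (q (t₁ + n) m).2 = h - 1 - (q (t₂ + n) (π m)).2 := by
    intro n
    induction n with
    | zero =>
      intro _ _ m
      have := hv m
      rw [add_zero, add_zero, this, ← hv2]
      exact ⟨rfl, rfl⟩
    | succ n ihn =>
      intro a b
      exact T.flip (t₂ + n) (t₁ + n) _ _ (far2 _ (by omega) (by omega))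
        (far1 _ (by omega) (by omega))
        (ihn (by omega) (by omega))
  -- they end in the same way, on leaving the neighbourhood of the wall, so they last equally long
  have hlen : T₂ - t₁ = T₂' - t₂ := by
    rcases lt_trichotomy (T₂ - t₁) (T₂' - t₂) with hlt | heq | hlt
    · obtain ⟨m, hm⟩ := hmin' (t₂ + (T₂ - t₁)) (by omega) (by omega)
      have h1 := hmatch (T₂ - t₁) (by omega) (by omega) (π.symm m)
      rw [Equiv.apply_symm_apply, Nat.add_sub_cancel' h12.le] at h1
      have h2 := hT2 (π.symm m)
      omega
    · exact heq
    · obtain ⟨m, hm⟩ := hmin (t₁ + (T₂' - t₂)) (by omega) (by omega)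
      have h1 := hmatch (T₂' - t₂) (by omega) (by omega) m
      rw [Nat.add_sub_cancel' h12'.le] at h1
      have h2 := hT2' (π m)
      omega
  obtain ⟨n, rfl⟩ := Nat.exists_eq_add_of_le htr
  -- the walk north that begins by the time `t₁ + n` is the mirror image of a walk south, which is
  -- the one that leads to the south wall
  have hWr' : W (t₂ + n) (0, -1) := by
    refine T.transfer (t₁ + n) (t₂ + n) (0, 1) v π.symm hWr fun m => ?_
    have h1 := hmatch n (by omega) (by omega) (π.symm m)
    rw [Equiv.apply_symm_apply] at h1
    ext
    · simp only [Prod.fst_sub]; omega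
    · simp only [Prod.snd_sub]; omega
  have hrun : ∀ i, t₂ + n ≤ i → i ≤ t₁ → Deep K w h (q i) := by
    intro i a b
    rcases Nat.lt_or_ge i T₂' with h1 | h1
    · obtain ⟨l, rfl⟩ := Nat.exists_eq_add_of_le (show t₂ ≤ i by omega)
      intro m
      have h2 := hmatch l (by omega) (by omega) (π.symm m)
      rw [Equiv.apply_symm_apply] at h2
      have h3 := hrd (t₁ + l) (by omega) (by omega) (π.symm m)
      have h4 := far2 (t₂ + l) (by omega) (by omega) m
      omega
    · exact (deep_turned _).1 (hrd2 i (by omega) b)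
  obtain ⟨-, n₁, ρ₁, hρ₁⟩ := T.line_eq (by omega) hWr' hW1 hrun
  obtain ⟨-, n₂, ρ₂, hρ₂⟩ := T.line_eq (by omega) hWr hW hrd
  have e1 := sum_line hρ₁
  have e2 := sum_line hρ₂
  have e3 : ∑ m, (q t₁ m).1 = 4 * v.1 - ∑ m, (q t₂ m).1 := by
    have := π.sum_comp Finset.univ (fun m => (q t₂ m).1) (by simp)
    simp only [hv, Prod.fst_sub, Finset.sum_sub_distrib, this]
    simp
  have e4 : ∑ m, (q (t₁ + n) m).1 = 4 * v.1 - ∑ m, (q (t₂ + n) m).1 := by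
    have := π.sum_comp Finset.univ (fun m => (q (t₂ + n) m).1) (by simp)
    simp only [hmatch n (by omega) (by omega), Finset.sum_sub_distrib, this]
    simp
  have e5 : ∑ m, (q t m).1 = ∑ m, (q t₂ m).1 := by omega
  obtain ⟨ρ, v', hv'⟩ := T.same t t₂ (0, 1) hW hW2
  have e6 : v'.1 = 0 := by
    have := ρ.sum_comp Finset.univ (fun m => (q t m).1) (by simp)
    simp only [hv', Prod.fst_add, Finset.sum_add_distrib, this] at e5
    simp at e5
    exact e5
  rw [e5]
  refine ih t₂ (by omega) hW2 (fun m => ?_) (fun m => ?_)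
  · have h1 := hL2 m
    have h2 := (T.near t₂ m m₂).bounds
    omega
  · have := hx (ρ m)
    rw [hv', Prod.fst_add, e6]
    omega

end Trail

namespace Trail

variable {w h K p : ℕ} {q : ℕ → Fin 4 → Cell} {W : ℕ → Cell → Prop}

/-- A trail that starts as a walk parallel to the `y`-axis, at a distance from the walls, never
leaves both the surroundings of the walls and a strip around its initial line. -/
theorem near_wall_or_line (T : Trail w h K p q W)
    (S : Trail h w K p (fun t m => (q t m).swap) (fun t u => W t u.swap)) {u₀ : Cell} (hW0 : W 0 u₀)
    (hu₀ : u₀ = (0, 1) ∨ u₀ = (0, -1))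
    (h0 : ∀ m, ((K + 40 : ℤ) ≤ (q 0 m).1 ∧ (q 0 m).1 + (K + 40) < w) ∧
      (K + 40 : ℤ) ≤ (q 0 m).2 ∧ (q 0 m).2 + (K + 40) < h)
    (hw : 2 * K + 100 < w) (hh : 2 * K + 100 < h) (t : ℕ) :
    (∀ m m', |(q t m).1 - (q 0 m').1| ≤ 3 * recurrenceTime K + 60) ∨
      ¬ Deep (K + 6 * recurrenceTime K + 150) w h (q t) := by
  by_contra hc
  push Not at hc
  obtain ⟨⟨m, m', hm⟩, hd⟩ := hc
  refine absurd ?_ (not_le.2 hm)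
  have hp := T.period
  have hpos : (0 : ℤ) ≤ recurrenceTime K := Int.natCast_nonneg _
  -- every walk far from the walls follows the initial line
  have walk : ∀ r u, W r u → Deep (K + 6 * recurrenceTime K + 100) w h (q r) →
      |∑ m, (q r m).1 - ∑ m, (q 0 m).1| ≤ 4 * (3 * recurrenceTime K + 20) := by
    intro r u hu hr
    rcases T.unit r u hu with rfl | rfl | rfl | rfl
    · have h1 := (S.line_of_north (u₀ := u₀.swap) (by simpa using hW0)
        (fun m => by have := h0 m; simp only [Prod.snd_swap]; omega) hw r hu
        (fun m => by have := hr m; simp only [Prod.snd_swap]; omega)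
        (fun m => by have := hr m; simp only [Prod.fst_swap]; omega)).1
      rcases hu₀ with rfl | rfl <;> simp at h1
    · have h1 := (S.turned.line_of_north (u₀ := -u₀.swap) (by simpa using hW0)
        (fun m => by have := h0 m; simp only [Prod.snd_sub, Prod.snd_swap]; omega) hw r
        (by simpa using hu)
        (fun m => by have := hr m; simp only [Prod.snd_sub, Prod.snd_swap]; omega)
        (fun m => by have := hr m; simp only [Prod.fst_sub, Prod.fst_swap]; omega)).1
      rcases hu₀ with rfl | rfl <;> simp at h1
    · exact (T.line_of_north hW0 (fun m => (h0 m).2) hh r hu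
        (fun m => by have := hr m; omega) (fun m => by have := hr m; omega)).2
    · have h1 := (T.turned.line_of_north (u₀ := -u₀) (by simpa using hW0)
        (fun m => by have := h0 m; simp only [Prod.snd_sub]; omega) hh r (by simpa using hu)
        (fun m => by have := hr m; simp only [Prod.snd_sub]; omega)
        (fun m => by have := hr m; simp only [Prod.fst_sub]; omega)).2
      simp only [Prod.fst_sub, Finset.sum_sub_distrib, sub_sub_sub_cancel_left] at h1
      rwa [abs_sub_comm] at h1
  have finish : ∀ r u, r ≤ t → t < r + p → W r u →
      |(q t m).1 - (q 0 m').1| ≤ 3 * recurrenceTime K + 60 := by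
    intro r u h1 h2 hu
    have h3 := walk r u hu (fun m => by
      have h4 := T.bounds h1 m
      have h5 := hd m
      omega)
    have h4 := T.bounds h1 m
    have near : ∀ s m, 4 * (q s m).1 ≤ ∑ i, (q s i).1 + 12 ∧
        ∑ i, (q s i).1 ≤ 4 * (q s m).1 + 12 := by
      intro s m
      have e0 := (T.near s 0 m).bounds
      have e1 := (T.near s 1 m).bounds
      have e2 := (T.near s 2 m).bounds
      have e3 := (T.near s 3 m).bounds
      rw [Fin.sum_univ_four]
      omega
    have h5 := near r m
    have h6 := near 0 m'
    rw [abs_le] at h3 ⊢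
    omega
  have htd : Deep K w h (q t) := fun m => by
    have := hd m
    omega
  obtain ⟨s, hst, hsd, rfl | ⟨hs0, hns⟩⟩ := run_start htd
  · obtain ⟨n, r, -, h1, h2, h3, -⟩ := T.line hst hW0 hsd
    exact finish r _ h1 h2 h3
  have back : ∀ i, t ≤ i + 4 → i ≤ t → Deep K w h (q i) := by
    intro i h1 h2 m
    have h3 := T.bounds h2 m
    have h4 := hd m
    omega
  rcases T.settle s (hsd s le_rfl hst) with ⟨i, hi, h1⟩ | h1
  · rcases Nat.lt_or_ge t (s + i) with h2 | h2
    · exact absurd (back (s - 1) (by omega) (by omega)) hns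
    · obtain ⟨u, hu⟩ := h1 (fun r a b => hsd r a (by omega))
      obtain ⟨n, r, -, h3, h4, h5, -⟩ := T.line h2 hu (fun r a b => hsd r (by omega) b)
      exact finish r _ h3 h4 h5
  · refine absurd (fun m => ?_) hns
    have h2 := (h1 t hst (fun r a b => hsd r a b.le) m).bounds
    have h3 := T.bounds (show s - 1 ≤ s by omega) m
    have h4 := hd m
    omega

end Trail

/-- Exchanging the coordinates turns a trail into a trail if its motion is symmetric with respect
to the east and west walls too. -/
lemma Trail.swapped {w h K p : ℕ} {q : ℕ → Fin 4 → Cell} {W : ℕ → Cell → Prop}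
    (T : Trail w h K p q W)
    (hs : ∀ (i j : ℕ) (d : ℤ) (π : Equiv.Perm (Fin 4)),
      (∀ m, K ≤ (q i m).2 ∧ (q i m).2 + K < h) → (∀ m, K ≤ (q j m).2 ∧ (q j m).2 + K < h) →
      (∀ m, (q j m).2 = d + (q i (π m)).2 ∧ (q j m).1 = (q i (π m)).1) →
      ∀ m, (q (j + 1) m).2 = d + (q (i + 1) (π m)).2 ∧ (q (j + 1) m).1 = (q (i + 1) (π m)).1)
    (hf : ∀ (i j : ℕ) (d : ℤ) (π : Equiv.Perm (Fin 4)),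
      (∀ m, K ≤ (q i m).2 ∧ (q i m).2 + K < h) → (∀ m, K ≤ (q j m).2 ∧ (q j m).2 + K < h) →
      (∀ m, (q j m).2 = d - (q i (π m)).2 ∧ (q j m).1 = w - 1 - (q i (π m)).1) →
      ∀ m, (q (j + 1) m).2 = d - (q (i + 1) (π m)).2 ∧
        (q (j + 1) m).1 = w - 1 - (q (i + 1) (π m)).1) :
    Trail h w K p (fun t m => (q t m).swap) (fun t u => W t u.swap) := by
  have hd : ∀ t, Deep K h w (fun m => (q t m).swap) ↔ Deep K w h (q t) := by
    intro t
    refine forall_congr' fun m => ?_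
    simp only [Prod.fst_swap, Prod.snd_swap]
    tauto
  have hn : ∀ (L : ℤ) (a b : Cell), Near L a.swap b.swap ↔ Near L a b := fun L a b => and_comm
  constructor
  · intro t m
    have := T.inside t m
    simp only [Prod.fst_swap, Prod.snd_swap]
    tauto
  · exact fun t m m' => (hn _ _ _).2 (T.near t m m')
  · exact fun t m => (hn _ _ _).2 (T.step t m)
  · exact T.period
  · exact hs
  · exact hf
  · intro t u hu
    have := T.unit t _ hu
    obtain ⟨a, b⟩ := u
    simp only [Prod.swap_prod_mk, Prod.mk.injEq] at this ⊢
    omega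
  · exact fun t u u' hu hu' => Prod.swap_injective (T.uniq t _ _ hu hu')
  · intro t u hu hs
    obtain ⟨h1, π, h2⟩ := T.walk t _ hu (fun s a b => (hd s).1 (hs s a b))
    exact ⟨h1, π, fun m => by rw [h2]; rfl⟩
  · intro t u hu s a b hs u'
    exact T.gap t _ hu s a b (fun r a b => (hd r).1 (hs r a b)) _
  · intro t t' u hu hu'
    obtain ⟨π, v, hv⟩ := T.same t t' _ hu hu'
    exact ⟨π, v.swap, fun m => by rw [hv]; rfl⟩
  · intro t t' u hu hu'
    obtain ⟨π, v, hv⟩ := T.opp t t' _ hu hu'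
    exact ⟨π, v.swap, fun m => by rw [hv]; rfl⟩
  · intro t t' u v π hu hv
    exact T.transfer t t' u.swap v.swap π hu fun m => Prod.swap_injective (hv m)
  · intro t ht
    rcases T.settle t ((hd t).1 ht) with ⟨i, hi, h1⟩ | h1
    · refine .inl ⟨i, hi, fun hs => ?_⟩
      obtain ⟨u, hu⟩ := h1 (fun s a b => (hd s).1 (hs s a b))
      exact ⟨u.swap, by rwa [Prod.swap_swap]⟩
    · exact .inr fun t' htt hs m => (hn _ _ _).2 (h1 t' htt (fun s a b => (hd s).1 (hs s a b)) m)

/-! ### The walking tetromino in the field -/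

section
variable (k w h : ℕ)

open Classical in
/-- The frame that the adversary gives to all modules of an MRS near a wall: it is attached to the
wall. What happens in the corners is irrelevant. -/
noncomputable def wallFrame (q : Fin 4 → Cell) : Fin 4 :=
  if ∃ m, (q m).2 < k + 4 then 0
  else if ∃ m, (h : ℤ) ≤ (q m).2 + (k + 4) then 2
  else if ∃ m, (q m).1 < k + 4 then 1 else 3

open Classical in
/-- The frames that the adversary gives to the modules of a tetromino in the field. -/
noncomputable def frameAt (q : Fin 4 → Cell) (m : Fin 4) : Fin 4 :=
  if Deep (k + 4) w h q then frameIn tetromino q m else wallFrame k h q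

/-- One step of a tetromino in the field against the adversary's frames. -/
noncomputable def fieldStep (A : Algorithm k) (q : Fin 4 → Cell) : Fin 4 → Cell :=
  stepOf A (field w h) q (frameAt k w h q)

end

section
variable {k w h : ℕ} {q q' : Fin 4 → Cell}

lemma frameAt_map (hq : Good q) {g : Motion} (π : Equiv.Perm (Fin 4))
    (hqq : ∀ m, q' m = place g (q (π m))) (hg : g.1 = 0 ∨ g.1 = 2)
    (hD : Deep (k + 4) w h q' ↔ Deep (k + 4) w h q)
    (hwall : ¬ Deep (k + 4) w h q → wallFrame k h q' = g.1 + wallFrame k h q) (m : Fin 4) :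
    frameAt k w h q' m = g.1 + frameAt k w h q (π m) := by
  unfold frameAt
  by_cases hd : Deep (k + 4) w h q
  · rw [if_pos hd, if_pos (hD.2 hd)]
    refine frameIn_zero tetromino_rigid g π hqq ?_ m
    rcases hg with hg | hg
    · exact .inl hg
    · rcases tetromino_classification hq with hx | ⟨σ, z, hσ, hz⟩
      · exact .inr (.inl hx)
      · exact .inr (.inr ⟨hg, hσ.offCentre hq.injective hz⟩)
  · rw [if_neg hd, if_neg (fun h => hd (hD.1 h))]
    exact hwall hd

lemma fieldStep_map (A : Algorithm k) (hq : Good q) (g : Motion) (π : Equiv.Perm (Fin 4))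
    (hqq : ∀ m, q' m = place g (q (π m))) (hg : g.1 = 0 ∨ g.1 = 2)
    (hD : Deep (k + 4) w h q' ↔ Deep (k + 4) w h q)
    (hwall : ¬ Deep (k + 4) w h q → wallFrame k h q' = g.1 + wallFrame k h q)
    (hw : ∀ m c, Near (k + 3) c (q m) → (IsWall w h (place g c) ↔ IsWall w h c) ∧
      (InField w h (place g c) ↔ InField w h c)) (m : Fin 4) :
    fieldStep k w h A q' m = place g (fieldStep k w h A q (π m)) :=
  step_equivariant A (by simp) hq.linked g π hqq (frameAt_map hq π hqq hg hD hwall)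
    (fun m c hc => (hw m c (hc.mono (by omega))).1)
    (fun m c hc => (hw m c (hc.mono (by omega))).2) m

lemma Good.near_three (hq : Good q) (m m' : Fin 4) : Near 3 (q m) (q m') := by
  simpa using hq.linked.near m m'

lemma exists_perm {P : Cell → Prop} {g : Motion} (π : Equiv.Perm (Fin 4))
    (hqq : ∀ m, q' m = place g (q (π m))) : (∃ m, P (q' m)) ↔ ∃ m, P (place g (q m)) := by
  simp only [hqq]
  exact ⟨fun ⟨m, hm⟩ => ⟨π m, hm⟩, fun ⟨m, hm⟩ => ⟨π.symm m, by simpa using hm⟩⟩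

lemma forall_perm {P : Cell → Prop} {g : Motion} (π : Equiv.Perm (Fin 4))
    (hqq : ∀ m, q' m = place g (q (π m))) : (∀ m, P (q' m)) ↔ ∀ m, P (place g (q m)) := by
  simp only [hqq]
  exact ⟨fun hm m => by simpa using hm (π.symm m), fun hm m => hm _⟩

lemma place_zero_mk (a b : ℤ) (c : Cell) : place (0, (a, b)) c = (a + c.1, b + c.2) := rfl

lemma place_two_mk (a b : ℤ) (c : Cell) : place (2, (a, b)) c = (a - c.1, b - c.2) := by
  rw [place_two]; rfl

lemma fieldStep_shift (A : Algorithm k) (hq : Good q) (d : ℤ) (π : Equiv.Perm (Fin 4))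
    (hx : XFar (k + 4) w q) (hx' : XFar (k + 4) w q')
    (he : ∀ m, q' m = place (0, (d, 0)) (q (π m))) (m : Fin 4) :
    fieldStep k w h A q' m = place (0, (d, 0)) (fieldStep k w h A q (π m)) := by
  have hx'' := (forall_perm (P := fun c => (k + 4 : ℤ) ≤ c.1 ∧ c.1 + (k + 4) < w) π he).1 hx'
  simp only [place_zero_mk] at hx''
  refine fieldStep_map A hq _ π he (.inl rfl) ?_ ?_ ?_ m
  · refine (forall_perm (P := fun c => (k + 4 : ℤ) ≤ c.1 ∧ c.1 + (k + 4) < w ∧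
      (k + 4 : ℤ) ≤ c.2 ∧ c.2 + (k + 4) < h) π he).trans (forall_congr' fun m => ?_)
    have h1 := hx m
    have h2 := hx'' m
    simp only [place_zero_mk]
    omega
  · intro _
    have e1 := exists_perm (P := fun c => c.2 < k + 4) π he
    have e2 := exists_perm (P := fun c => (h : ℤ) ≤ c.2 + (k + 4)) π he
    have e3 : ¬ ∃ m, (q m).1 < k + 4 := by push Not; exact fun m => (hx m).1
    have e3' : ¬ ∃ m, (q' m).1 < k + 4 := by push Not; exact fun m => (hx' m).1
    simp only [place_zero_mk, zero_add] at e1 e2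
    unfold wallFrame
    simp only [e1, e2, e3, e3', zero_add]
  · intro m c hc
    have h1 := hx m
    have h2 := hx'' m
    have h3 := hc.bounds
    simp only [place_zero_mk, IsWall, InField]
    omega

lemma fieldStep_flip (A : Algorithm k) (hq : Good q) (d : ℤ) (π : Equiv.Perm (Fin 4))
    (hx : XFar (k + 4) w q) (hx' : XFar (k + 4) w q') (hh : 2 * (k + 4) + 4 < h)
    (he : ∀ m, q' m = place (2, (d, (h : ℤ) - 1)) (q (π m))) (m : Fin 4) :
    fieldStep k w h A q' m = place (2, (d, (h : ℤ) - 1)) (fieldStep k w h A q (π m)) := by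
  have hx'' := (forall_perm (P := fun c => (k + 4 : ℤ) ≤ c.1 ∧ c.1 + (k + 4) < w) π he).1 hx'
  simp only [place_two_mk] at hx''
  refine fieldStep_map A hq _ π he (.inr rfl) ?_ ?_ ?_ m
  · refine (forall_perm (P := fun c => (k + 4 : ℤ) ≤ c.1 ∧ c.1 + (k + 4) < w ∧
      (k + 4 : ℤ) ≤ c.2 ∧ c.2 + (k + 4) < h) π he).trans (forall_congr' fun m => ?_)
    have h1 := hx m
    have h2 := hx'' m
    simp only [place_two_mk]
    omega
  · intro hnd
    have e1 := exists_perm (P := fun c => c.2 < k + 4) π he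
    have e2 := exists_perm (P := fun c => (h : ℤ) ≤ c.2 + (k + 4)) π he
    simp only [place_two_mk] at e1 e2
    have e1' : (∃ m, (q' m).2 < k + 4) ↔ ∃ m, (h : ℤ) ≤ (q m).2 + (k + 4) :=
      e1.trans (exists_congr fun m => by omega)
    have e2' : (∃ m, (h : ℤ) ≤ (q' m).2 + (k + 4)) ↔ ∃ m, (q m).2 < k + 4 :=
      e2.trans (exists_congr fun m => by omega)
    unfold wallFrame
    simp only [e1', e2']
    by_cases hb : ∃ m, (q m).2 < k + 4
    · have ht : ¬ ∃ m, (h : ℤ) ≤ (q m).2 + (k + 4) := by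
        rintro ⟨m, hm⟩
        obtain ⟨m', hm'⟩ := hb
        have := (hq.near_three m m').bounds
        omega
      simp only [hb, ht, if_true, if_false]
      rfl
    · have ht : ∃ m, (h : ℤ) ≤ (q m).2 + (k + 4) := by
        by_contra hc
        push Not at hb hc
        refine hnd fun m => ?_
        have h1 := hx m
        have h2 := hb m
        have h3 := hc m
        omega
      simp only [hb, ht, if_true, if_false]
      rfl
  · intro m c hc
    have h1 := hx m
    have h2 := hx'' m
    have h3 := hc.bounds
    simp only [place_two_mk, IsWall, InField]
    omega

lemma fieldStep_shift' (A : Algorithm k) (hq : Good q) (d : ℤ) (π : Equiv.Perm (Fin 4))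
    (hx : ∀ m, k + 4 ≤ (q m).2 ∧ (q m).2 + (k + 4) < h)
    (hx' : ∀ m, k + 4 ≤ (q' m).2 ∧ (q' m).2 + (k + 4) < h)
    (he : ∀ m, q' m = place (0, (0, d)) (q (π m))) (m : Fin 4) :
    fieldStep k w h A q' m = place (0, (0, d)) (fieldStep k w h A q (π m)) := by
  have hx'' := (forall_perm (P := fun c => (k + 4 : ℤ) ≤ c.2 ∧ c.2 + (k + 4) < h) π he).1 hx'
  simp only [place_zero_mk] at hx''
  refine fieldStep_map A hq _ π he (.inl rfl) ?_ ?_ ?_ m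
  · refine (forall_perm (P := fun c => (k + 4 : ℤ) ≤ c.1 ∧ c.1 + (k + 4) < w ∧
      (k + 4 : ℤ) ≤ c.2 ∧ c.2 + (k + 4) < h) π he).trans (forall_congr' fun m => ?_)
    have h1 := hx m
    have h2 := hx'' m
    simp only [place_zero_mk]
    omega
  · intro _
    have e1 : ¬ ∃ m, (q m).2 < k + 4 := by push Not; exact fun m => (hx m).1
    have e1' : ¬ ∃ m, (q' m).2 < k + 4 := by push Not; exact fun m => (hx' m).1
    have e2 : ¬ ∃ m, (h : ℤ) ≤ (q m).2 + (k + 4) := by push Not; exact fun m => (hx m).2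
    have e2' : ¬ ∃ m, (h : ℤ) ≤ (q' m).2 + (k + 4) := by push Not; exact fun m => (hx' m).2
    have e3 := exists_perm (P := fun c => c.1 < k + 4) π he
    simp only [place_zero_mk, zero_add] at e3
    unfold wallFrame
    simp only [e1, e1', e2, e2', e3, zero_add]
  · intro m c hc
    have h1 := hx m
    have h2 := hx'' m
    have h3 := hc.bounds
    simp only [place_zero_mk, IsWall, InField]
    omega

lemma fieldStep_flip' (A : Algorithm k) (hq : Good q) (d : ℤ) (π : Equiv.Perm (Fin 4))
    (hx : ∀ m, k + 4 ≤ (q m).2 ∧ (q m).2 + (k + 4) < h)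
    (hx' : ∀ m, k + 4 ≤ (q' m).2 ∧ (q' m).2 + (k + 4) < h) (hw : 2 * (k + 4) + 4 < w)
    (he : ∀ m, q' m = place (2, ((w : ℤ) - 1, d)) (q (π m))) (m : Fin 4) :
    fieldStep k w h A q' m = place (2, ((w : ℤ) - 1, d)) (fieldStep k w h A q (π m)) := by
  have hx'' := (forall_perm (P := fun c => (k + 4 : ℤ) ≤ c.2 ∧ c.2 + (k + 4) < h) π he).1 hx'
  simp only [place_two_mk] at hx''
  refine fieldStep_map A hq _ π he (.inr rfl) ?_ ?_ ?_ m
  · refine (forall_perm (P := fun c => (k + 4 : ℤ) ≤ c.1 ∧ c.1 + (k + 4) < w ∧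
      (k + 4 : ℤ) ≤ c.2 ∧ c.2 + (k + 4) < h) π he).trans (forall_congr' fun m => ?_)
    have h1 := hx m
    have h2 := hx'' m
    simp only [place_two_mk]
    omega
  · intro hnd
    have e1 : ¬ ∃ m, (q m).2 < k + 4 := by push Not; exact fun m => (hx m).1
    have e1' : ¬ ∃ m, (q' m).2 < k + 4 := by push Not; exact fun m => (hx' m).1
    have e2 : ¬ ∃ m, (h : ℤ) ≤ (q m).2 + (k + 4) := by push Not; exact fun m => (hx m).2
    have e2' : ¬ ∃ m, (h : ℤ) ≤ (q' m).2 + (k + 4) := by push Not; exact fun m => (hx' m).2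
    have e3 := exists_perm (P := fun c => c.1 < k + 4) π he
    simp only [place_two_mk] at e3
    have e3' : (∃ m, (q' m).1 < k + 4) ↔ ∃ m, (w : ℤ) ≤ (q m).1 + (k + 4) :=
      e3.trans (exists_congr fun m => by omega)
    unfold wallFrame
    simp only [e1, e1', e2, e2', e3', if_false]
    by_cases hb : ∃ m, (q m).1 < k + 4
    · have ht : ¬ ∃ m, (w : ℤ) ≤ (q m).1 + (k + 4) := by
        rintro ⟨m, hm⟩
        obtain ⟨m', hm'⟩ := hb
        have := (hq.near_three m m').bounds
        omega
      simp only [hb, ht, if_true, if_false]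
      rfl
    · have ht : ∃ m, (w : ℤ) ≤ (q m).1 + (k + 4) := by
        by_contra hc
        push Not at hb hc
        refine hnd fun m => ?_
        have h1 := hx m
        have h2 := hb m
        have h3 := hc m
        omega
      simp only [hb, ht, if_true, if_false]
      rfl
  · intro m c hc
    have h1 := hx m
    have h2 := hx'' m
    have h3 := hc.bounds
    simp only [place_two_mk, IsWall, InField]
    omega

lemma fieldStep_deep (A : Algorithm k) (hq : Good q) (hd : Deep (k + 4) w h q) :
    fieldStep k w h A q = openStep tetromino A q := by
  unfold fieldStep
  rw [step_deep A (by simp) _ hq.linked hd]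
  have : frameAt k w h q = frameIn tetromino q := by
    funext m
    rw [frameAt, if_pos hd]
  rw [this]; rfl

end

section
variable {k w h : ℕ} {A : Algorithm k} {q : ℕ → Fin 4 → Cell}

/-- At time `t` the MRS is an L tetromino, and `u` is the direction of the vector `(0, e)` relative
to it. -/
def WalksAlong (e : ℤ) (q : ℕ → Fin 4 → Cell) (t : ℕ) (u : Cell) : Prop :=
  ∃ g : Motion, Pose tetromino (1, g) (q t) ∧ u = turn g.1 (0, e)

lemma pose_after {f : Fin 3 → Option (Fin 3 × Motion)} (hf : Describes tetromino A f)
    (hq : ∀ t, q (t + 1) = fieldStep k w h A (q t)) (hg : ∀ t, Good (q t)) {t : ℕ} {τ : Fin 3}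
    {g : Motion} (hP : Pose tetromino (τ, g) (q t)) (i : ℕ)
    (hd : ∀ s, t ≤ s → s < t + i → Deep (k + 4) w h (q s)) :
    ∀ y, orbit f τ i = some y → Pose tetromino (y.1, comp g y.2) (q (t + i)) := by
  induction i with
  | zero =>
    intro y hy
    obtain rfl : (τ, (0, 0)) = y := by simpa [orbit] using hy
    rwa [comp_zero]
  | succ i ih =>
    intro y hy
    rw [orbit_succ] at hy
    obtain ⟨x, hx, hxy⟩ := Option.bind_eq_some_iff.1 hy
    obtain ⟨z, hz, rfl⟩ := Option.map_eq_some_iff.1 hxy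
    have h1 := hf.step tetromino_rigid (by simp) (ih (fun s a b => hd s a (by omega)) x hx)
    simp only [follow, hz, Option.map_some, comp_assoc] at h1
    rw [← add_assoc, hq, fieldStep_deep A (hg _) (hd _ (by omega) (by omega))]
    exact h1

lemma sym_after (hq : ∀ t, q (t + 1) = fieldStep k w h A (q t)) (hg : ∀ t, Good (q t))
    {t : ℕ} {σ : Fin 4 → Fin 4} {z : Cell} (hs : SymBy σ z (q t)) {t' : ℕ} (ht : t ≤ t')
    (hd : ∀ s, t ≤ s → s < t' → Deep (k + 4) w h (q s)) : SymBy σ z (q t') := by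
  induction t', ht using Nat.le_induction with
  | base => exact hs
  | succ r hr ih =>
    rw [hq, fieldStep_deep A (hg _) (hd _ hr (by omega))]
    exact openStep_sym tetromino_rigid (by simp) A (hg r) (ih fun s a b => hd s a (by omega))

lemma turn_unit_injective {e : ℤ} (he : e = 1 ∨ e = -1) {r s : Fin 4}
    (h : turn r (0, e) = turn s (0, e)) : r = s := by
  revert r s
  rcases he with rfl | rfl <;> decide

lemma turn_two_add (r : Fin 4) (c : Cell) : turn (2 + r) c = -turn r c := by
  rw [← turn_turn, turn_two]; rfl

lemma trail_of_walks {f : Fin 3 → Option (Fin 3 × Motion)} {p : ℕ} {e : ℤ}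
    (hf : Describes tetromino A f) (hp : p = 2 ∨ p = 3) (he : e = 1 ∨ e = -1)
    (hW : Walks f p e = true) (hq : ∀ t, q (t + 1) = fieldStep k w h A (q t))
    (hg : ∀ t, Good (q t)) (hin : ∀ t m, InField w h (q t m)) (hh : 2 * (k + 4) + 4 < h) :
    Trail w h (k + 4) p q (WalksAlong e q) := by
  simp only [Walks, Bool.and_eq_true, beq_iff_eq, List.all_eq_true, List.any_eq_true,
    List.mem_range, List.mem_finRange, true_implies, Bool.or_eq_true, bne_iff_ne,
    Option.any_eq_true] at hW
  obtain ⟨⟨hper, hgap⟩, hret⟩ := hW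
  have hturn : ∀ g : Motion, comp g (0, (0, e)) = comp (0, turn g.1 (0, e)) g := by
    intro g
    simp [comp, turn_zero, add_comm]
  constructor
  · exact hin
  · exact fun t m m' => (hg t).near_three m m'
  · intro t m
    rw [hq]
    exact step_near A (by simp) _ (hg t).linked _ m
  · omega
  · intro i j d π hi hj hij m
    have := fieldStep_shift (w := w) (h := h) A (hg i) d π
      (by simpa [XFar] using hi) (by simpa [XFar] using hj)
      (fun m => by rw [place_zero_mk]; ext <;> simp [hij m]) m
    rw [← hq, ← hq, place_zero_mk] at this
    rw [this]; simp
  · intro i j d π hi hj hij m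
    have := fieldStep_flip (w := w) (h := h) A (hg i) d π
      (by simpa [XFar] using hi) (by simpa [XFar] using hj) hh
      (fun m => by rw [place_two_mk]; ext <;> simp [hij m]) m
    rw [← hq, ← hq, place_two_mk] at this
    rw [this]; simp
  · rintro t u ⟨g, -, rfl⟩
    generalize g.1 = r
    revert r
    rcases he with rfl | rfl <;> decide
  · rintro t u u' ⟨g, hg1, rfl⟩ ⟨g', hg2, rfl⟩
    have := tetromino_rigid.pose_unique hg1 hg2
    simp only [Prod.mk.injEq, true_and] at this
    rw [this]
  · rintro t u ⟨g, hP, rfl⟩ hd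
    have h1 := pose_after hf hq hg hP p (by simpa using hd) _ hper
    refine ⟨⟨_, h1, by simp [comp]⟩, ?_⟩
    obtain ⟨π, hπ⟩ := h1
    obtain ⟨ρ, hρ⟩ := hP
    refine ⟨π.trans ρ.symm, fun m => ?_⟩
    rw [hπ, hρ]
    simp only [hturn, place_comp, Equiv.trans_apply, Equiv.apply_symm_apply]
    rw [place, turn_zero, add_comm]
  · rintro t u ⟨g, hP, rfl⟩ s hts hsp hd u' ⟨g', hP', -⟩
    rcases hgap (s - t) (by omega) with h0 | ⟨x, hx, hx1⟩
    · omega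
    · have h1 := pose_after hf hq hg hP (s - t) (fun r a b => by
        simpa using hd r a (by omega)) x hx
      rw [Nat.add_sub_cancel' hts.le] at h1
      exact hx1 (congrArg Prod.fst (tetromino_rigid.pose_unique h1 hP'))
  · rintro t t' u ⟨g, ⟨π, hπ⟩, rfl⟩ ⟨g', ⟨ρ, hρ⟩, hu⟩
    have hr := turn_unit_injective he hu
    refine ⟨ρ.trans π.symm, g'.2 - g.2, fun m => ?_⟩
    rw [hπ, hρ]
    simp only [place, Equiv.trans_apply, Equiv.apply_symm_apply, hr]
    abel
  · rintro t t' u ⟨g, ⟨π, hπ⟩, rfl⟩ ⟨g', ⟨ρ, hρ⟩, hu⟩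
    rw [← turn_two_add] at hu
    have hr := turn_unit_injective he hu
    refine ⟨ρ.trans π.symm, g'.2 + g.2, fun m => ?_⟩
    rw [hπ, hρ]
    simp only [place, Equiv.trans_apply, Equiv.apply_symm_apply, ← hr, turn_two_add]
    abel
  · rintro t t' u v π ⟨g, hP, rfl⟩ hv
    refine ⟨_, hP.map (2, v) π (fun m => by rw [hv, place_two]), ?_⟩
    simp only [comp, turn_two_add]
  · intro t ht
    rcases tetromino_classification (hg t) with ⟨⟨τ, g⟩, hP⟩ | ⟨σ, z, hs, -⟩
    · obtain ⟨i, hi, y, hy, hy1⟩ := hret τ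
      refine .inl ⟨i, by omega, fun hd => ⟨_, comp g y.2, ?_, rfl⟩⟩
      have := pose_after hf hq hg hP i (by simpa using hd) y hy
      rwa [hy1] at this
    · refine .inr fun t' htt hd m => ?_
      have n1 := hs.near (by simp) (hg t) m
      have n2 := (sym_after hq hg hs htt (by simpa using hd)).near (by simp) (hg t') m
      rw [abs_le, abs_le] at n1 n2
      constructor <;> rw [abs_le] <;> omega

/-- Against the adversary's frames, a walking tetromino that starts as an L tetromino near `c`
never leaves both the surroundings of the walls and a vertical strip around `c`. -/
lemma exists_strip {f : Fin 3 → Option (Fin 3 × Motion)} {p : ℕ} {e : ℤ}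
    (hf : Describes tetromino A f) (hp : p = 2 ∨ p = 3) (he : e = 1 ∨ e = -1)
    (hW : Walks f p e = true) (c : Cell)
    (hc : k + 50 ≤ c.1 ∧ c.1 + (k + 50) < w ∧ k + 50 ≤ c.2 ∧ c.2 + (k + 50) < h)
    (hw : 2 * k + 110 < w) (hh : 2 * k + 110 < h) :
    ∃ (fr : ℕ → Fin 4 → Fin 4) (q : ℕ → Fin 4 → Cell),
      (∃ x, Pose tetromino x (q 0)) ∧ (∀ m, Near 2 (q 0 m) c) ∧
      (∀ t, q (t + 1) = stepOf A (field w h) (q t) (fr t)) ∧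
      (∀ t, Good (q t)) ∧ (∀ t m, InField w h (q t m)) ∧
      ∀ t, (∀ m, |(q t m).1 - c.1| ≤ 3 * Trail.recurrenceTime (k + 4) + 62) ∨
        ¬ Deep (k + 6 * Trail.recurrenceTime (k + 4) + 154) w h (q t) := by
  set q : ℕ → Fin 4 → Cell := fun t =>
    (fieldStep k w h A)^[t] (fun m => place (0, c) (tetromino 1 m)) with hqdef
  have hq : ∀ t, q (t + 1) = fieldStep k w h A (q t) := fun t => Function.iterate_succ_apply' _ _ _
  have h0 : ∀ m, q 0 m = place (0, c) (tetromino 1 m) := fun m => rfl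
  have hP : Pose tetromino (1, (0, c)) (q 0) := ⟨Equiv.refl _, h0⟩
  clear_value q
  have hg : ∀ t, Good (q t) := by
    intro t
    induction t with
    | zero => exact hP.good tetromino_rigid
    | succ t ih => rw [hq]; exact step_good A _ ih _
  have hnear : ∀ m, Near 2 (q 0 m) c := by
    intro m
    have h1 : Near 2 (tetromino 1 m) (0, 0) := by revert m; unfold Near; decide
    have h2 := (near_place (0, c) _ _ _).2 h1
    rw [← h0] at h2
    have e : place (0, c) (0, 0) = c := by simp only [place, turn_zero]; ext <;> simp
    rwa [e] at h2
  have hin : ∀ t m, InField w h (q t m) := by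
    intro t
    induction t with
    | zero =>
      intro m
      have := (hnear m).bounds
      unfold InField
      omega
    | succ t ih =>
      intro m
      rw [hq]
      exact step_free A (field w h) ih _ m
  have T := trail_of_walks hf hp he hW hq hg hin (by omega)
  have S := T.swapped
    (fun i j d π hi hj hij m => by
      have := fieldStep_shift' (w := w) (h := h) A (hg i) d π
        (by simpa using hi) (by simpa using hj)
        (fun m => by rw [place_zero_mk]; ext <;> simp [hij m]) m
      rw [← hq, ← hq, place_zero_mk] at this
      rw [this]; simp)
    (fun i j d π hi hj hij m => by
      have := fieldStep_flip' (w := w) (h := h) A (hg i) d π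
        (by simpa using hi) (by simpa using hj) (by omega)
        (fun m => by rw [place_two_mk]; ext <;> simp [hij m]) m
      rw [← hq, ← hq, place_two_mk] at this
      rw [this]; simp)
  refine ⟨fun t => frameAt k w h (q t), q, ⟨_, hP⟩, hnear, hq, hg, hin, fun t => ?_⟩
  have h1 := T.near_wall_or_line S (u₀ := (0, e)) ⟨_, hP, by rw [turn_zero]⟩
    (by rcases he with rfl | rfl <;> simp)
    (fun m => by have := (hnear m).bounds; push_cast; omega) (by omega) (by omega) t
  rcases h1 with h1 | h1
  · refine .inl fun m => ?_
    have h2 := h1 m 0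
    have h3 := (hnear 0).bounds
    rw [abs_le] at h2 ⊢
    omega
  · refine .inr fun hd => h1 fun m => ?_
    have := hd m
    push_cast
    omega

end

/-! ### Two MRSs that never meet -/

section
variable {k w h n₁ n₂ : ℕ} {A : Algorithm k}

lemma isInitial_elim {p₁ : Fin n₁ → Cell} {p₂ : Fin n₂ → Cell} (h₁ : Good p₁) (h₂ : Good p₂)
    (i₁ : ∀ m, InField w h (p₁ m)) (i₂ : ∀ m, InField w h (p₂ m)) (hne : ∀ m m', p₁ m ≠ p₂ m') :
    IsInitial w h (Sum.elim p₁ p₂ : Modules n₁ n₂ → Cell) := by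
  refine ⟨?_, h₁.injective.sumElim h₂.injective hne, fun b => (connected_iff_linked _ _).2 ?_⟩
  · rintro (m | m)
    · exact i₁ m
    · exact i₂ m
  · cases b with
    | true =>
      rintro T ⟨a | a, ha, hTa⟩ ⟨b | b, hb, hTb⟩ <;> simp [members] at ha hb
      obtain ⟨x, -, y, -, h3⟩ := h₁.linked (fun m => T (.inl m)) ⟨a, trivial, hTa⟩
        ⟨b, trivial, hTb⟩
      exact ⟨.inl x, rfl, .inl y, rfl, h3⟩
    | false =>
      rintro T ⟨a | a, ha, hTa⟩ ⟨b | b, hb, hTb⟩ <;> simp [members] at ha hb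
      obtain ⟨x, -, y, -, h3⟩ := h₂.linked (fun m => T (.inr m)) ⟨a, trivial, hTa⟩
        ⟨b, trivial, hTb⟩
      exact ⟨.inr x, rfl, .inr y, rfl, h3⟩

lemma image_members (p₁ : Fin n₁ → Cell) (p₂ : Fin n₂ → Cell) :
    (Sum.elim p₁ p₂ : Modules n₁ n₂ → Cell) '' members n₁ n₂ true = Set.range p₁ ∧
    (Sum.elim p₁ p₂ : Modules n₁ n₂ → Cell) '' members n₁ n₂ false = Set.range p₂ := by
  constructor <;> ext c <;> simp [members]

/-- The motion of a single MRS that starts in an admissible state: the state has no rotational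
symmetry unless it consists of two modules. -/
structure Lone {n : ℕ} (A : Algorithm k) (w h : ℕ) (fr : ℕ → Fin n → Fin 4)
    (q : ℕ → Fin n → Cell) : Prop where
  good : Good (q 0)
  asymmetric : n ≠ 2 → ¬ SymmetricState (Set.range (q 0))
  inside : ∀ m, InField w h (q 0 m)
  step : ∀ t, q (t + 1) = stepOf A (field w h) (q t) (fr t)

lemma Lone.unsolvable (hn₁ : 1 ≤ n₁) (hn₂ : 1 ≤ n₂) {fr₁ : ℕ → Fin n₁ → Fin 4}
    {fr₂ : ℕ → Fin n₂ → Fin 4} {q₁ : ℕ → Fin n₁ → Cell} {q₂ : ℕ → Fin n₂ → Cell}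
    (h₁ : Lone A w h fr₁ q₁) (h₂ : Lone A w h fr₂ q₂)
    (hfar : ∀ t m m', ¬ Near (k + 4) (q₁ t m) (q₂ t m')) :
    ∃ init : Modules n₁ n₂ → Cell, IsInitial w h init ∧
      (∀ b : Bool, size n₁ n₂ b ≠ 2 → ¬ SymmetricState (init '' members n₁ n₂ b)) ∧
      ∃ frames : ℕ → Modules n₁ n₂ → Fin 4, ¬ SolvesRendezvous w h A init frames := by
  refine ⟨Sum.elim (q₁ 0) (q₂ 0), isInitial_elim h₁.good h₂.good h₁.inside h₂.inside ?_, ?_, _,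
    not_solves_of_far A hn₁ hn₂ h₁.step h₂.step hfar⟩
  · intro m m' he
    refine hfar 0 m m' ?_
    rw [he]
    constructor <;> simp <;> positivity
  · rintro (_ | _) hb
    · rw [(image_members _ _).2]; exact h₂.asymmetric hb
    · rw [(image_members _ _).1]; exact h₁.asymmetric hb

lemma Trappable.lone {n : ℕ} (hA : Trappable A n) {c : Cell}
    (hc : k + 100 ≤ c.1 ∧ c.1 + (k + 100) < w ∧ k + 100 ≤ c.2 ∧ c.2 + (k + 100) < h) :
    ∃ (fr : ℕ → Fin n → Fin 4) (q : ℕ → Fin n → Cell), Lone A w h fr q ∧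
      ∀ t m, Near 90 (q t m) c := by
  obtain ⟨fr, q, h1, h2, h3, h4⟩ := hA w h c hc
  refine ⟨fr, q, ⟨h1, h2, fun m => ?_, h3⟩, h4⟩
  have := (h4 0 m).bounds
  unfold InField
  omega

/-- The half turn of the field. -/
lemma stepOf_half_turn {q : Fin 4 → Cell} (hq : Good q) (fr : Fin 4 → Fin 4) :
    stepOf A (field w h) (fun m => place (2, ((w : ℤ) - 1, (h : ℤ) - 1)) (q m))
        (fun m => 2 + fr m) =
      fun m => place (2, ((w : ℤ) - 1, (h : ℤ) - 1)) (stepOf A (field w h) q fr m) := by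
  funext m
  refine step_equivariant A (by simp) hq.linked (2, ((w : ℤ) - 1, (h : ℤ) - 1)) (Equiv.refl _)
    (fun _ => rfl) (fun _ => rfl) (fun _ c _ => ?_) (fun _ c _ => ?_) m <;>
  · simp only [field, place_two_mk, IsWall, InField]
    omega

/-- A walking tetromino and a confined MRS that is far from the walls and from the initial line of
the walk. -/
lemma lone_walker_trapped (hA : ¬ Trappable A 4) {n : ℕ} (hn : Trappable A n)
    (hw : 100 * (k + Trail.recurrenceTime (k + 4) + 100) ≤ w)
    (hh : 100 * (k + Trail.recurrenceTime (k + 4) + 100) ≤ h) :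
    ∃ (fr₁ : ℕ → Fin 4 → Fin 4) (fr₂ : ℕ → Fin n → Fin 4) (q₁ : ℕ → Fin 4 → Cell)
      (q₂ : ℕ → Fin n → Cell), Lone A w h fr₁ q₁ ∧ Lone A w h fr₂ q₂ ∧
      ∀ t m m', ¬ Near (k + 4) (q₁ t m) (q₂ t m') := by
  obtain ⟨f, p, e, hf, hp, he, hW⟩ := (trappable_or_walks A).resolve_left hA
  obtain ⟨fr₁, q₁, ⟨x, hx⟩, -, hs, hg, hin, hq₁⟩ := exists_strip (w := w) (h := h) hf hp he hW
    (k + 50, k + 50) (by dsimp only; omega) (by omega) (by omega)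
  set R := Trail.recurrenceTime (k + 4)
  obtain ⟨fr₂, q₂, h₂, hq₂⟩ := hn.lone (w := w) (h := h)
    (c := (10 * (k + R + 100), 10 * (k + R + 100))) (by dsimp only; omega)
  refine ⟨fr₁, fr₂, q₁, q₂, ⟨hg 0, fun _ => hx.not_symmetricState tetromino_rigid, hin 0, hs⟩, h₂,
    fun t m m' hn => ?_⟩
  have h3 := hn.bounds
  have h4 := (hq₂ t m').bounds
  dsimp only at h4
  rcases hq₁ t with h5 | h5
  · have h6 := h5 m
    rw [abs_le] at h6
    dsimp only at h6
    omega
  · refine h5 fun m₀ => ?_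
    have h6 := ((hg t).near_three m₀ m).bounds
    omega

/-- Two walking tetrominoes that are exchanged by the half turn of the field: when one is close to
a wall, the other one is close to the opposite wall. -/
lemma lone_walker_walker (hA : ¬ Trappable A 4)
    (hw : 100 * (k + Trail.recurrenceTime (k + 4) + 100) ≤ w)
    (hh : 100 * (k + Trail.recurrenceTime (k + 4) + 100) ≤ h) :
    ∃ (fr₁ : ℕ → Fin 4 → Fin 4) (fr₂ : ℕ → Fin 4 → Fin 4) (q₁ : ℕ → Fin 4 → Cell)
      (q₂ : ℕ → Fin 4 → Cell), Lone A w h fr₁ q₁ ∧ Lone A w h fr₂ q₂ ∧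
      ∀ t m m', ¬ Near (k + 4) (q₁ t m) (q₂ t m') := by
  obtain ⟨f, p, e, hf, hp, he, hW⟩ := (trappable_or_walks A).resolve_left hA
  obtain ⟨fr, q, ⟨x, hx⟩, -, hs, hg, hin, hq⟩ := exists_strip (w := w) (h := h) hf hp he hW
    (k + 50, k + 50) (by dsimp only; omega) (by omega) (by omega)
  set R := Trail.recurrenceTime (k + 4)
  refine ⟨fr, fun t m => 2 + fr t m, q,
    fun t m => place (2, ((w : ℤ) - 1, (h : ℤ) - 1)) (q t m),
    ⟨hg 0, fun _ => hx.not_symmetricState tetromino_rigid, hin 0, hs⟩,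
    ⟨(hg 0).place _, fun _ => (hx.map _ (Equiv.refl _) (fun _ => rfl)).not_symmetricState
      tetromino_rigid, fun m => ?_, fun t => ?_⟩, fun t m m' hn => ?_⟩
  · have := hin 0 m
    simp only [place_two_mk, InField] at this ⊢
    omega
  · rw [stepOf_half_turn (hg t), hs]
  · have h3 := hn.bounds
    simp only [place_two_mk] at h3
    rcases hq t with h5 | h5
    · have h6 := h5 m
      have h7 := h5 m'
      rw [abs_le] at h6 h7
      dsimp only at h6 h7
      omega
    · refine h5 fun m₀ => ?_
      have h6 := ((hg t).near_three m₀ m).bounds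
      have h7 := ((hg t).near_three m₀ m').bounds
      have h8 := hin t m₀
      unfold InField at h8
      omega

lemma lone_trapped_trapped (h₁ : Trappable A n₁) (h₂ : Trappable A n₂)
    (hw : 100 * (k + 100) ≤ w) (hh : 100 * (k + 100) ≤ h) :
    ∃ (fr₁ : ℕ → Fin n₁ → Fin 4) (fr₂ : ℕ → Fin n₂ → Fin 4) (q₁ : ℕ → Fin n₁ → Cell)
      (q₂ : ℕ → Fin n₂ → Cell), Lone A w h fr₁ q₁ ∧ Lone A w h fr₂ q₂ ∧
      ∀ t m m', ¬ Near (k + 4) (q₁ t m) (q₂ t m') := by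
  obtain ⟨fr₁, q₁, l₁, n₁⟩ := h₁.lone (w := w) (h := h) (c := (k + 100, k + 100))
    (by dsimp only; omega)
  obtain ⟨fr₂, q₂, l₂, n₂⟩ := h₂.lone (w := w) (h := h) (c := (5 * (k + 100), k + 100))
    (by dsimp only; omega)
  refine ⟨fr₁, fr₂, q₁, q₂, l₁, l₂, fun t m m' hn => ?_⟩
  have h3 := (n₁ t m).bounds
  have h4 := (n₂ t m').bounds
  have h5 := hn.bounds
  dsimp only at h3 h4
  omega

lemma trappable_or_eq_four (A : Algorithm k) {n : ℕ} (hn : n < 5) :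
    Trappable A n ∨ n = 4 ∧ ¬ Trappable A 4 := by
  obtain h | rfl | rfl : n < 3 ∨ n = 3 ∨ n = 4 := by omega
  · exact .inl (trappable_of_lt_three A h)
  · exact .inl (trappable_three A)
  · by_cases h : Trappable A 4
    · exact .inl h
    · exact .inr ⟨rfl, h⟩

lemma unsolvable_of_changing_frames (A : Algorithm k) (hn₁ : 1 ≤ n₁) (hn₁' : n₁ < 5)
    (hn₂ : 1 ≤ n₂) (hn₂' : n₂ < 5)
    (hw : 100 * (k + Trail.recurrenceTime (k + 4) + 100) ≤ w)
    (hh : 100 * (k + Trail.recurrenceTime (k + 4) + 100) ≤ h) :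
    ∃ init : Modules n₁ n₂ → Cell, IsInitial w h init ∧
      (∀ b : Bool, size n₁ n₂ b ≠ 2 → ¬ SymmetricState (init '' members n₁ n₂ b)) ∧
      ∃ frames : ℕ → Modules n₁ n₂ → Fin 4, ¬ SolvesRendezvous w h A init frames := by
  rcases trappable_or_eq_four A hn₁' with t₁ | ⟨rfl, t₁⟩ <;>
    rcases trappable_or_eq_four A hn₂' with t₂ | ⟨rfl, t₂⟩
  · obtain ⟨fr₁, fr₂, q₁, q₂, l₁, l₂, hfar⟩ :=
      lone_trapped_trapped (w := w) (h := h) t₁ t₂ (by omega) (by omega)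
    exact l₁.unsolvable hn₁ hn₂ l₂ hfar
  · obtain ⟨fr₁, fr₂, q₁, q₂, l₁, l₂, hfar⟩ := lone_walker_trapped t₂ t₁ hw hh
    exact l₂.unsolvable hn₁ hn₂ l₁ fun t m m' hn => hfar t m' m hn.symm
  · obtain ⟨fr₁, fr₂, q₁, q₂, l₁, l₂, hfar⟩ := lone_walker_trapped t₁ t₂ hw hh
    exact l₁.unsolvable hn₁ hn₂ l₂ hfar
  · obtain ⟨fr₁, fr₂, q₁, q₂, l₁, l₂, hfar⟩ := lone_walker_walker t₁ hw hh
    exact l₁.unsolvable hn₁ hn₂ l₂ hfar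

lemma unsolvable_of_constant_frames (A : Algorithm k) (hn₁ : 1 ≤ n₁) (hn₁' : n₁ < 5)
    (hn₂ : 1 ≤ n₂) (hn₂' : n₂ < 5) (hw : 100 * (k + 100) ≤ w) (hh : 100 * (k + 100) ≤ h) :
    ∃ init : Modules n₁ n₂ → Cell, IsInitial w h init ∧
      ∃ frame : Modules n₁ n₂ → Fin 4, ¬ SolvesRendezvous w h A init (fun _ => frame) := by
  obtain ⟨fr₁, q₁, g₁, s₁, b₁⟩ := row_trapped (w := w) (h := h) A hn₁' (k + 100, k + 100)
    (by dsimp only; omega)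
  obtain ⟨fr₂, q₂, g₂, s₂, b₂⟩ := row_trapped (w := w) (h := h) A hn₂' (5 * (k + 100), k + 100)
    (by dsimp only; omega)
  have hfar : ∀ t m m', ¬ Near (k + 4) (q₁ t m) (q₂ t m') := by
    intro t m m' hn
    have h3 := (b₁ t m).bounds
    have h4 := (b₂ t m').bounds
    have h5 := hn.bounds
    dsimp only at h3 h4
    omega
  refine ⟨Sum.elim (q₁ 0) (q₂ 0), isInitial_elim g₁ g₂ (fun m => ?_) (fun m => ?_) ?_,
    Sum.elim fr₁ fr₂, not_solves_of_far A hn₁ hn₂ s₁ s₂ hfar⟩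
  · have := (b₁ 0 m).bounds
    unfold InField; dsimp only at this; omega
  · have := (b₂ 0 m).bounds
    unfold InField; dsimp only at this; omega
  · intro m m' he
    have h3 := (b₁ 0 m).bounds
    have h4 := (b₂ 0 m').bounds
    rw [he] at h3
    dsimp only at h3 h4
    omega

end

end MRS

theorem theorem3 (k n₁ n₂ : ℕ) (hn₁ : 1 ≤ n₁) (hn₁' : n₁ < 5) (hn₂ : 1 ≤ n₂) (hn₂' : n₂ < 5) :
    ∃ N : ℕ, ∀ w h : ℕ, N ≤ h → h < w → ∀ A : MRS.Algorithm k,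
      (∃ init : MRS.Modules n₁ n₂ → MRS.Cell, MRS.IsInitial w h init ∧
        (∀ b : Bool, MRS.size n₁ n₂ b ≠ 2 →
          ¬ MRS.SymmetricState (init '' MRS.members n₁ n₂ b)) ∧
        ∃ frames : ℕ → MRS.Modules n₁ n₂ → Fin 4,
          ¬ MRS.SolvesRendezvous w h A init frames) ∧
      (∃ init : MRS.Modules n₁ n₂ → MRS.Cell, MRS.IsInitial w h init ∧
        ∃ frame : MRS.Modules n₁ n₂ → Fin 4,
          ¬ MRS.SolvesRendezvous w h A init (fun _ => frame)) :=
  ⟨100 * (k + MRS.Trail.recurrenceTime (k + 4) + 100), fun _ _ hh hw A =>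
    ⟨MRS.unsolvable_of_changing_frames A hn₁ hn₁' hn₂ hn₂' (hh.trans hw.le) hh,
      MRS.unsolvable_of_constant_frames A hn₁ hn₁' hn₂ hn₂' (by omega) (by omega)⟩⟩
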